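/- Let $p$ be a prime, $\kappa$ a finite field of characteristic $p$ and $W=W(\kappa)$. Let $\mathcal G$ be a smooth affine group scheme over $W$ (for instance a reductive one) with special fibre $G=\mathcal G_\kappa$, let $\tilde\mu:\mathbb G_{m,W}\to\mathcal G$ be a cocharacter and $\mu=\tilde\mu\otimes_W\kappa$. *Notation.* For a $W$-algebra $R$ write $\bar R=R/pR$, let $g\mapsto\bar g$ be the map $\mathcal G(R)\to G(\bar R)$ and $K_1(R)$ its kernel. Let $P_+$ (resp. $P_-$) be the subgroup of $G$ of those $g$ for which $\lim_{t\to0}\mu(t)g\mu(t)^{-1}$ (resp. $\lim_{t\to\infty}\mu(t)g\mu(t)^{-1}$) exists; the limit is the Levi component of $g$, an element of the centralizer $P_+\cap P_-$ of $\mu$. Let $\mathsf E_\mu\subseteq P_-\times P_+$ be the group of pairs $(p_-,p_+)$ with the same Levi component, acting on $G^2=G\times G$ by $(p_-,p_+)\cdot(a,b)=(p_-a,p_+b)$. Sheaves are taken for the flat (fppf) topology, on the category $(\mathbf{FlatAlg}/W)$ of flat $W$-algebras or on the category $(\mathbf{Alg}/\kappa)$ of $\kappa$-algebras. Let $\mathsf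 E_\mu\backslash G^2$ be the quotient sheaf on $(\mathbf{Alg}/\kappa)$, and for a sheaf $X$ on $(\mathbf{Alg}/\kappa)$ let $\mathrm{Res}_{\kappa/W}X$ be the functor $R\mapsto X(\bar R)$ on $(\mathbf{FlatAlg}/W)$. Let ${}_1\mathbf C_1^{\tilde\mu}$ be the sheafification on $(\mathbf{FlatAlg}/W)$ of $R\mapsto K_1(R)\backslash\mathcal G(R)\tilde\mu(p)\mathcal G(R)/K_1(R)$, where $\mathcal G(R)\tilde\mu(p)\mathcal G(R)\subseteq\mathcal G(R[1/p])$. For a $\kappa$-algebra $R$ let $L^1G(R)$ be the kernel of $G(R[[t]])\to G(R)$; let $\mathcal C^\mu\subseteq LG=G(-((t)))$ be the sheafification of $R\mapsto G(R[[t]])\mu(t)G(R[[t]])$, and ${}_1\mathcal C_1^\mu=L^1G\backslash\mathcal C^\mu/L^1G$ the quotient sheaf on $(\mathbf{Alg}/\kappa)$. Let $W_{\mathrm{cris}}\subseteq(\mathbf{FlatAlg}/W)$ be the full subcategory of crystalline $W$-algebras, that is, of flat, $p$-adically complete $W$-algebras that admit a ring endomorphism lifting the Frobenius of $\bar R$,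 and let $\kappa_{\mathrm{cris}}\subseteq(\mathbf{Alg}/\kappa)$ be the full subcategory of the $\kappa$-algebras isomorphic to $\bar R$ for some $R\in W_{\mathrm{cris}}$. **Theorem.** 1. For every flat $W$-algebra $R$ the rule $g\tilde\mu(p)h\mapsto(\bar g^{-1},\bar h)$ gives a well-defined injective map, functorial in $R$, $$K_1(R)\backslash\mathcal G(R)\tilde\mu(p)\mathcal G(R)/K_1(R)\longrightarrow\mathsf E_\mu(\bar R)\backslash G^2(\bar R),$$ and this map is bijective if $R$ is $p$-adically complete. 2. There is an isomorphism ${}_1\mathbf C_1^{\tilde\mu}\cong\mathrm{Res}_{\kappa/W}(\mathsf E_\mu\backslash G^2)$ of sheaves on $(\mathbf{FlatAlg}/W)$, sending the class of $g\tilde\mu(p)h$ to the class of $(\bar g^{-1},\bar h)$. 3. There is an isomorphism between the restriction of ${}_1\mathbf C_1^{\tilde\mu}$ to $W_{\mathrm{cris}}$ and the pullback along $W_{\mathrm{cris}}\to\kappa_{\mathrm{cris}}$, $R\mapsto\bar R$, of the restriction of ${}_1\mathcal C_1^\mu$ to $\kappa_{\mathrm{cris}}$, sending the class of $g\tilde\mu(p)h$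 to the class of $\bar g\mu(t)\bar h$. Moreover ${}_1\mathcal C_1^\mu|_{\kappa_{\mathrm{cris}}}$ is, up to isomorphism, the only presheaf of sets on $\kappa_{\mathrm{cris}}$ whose pullback to $W_{\mathrm{cris}}$ is isomorphic to ${}_1\mathbf C_1^{\tilde\mu}|_{W_{\mathrm{cris}}}$. That is, ${}_1\mathbf C_1^{\tilde\mu}|_{W_{\mathrm{cris}}}$ is of reduction along $W_{\mathrm{cris}}\to\kappa_{\mathrm{cris}}$ by ${}_1\mathcal C_1^\mu$. -/

import Mathlib

open CategoryTheory TensorProduct Opposite WithConv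
open scoped LaurentPolynomial Polynomial PowerSeries

universe u

namespace CrisZip

noncomputable section

/-! ### Points of an affine group scheme -/

section Points

variable (W H R : Type u) [CommRing W] [CommRing H] [HopfAlgebra W H] [CommRing R] [Algebra W R]

/-- The set `𝒢(R)` of `R`-valued points of the affine group scheme `𝒢 = Spec H` over `W`, with the
group law coming from the comultiplication of `H` (convolution). -/
abbrev Pt : Type u := WithConv (H →ₐ[W] R)

instance ptGroup : Group (Pt W H R) where
  inv g := toConv (g.ofConv.comp (HopfAlgebra.antipodeAlgHom W H))
  inv_mul_cancel g := by
    apply WithConv.ofConv_injective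
    apply AlgHom.toLinearMap_injective
    have key := congrArg (fun f : WithConv (H →ₐ[W] H) => g.ofConv.comp f.ofConv)
      (AlgHom.antipode_id_cancel (R := W) (A := H))
    simp only [AlgHom.comp_convMul_distrib] at key
    have h1 : g.ofConv.comp (1 : WithConv (H →ₐ[W] H)).ofConv = (1 : Pt W H R).ofConv := by
      ext x
      simp [AlgHom.convOne_def, Algebra.ofId_apply]
    rw [h1] at key
    exact congrArg AlgHom.toLinearMap key

variable {W R} {S T : Type u} [CommRing S] [Algebra W S] [CommRing T] [Algebra W T]

/-- The group homomorphism `𝒢(R) → 𝒢(S)` induced by a homomorphism `R → S` of `W`-algebras. -/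
def Pt.map (f : R →ₐ[W] S) : Pt W H R →* Pt W H S where
  toFun g := toConv (f.comp g.ofConv)
  map_one' := by
    apply WithConv.ofConv_injective
    ext x
    simp [AlgHom.convOne_def, Algebra.ofId_apply]
  map_mul' g h := by
    apply WithConv.ofConv_injective
    exact AlgHom.comp_convMul_distrib f g h

variable {H}

lemma Pt.map_id (g : Pt W H R) : Pt.map H (AlgHom.id W R) g = g := rfl

lemma Pt.map_map (f : R →ₐ[W] S) (f' : S →ₐ[W] T) (g : Pt W H R) :
    Pt.map H f' (Pt.map H f g) = Pt.map H (f'.comp f) g := rfl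

/-- The value `μ(r) ∈ 𝒢(R)` of a cocharacter `μ : 𝔾ₘ → 𝒢` (a homomorphism of group schemes over
`W`, that is, a bialgebra homomorphism `H → W[T, T⁻¹]`) at a unit `r ∈ Rˣ = 𝔾ₘ(R)`. -/
def cocharAt (μ : H →ₐc[W] W[T;T⁻¹]) (r : Rˣ) : Pt W H R :=
  toConv ((AddMonoidAlgebra.lift W R ℤ ((Units.coeHom R).comp (zpowersHom Rˣ r))).comp
    (μ : H →ₐ[W] W[T;T⁻¹]))

lemma map_cocharAt (μ : H →ₐc[W] W[T;T⁻¹]) (f : R →ₐ[W] S) (r : Rˣ) (s : Sˣ) (h : f r = s) :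
    Pt.map H f (cocharAt μ r) = cocharAt μ s := by
  obtain rfl : Units.map (f : R →* S) r = s := Units.ext h
  apply WithConv.ofConv_injective
  change f.comp (AlgHom.comp _ _) = AlgHom.comp _ _
  rw [← AlgHom.comp_assoc]
  congr 1
  apply AddMonoidAlgebra.algHom_ext'
  · ext
    simp only [MonoidHom.coe_comp, MonoidHom.coe_coe, Function.comp_apply, AlgHom.comp_apply,
      AddMonoidAlgebra.of_apply, AddMonoidAlgebra.lift_single]
    simp
  · exact Subsingleton.elim _ _

end Points

/-! ### The zip group and its quotient -/

section Zip

variable {W H : Type u} (R : Type u) {S : Type u} [CommRing W] [CommRing H] [HopfAlgebra W H]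
  [CommRing R] [Algebra W R] [CommRing S] [Algebra W S] (μ : H →ₐc[W] W[T;T⁻¹])

/-- The coordinate `T` of `𝔾ₘ` over `R`, as a unit of `R[T, T⁻¹]`. -/
def unitT : (R[T;T⁻¹])ˣ where
  val := LaurentPolynomial.T 1
  inv := LaurentPolynomial.T (-1)
  val_inv := by rw [← LaurentPolynomial.T_add]; simp
  inv_val := by rw [← LaurentPolynomial.T_add]; simp

variable {R}

/-- `HasLimit μ τ g m`, for `τ = T` or `τ = T⁻¹`: the morphism `T ↦ μ(τ) g μ(τ)⁻¹` from `𝔾ₘ` to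
`𝒢` over `R` extends to a morphism from the affine line to `𝒢`, whose value at `T = 0` is `m`. So
`HasLimit μ T g m` says that `lim_{t → 0} μ(t) g μ(t)⁻¹ = m`, and `HasLimit μ T⁻¹ g m` says that
`lim_{t → ∞} μ(t) g μ(t)⁻¹ = m`. -/
def HasLimit (τ : (R[T;T⁻¹])ˣ) (g m : Pt W H R) : Prop :=
  ∃ γ : Pt W H R[X],
    Pt.map H ((Polynomial.toLaurentAlg (R := R)).restrictScalars W) γ =
      cocharAt μ τ * Pt.map H (IsScalarTower.toAlgHom W R R[T;T⁻¹]) g * (cocharAt μ τ)⁻¹ ∧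
    Pt.map H ((Polynomial.aeval (R := R) (0 : R)).restrictScalars W) γ = m

variable {μ}

lemma HasLimit.one (τ : (R[T;T⁻¹])ˣ) : HasLimit μ τ (1 : Pt W H R) 1 :=
  ⟨1, by simp, by simp⟩

lemma HasLimit.mul {τ : (R[T;T⁻¹])ˣ} {g m g' m' : Pt W H R} (h : HasLimit μ τ g m)
    (h' : HasLimit μ τ g' m') : HasLimit μ τ (g * g') (m * m') := by
  obtain ⟨γ, h1, h2⟩ := h
  obtain ⟨γ', h1', h2'⟩ := h'
  refine ⟨γ * γ', ?_, by rw [map_mul, h2, h2']⟩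
  rw [map_mul, h1, h1', map_mul]
  group

lemma HasLimit.inv {τ : (R[T;T⁻¹])ˣ} {g m : Pt W H R} (h : HasLimit μ τ g m) :
    HasLimit μ τ g⁻¹ m⁻¹ := by
  obtain ⟨γ, h1, h2⟩ := h
  refine ⟨γ⁻¹, ?_, by rw [map_inv, h2]⟩
  rw [map_inv, h1, map_inv]
  group

lemma HasLimit.map {τ : (R[T;T⁻¹])ˣ} {τ' : (S[T;T⁻¹])ˣ} {g m : Pt W H R} (f : R →ₐ[W] S)
    (hτ : AddMonoidAlgebra.mapAlgHom ℤ f (τ : R[T;T⁻¹]) = τ')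
    (h : HasLimit μ τ g m) : HasLimit μ τ' (Pt.map H f g) (Pt.map H f m) := by
  obtain ⟨γ, h1, h2⟩ := h
  refine ⟨Pt.map H (Polynomial.mapAlgHom f) γ, ?_, ?_⟩
  · have e : ((Polynomial.toLaurentAlg (R := S)).restrictScalars W).comp (Polynomial.mapAlgHom f)
        = (AddMonoidAlgebra.mapAlgHom ℤ f).comp
          ((Polynomial.toLaurentAlg (R := R)).restrictScalars W) := by
      ext x n
      · by_cases hn : n = 0 <;> simp [hn]
      · simp
    have e' : (AddMonoidAlgebra.mapAlgHom ℤ f).comp (IsScalarTower.toAlgHom W R R[T;T⁻¹])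
        = (IsScalarTower.toAlgHom W S S[T;T⁻¹]).comp f := by
      ext x n
      by_cases hn : n = 0 <;> simp [hn]
    rw [Pt.map_map, e, ← Pt.map_map, h1, map_mul, map_mul, map_inv, map_cocharAt μ _ τ τ' hτ,
      Pt.map_map, e', Pt.map_map]
  · rw [← h2, Pt.map_map, Pt.map_map]
    congr 2
    ext x
    · simp
    · simp

variable (μ R)

/-- The `R`-valued points of the zip group `E_μ ⊆ P₋ × P₊`: pairs `(p₋, p₊)` that have the same
Levi component. Here `P₊(R)` (resp. `P₋(R)`) consists of the `g ∈ 𝒢(R)` such that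
`lim_{t → 0} μ(t) g μ(t)⁻¹` (resp. `lim_{t → ∞} μ(t) g μ(t)⁻¹`) exists, and the limit is the
component of `g` in the common Levi subgroup `P₊ ∩ P₋`, the centralizer of `μ`. -/
def zipGroup : Subgroup (Pt W H R × Pt W H R) where
  carrier := {x | ∃ m, HasLimit μ (unitT R)⁻¹ x.1 m ∧ HasLimit μ (unitT R) x.2 m}
  one_mem' := ⟨1, HasLimit.one _, HasLimit.one _⟩
  mul_mem' := fun ⟨m, h1, h2⟩ ⟨m', h1', h2'⟩ => ⟨m * m', h1.mul h1', h2.mul h2'⟩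
  inv_mem' := fun ⟨m, h1, h2⟩ => ⟨m⁻¹, h1.inv, h2.inv⟩

/-- The set `E_μ(R) \ (𝒢(R) × 𝒢(R))`, the quotient by left multiplication. -/
def ZipQuot : Type u := Quotient (QuotientGroup.rightRel (zipGroup R μ))

variable {R}

/-- The class of `(a, b)` in `E_μ(R) \ (𝒢(R) × 𝒢(R))`. -/
def ZipQuot.mk (x : Pt W H R × Pt W H R) : ZipQuot R μ :=
  Quotient.mk (QuotientGroup.rightRel (zipGroup R μ)) x

lemma zipGroup_map (f : R →ₐ[W] S) {x : Pt W H R × Pt W H R} (hx : x ∈ zipGroup R μ) :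
    (Pt.map H f x.1, Pt.map H f x.2) ∈ zipGroup S μ := by
  obtain ⟨m, h1, h2⟩ := hx
  refine ⟨Pt.map H f m, h1.map f ?_, h2.map f ?_⟩
  · exact (AddMonoidAlgebra.mapAlgHom_single f _ _).trans (by rw [map_one]; rfl)
  · exact (AddMonoidAlgebra.mapAlgHom_single f _ _).trans (by rw [map_one]; rfl)

/-- The map on quotients induced by a homomorphism `R → S` of `W`-algebras. -/
def ZipQuot.map (f : R →ₐ[W] S) : ZipQuot R μ → ZipQuot S μ :=
  Quotient.map (fun x => (Pt.map H f x.1, Pt.map H f x.2)) (by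
    intro x y h
    have h' := QuotientGroup.rightRel_apply.mp h
    apply QuotientGroup.rightRel_apply.mpr
    have := zipGroup_map μ f h'
    simpa using this)

end Zip

/-! ### Double quotients -/

section DoubleQuot

variable {Γ Γ' : Type u} [Group Γ] [Group Γ']

/-- The equivalence relation on a subset `C` of a group for which `x` and `y` are equivalent if
`y = k x k'` for some `k, k'` in the subgroup `K`. -/
def dcSetoid (K : Subgroup Γ) (C : Set Γ) : Setoid C where
  r x y := ∃ k ∈ K, ∃ k' ∈ K, (y : Γ) = k * x * k'
  iseqv :=
    { refl := fun x => ⟨1, K.one_mem, 1, K.one_mem, by simp⟩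
      symm := by
        rintro x y ⟨k, hk, k', hk', h⟩
        exact ⟨k⁻¹, K.inv_mem hk, k'⁻¹, K.inv_mem hk', by rw [h]; group⟩
      trans := by
        rintro x y z ⟨k, hk, k', hk', h⟩ ⟨l, hl, l', hl', h'⟩
        exact ⟨l * k, K.mul_mem hl hk, k' * l', K.mul_mem hk' hl', by rw [h', h]; group⟩ }

/-- The double quotient `K \ C / K` of a subset `C` of a group by a subgroup `K`. -/
def DoubleQuot (K : Subgroup Γ) (C : Set Γ) : Type u := Quotient (dcSetoid K C)

/-- The class of an element of `C` in `K \ C / K`. -/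
def DoubleQuot.mk (K : Subgroup Γ) {C : Set Γ} (x : Γ) (hx : x ∈ C) : DoubleQuot K C :=
  Quotient.mk (dcSetoid K C) ⟨x, hx⟩

/-- The map of double quotients induced by a group homomorphism. -/
def DoubleQuot.map {K : Subgroup Γ} {C : Set Γ} {K' : Subgroup Γ'} {C' : Set Γ'} (φ : Γ →* Γ')
    (hK : ∀ k ∈ K, φ k ∈ K') (hC : ∀ x ∈ C, φ x ∈ C') : DoubleQuot K C → DoubleQuot K' C' :=
  Quotient.map (fun x => ⟨φ x, hC x x.2⟩) (by
    rintro x y ⟨k, hk, k', hk', h⟩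
    exact ⟨φ k, hK k hk, φ k', hK k' hk', by simp [h]⟩)

end DoubleQuot

/-! ### The cells `𝒢(A) μ(a) 𝒢(A) ⊆ 𝒢(A[1/a])` -/

section Cell

variable {W H : Type u} {A B D : Type u} [CommRing W] [CommRing H] [HopfAlgebra W H]
  [CommRing A] [Algebra W A] [CommRing B] [Algebra W B] [CommRing D] [Algebra W D]
  (μ : H →ₐc[W] W[T;T⁻¹])

/-- The homomorphism `𝒢(A) → 𝒢(A[1/a])`. -/
def toLoc (a : A) : Pt W H A →* Pt W H (Localization.Away a) :=
  Pt.map H (IsScalarTower.toAlgHom W A (Localization.Away a))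

/-- The element `a` as a unit of `A[1/a]`. -/
def unitAway (a : A) : (Localization.Away a)ˣ :=
  (IsLocalization.Away.algebraMap_isUnit (S := Localization.Away a) a).unit

/-- The element `g μ(a) h` of `𝒢(A[1/a])`, for `g, h ∈ 𝒢(A)`. -/
def cellElt (a : A) (g h : Pt W H A) : Pt W H (Localization.Away a) :=
  toLoc a g * cocharAt μ (unitAway a) * toLoc a h

/-- The subset `𝒢(A) μ(a) 𝒢(A)` of `𝒢(A[1/a])`. -/
def cell (a : A) : Set (Pt W H (Localization.Away a)) :=
  {x | ∃ g h : Pt W H A, x = cellElt μ a g h}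

lemma cellElt_mem (a : A) (g h : Pt W H A) : cellElt μ a g h ∈ cell μ a := ⟨g, h, rfl⟩

/-- The homomorphism `A[1/a] → B[1/b]` induced by a homomorphism `f : A → B` with `f a = b`. -/
def locMap (f : A →ₐ[W] B) {a : A} {b : B} (h : f a = b) :
    Localization.Away a →ₐ[W] Localization.Away b :=
  IsLocalization.liftAlgHom (M := Submonoid.powers a)
    (f := (IsScalarTower.toAlgHom W B (Localization.Away b)).comp f) (by
      rintro ⟨_, n, rfl⟩
      simp only [AlgHom.comp_apply, map_pow, h]
      exact (IsLocalization.Away.algebraMap_isUnit b).pow n)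

lemma locMap_algebraMap (f : A →ₐ[W] B) {a : A} {b : B} (h : f a = b) (x : A) :
    locMap f h (algebraMap A _ x) = algebraMap B _ (f x) := by
  simp [locMap]

lemma locMap_id (a : A) : locMap (AlgHom.id W A) (rfl : AlgHom.id W A a = a) = AlgHom.id W _ := by
  apply AlgHom.coe_ringHom_injective
  apply IsLocalization.ringHom_ext (Submonoid.powers a)
  ext x
  exact locMap_algebraMap (AlgHom.id W A) (rfl : AlgHom.id W A a = a) x

lemma locMap_comp (f : A →ₐ[W] B) (f' : B →ₐ[W] D) {a : A} {b : B} {d : D} (h : f a = b)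
    (h' : f' b = d) (h'' : (f'.comp f) a = d) :
    (locMap f' h').comp (locMap f h) = locMap (f'.comp f) h'' := by
  apply AlgHom.coe_ringHom_injective
  apply IsLocalization.ringHom_ext (Submonoid.powers a)
  ext x
  change locMap f' h' (locMap f h (algebraMap A _ x)) = locMap (f'.comp f) h'' (algebraMap A _ x)
  rw [locMap_algebraMap, locMap_algebraMap, locMap_algebraMap]
  rfl

lemma map_toLoc (f : A →ₐ[W] B) {a : A} {b : B} (h : f a = b) (g : Pt W H A) :
    Pt.map H (locMap f h) (toLoc a g) = toLoc b (Pt.map H f g) := by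
  have e : (locMap f h).comp (IsScalarTower.toAlgHom W A (Localization.Away a)) =
      (IsScalarTower.toAlgHom W B (Localization.Away b)).comp f := by
    ext x
    exact locMap_algebraMap f h x
  simp only [toLoc, Pt.map_map, e]

lemma map_cellElt (f : A →ₐ[W] B) {a : A} {b : B} (h : f a = b) (g g' : Pt W H A) :
    Pt.map H (locMap f h) (cellElt μ a g g') = cellElt μ b (Pt.map H f g) (Pt.map H f g') := by
  simp only [cellElt, map_mul, map_toLoc]
  rw [map_cocharAt μ (locMap f h) (unitAway a) (unitAway b)]
  exact (locMap_algebraMap f h a).trans (by rw [h]; rfl)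

lemma map_mem_cell (f : A →ₐ[W] B) {a : A} {b : B} (h : f a = b)
    {x : Pt W H (Localization.Away a)} (hx : x ∈ cell μ a) :
    Pt.map H (locMap f h) x ∈ cell μ b := by
  obtain ⟨g, g', rfl⟩ := hx
  exact ⟨_, _, map_cellElt μ f h g g'⟩

variable (H) in
/-- The image in `𝒢(A[1/a])` of the kernel of `𝒢(A) → 𝒢(B)`, for a homomorphism `q : A → B`. -/
def kerLoc (a : A) (q : A →ₐ[W] B) : Subgroup (Pt W H (Localization.Away a)) :=
  (Pt.map H q).ker.map (toLoc a)

lemma map_mem_kerLoc {A' B' : Type u} [CommRing A'] [Algebra W A'] [CommRing B'] [Algebra W B']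
    {a : A} {q : A →ₐ[W] B} {a' : A'} {q' : A' →ₐ[W] B'} (f : A →ₐ[W] A') (h : f a = a')
    (f' : B →ₐ[W] B') (hq : q'.comp f = f'.comp q)
    {x : Pt W H (Localization.Away a)} (hx : x ∈ kerLoc H a q) :
    Pt.map H (locMap f h) x ∈ kerLoc H a' q' := by
  obtain ⟨k, hk, rfl⟩ := hx
  refine ⟨Pt.map H f k, ?_, (map_toLoc f h k).symm⟩
  have hk' : Pt.map H q k = 1 := hk
  change Pt.map H q' (Pt.map H f k) = 1
  rw [Pt.map_map, hq, ← Pt.map_map, hk', map_one]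

end Cell

/-! ### Sites of algebras and sheafification -/

section Sites

variable {W : Type u} [CommRing W]

lemma mem_range_comap_includeLeft {R S T : Type u} [CommRing R] [CommRing S] [CommRing T]
    [Algebra R S] [Algebra R T] (q : PrimeSpectrum S)
    (h : PrimeSpectrum.comap (algebraMap R S) q ∈
      Set.range (PrimeSpectrum.comap (algebraMap R T))) :
    q ∈ Set.range (PrimeSpectrum.comap (algebraMap S (S ⊗[R] T))) := by
  let p := PrimeSpectrum.comap (algebraMap R S) q
  let k := p.asIdeal.ResidueField
  let l := q.asIdeal.ResidueField
  rw [← PrimeSpectrum.nontrivial_iff_mem_rangeComap] at h ⊢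
  let φ : k →ₐ[R] l := Ideal.ResidueField.mapₐ p.asIdeal q.asIdeal (Algebra.ofId R S) rfl
  let : Algebra k l := φ.toRingHom.toAlgebra
  have : IsScalarTower R k l := IsScalarTower.of_algebraMap_eq' φ.comp_algebraMap.symm
  have : Nontrivial (k ⊗[R] T) := h
  have h1 : Nontrivial (l ⊗[k] (k ⊗[R] T)) := inferInstance
  have h2 : Nontrivial (l ⊗[R] T) :=
    (TensorProduct.AlgebraTensorModule.cancelBaseChange R k k l T).injective.nontrivial
  exact (TensorProduct.AlgebraTensorModule.cancelBaseChange R S S l T).symm.injective.nontrivial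

/-- The flat (fppf) topology on the opposite of a full subcategory `P` of the category of
`W`-algebras that is closed under flat extensions: a sieve is covering if it contains a finite
family of flat homomorphisms of finite presentation `R → R_i` such that `Spec R` is the union of
the images of the `Spec R_i`. -/
def fppf (P : ObjectProperty (CommAlgCat.{u} W))
    (hP : ∀ {R S : CommAlgCat.{u} W} (f : R ⟶ S), P R → f.hom.toRingHom.Flat → P S) :
    GrothendieckTopology P.FullSubcategoryᵒᵖ where
  sieves X := {𝒮 | ∃ (I : Type) (_ : Finite I) (Y : I → P.FullSubcategory)
    (f : ∀ i, X.unop ⟶ Y i),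
      (∀ i, (f i).hom.hom.toRingHom.Flat ∧ (f i).hom.hom.toRingHom.FinitePresentation) ∧
      (∀ q : PrimeSpectrum X.unop.obj, ∃ i,
        q ∈ Set.range (PrimeSpectrum.comap (f i).hom.hom.toRingHom)) ∧
      ∀ i, 𝒮.arrows (f i).op}
  top_mem' X := ⟨Unit, inferInstance, fun _ => X.unop, fun _ => 𝟙 _,
    fun _ => ⟨RingHom.Flat.id _, RingHom.FinitePresentation.id _⟩,
    fun q => ⟨(), q, rfl⟩, fun _ => trivial⟩
  pullback_stable' := by
    rintro X Z 𝒮 g ⟨I, hI, Y, f, hf, hs, hm⟩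
    let : Algebra X.unop.obj Z.unop.obj := g.unop.hom.hom.toRingHom.toAlgebra
    have : IsScalarTower W X.unop.obj Z.unop.obj :=
      IsScalarTower.of_algebraMap_eq' g.unop.hom.hom.comp_algebraMap.symm
    let (i : I) : Algebra X.unop.obj (Y i).obj := (f i).hom.hom.toRingHom.toAlgebra
    have (i : I) : IsScalarTower W X.unop.obj (Y i).obj :=
      IsScalarTower.of_algebraMap_eq' (f i).hom.hom.comp_algebraMap.symm
    let in₁ (i : I) : Z.unop.obj ⟶ CommAlgCat.of W (Z.unop.obj ⊗[X.unop.obj] (Y i).obj) :=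
      CommAlgCat.ofHom Algebra.TensorProduct.includeLeft
    let in₂ (i : I) : (Y i).obj ⟶ CommAlgCat.of W (Z.unop.obj ⊗[X.unop.obj] (Y i).obj) :=
      CommAlgCat.ofHom (Algebra.TensorProduct.includeRight.restrictScalars W)
    have flat (i : I) : (in₁ i).hom.toRingHom.Flat :=
      RingHom.Flat.isStableUnderBaseChange.tensorProduct Z.unop.obj (hf i).1
    have fp (i : I) : (in₁ i).hom.toRingHom.FinitePresentation :=
      RingHom.finitePresentation_isStableUnderBaseChange.tensorProduct Z.unop.obj (hf i).2
    let V (i : I) : P.FullSubcategory :=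
      ⟨CommAlgCat.of W (Z.unop.obj ⊗[X.unop.obj] (Y i).obj), hP (in₁ i) Z.unop.property (flat i)⟩
    let j₁ (i : I) : Z.unop ⟶ V i := ObjectProperty.homMk (in₁ i)
    let j₂ (i : I) : Y i ⟶ V i := ObjectProperty.homMk (in₂ i)
    refine ⟨I, hI, V, j₁, fun i => ⟨flat i, fp i⟩, ?_, ?_⟩
    · intro q
      obtain ⟨i, hi⟩ := hs (PrimeSpectrum.comap g.unop.hom.hom.toRingHom q)
      exact ⟨i, mem_range_comap_includeLeft q hi⟩
    · intro i
      have hc : g.unop ≫ j₁ i = f i ≫ j₂ i := by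
        ext x
        exact ((Algebra.TensorProduct.includeRight :
          (Y i).obj →ₐ[X.unop.obj] Z.unop.obj ⊗[X.unop.obj] (Y i).obj).commutes x).symm
      have hd := 𝒮.downward_closed (hm i) (j₂ i).op
      rw [← op_comp, ← hc] at hd
      exact hd
  transitive' := by
    rintro X 𝒮 ⟨I, hI, Y, f, hf, hs, hm⟩ 𝒯 h
    choose I' hI' Y' f' hf' hs' hm' using fun i => h (hm i)
    refine ⟨Σ i, I' i, inferInstance, fun j => Y' j.1 j.2, fun j => f j.1 ≫ f' j.1 j.2, ?_, ?_, ?_⟩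
    · exact fun j => ⟨RingHom.Flat.comp (hf j.1).1 (hf' j.1 j.2).1,
        RingHom.FinitePresentation.comp (hf' j.1 j.2).2 (hf j.1).2⟩
    · intro q
      obtain ⟨i, q', rfl⟩ := hs q
      obtain ⟨j, q'', rfl⟩ := hs' i q'
      exact ⟨⟨i, j⟩, q'', rfl⟩
    · exact fun j => hm' j.1 j.2

/-- The sheafification, as a functor on algebras, of a functor `F` on algebras (a presheaf on the
opposite category). -/
def sheafification {C : Type (u + 1)} [Category.{u} C] (J : GrothendieckTopology Cᵒᵖ)
    (F : C ⥤ Type u) : C ⥤ Type (u + 1) :=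
  opOp C ⋙ sheafify J (unopUnop C ⋙ F ⋙ uliftFunctor.{u + 1, u})

/-- The canonical map from a presheaf to its sheafification. -/
def toSheafification {C : Type (u + 1)} [Category.{u} C] (J : GrothendieckTopology Cᵒᵖ)
    (F : C ⥤ Type u) {R : C} (x : F.obj R) : (sheafification J F).obj R :=
  (toSheafify J (unopUnop C ⋙ F ⋙ uliftFunctor.{u + 1, u})).app (op (op R)) (ULift.up x)

end Sites

section BaseSites

variable (p : ℕ) (W : Type u) [CommRing W]

/-- Flat `W`-algebras. -/
def IsFlatAlg : ObjectProperty (CommAlgCat.{u} W) := fun R => Module.Flat W R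

/-- `W`-algebras in which `p = 0`. For `W = W(κ)` we have `W / pW = κ`, so that these are the
algebras over `κ`, see `isKappaAlg_iff` below. -/
def IsKappaAlg : ObjectProperty (CommAlgCat.{u} W) := fun R => (p : R) = 0

/-- Crystalline `W`-algebras: the flat `W`-algebras `R` that are `p`-adically complete and have a
Frobenius lift, that is, an endomorphism `φ` with `φ(x) ≡ x ^ p` modulo `pR`. -/
def IsCrisW : ObjectProperty (CommAlgCat.{u} W) := fun R =>
  Module.Flat W R ∧ IsAdicComplete (Ideal.span {(p : R)}) R ∧
    ∃ φ : R →+* R, ∀ x : R, φ x - x ^ p ∈ Ideal.span {(p : R)}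

/-- Crystalline `κ`-algebras: those that are isomorphic to `R / pR` for a crystalline
`W`-algebra `R`. -/
def IsCrisKappa : ObjectProperty (CommAlgCat.{u} W) := fun S =>
  ∃ R : CommAlgCat.{u} W, IsCrisW p W R ∧ Nonempty ((R ⧸ Ideal.span {(p : R)}) ≃ₐ[W] S)

lemma IsFlatAlg.of_flat {R S : CommAlgCat.{u} W} (f : R ⟶ S) (hR : IsFlatAlg W R)
    (hf : f.hom.toRingHom.Flat) : IsFlatAlg W S := by
  let : Algebra R S := f.hom.toRingHom.toAlgebra
  have : IsScalarTower W R S := IsScalarTower.of_algebraMap_eq' f.hom.comp_algebraMap.symm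
  have : Module.Flat W R := hR
  have : Module.Flat R S := hf
  exact Module.Flat.trans W R S

lemma IsKappaAlg.of_hom {R S : CommAlgCat.{u} W} (f : R ⟶ S) (hR : IsKappaAlg p W R) :
    IsKappaAlg p W S := by
  have h : f.hom (p : R) = 0 := by rw [show (p : R) = 0 from hR, map_zero]
  rwa [map_natCast] at h

lemma natCast_quotient_eq_zero (R : Type u) [CommRing R] :
    ((p : ℕ) : R ⧸ Ideal.span {(p : R)}) = 0 := by
  rw [← map_natCast (Ideal.Quotient.mk (Ideal.span {(p : R)}))]
  exact Ideal.Quotient.eq_zero_iff_mem.mpr (Ideal.mem_span_singleton_self _)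

lemma isCrisW_le : IsCrisW p W ≤ IsFlatAlg W := fun _ h => h.1

lemma isCrisKappa_le : IsCrisKappa p W ≤ IsKappaAlg p W := by
  rintro S ⟨R, -, ⟨e⟩⟩
  have h := congrArg e (natCast_quotient_eq_zero p R)
  rwa [map_natCast, map_zero] at h

/-- The category of flat `W`-algebras. -/
abbrev FlatAlg : Type (u + 1) := (IsFlatAlg.{u} W).FullSubcategory

/-- The category of `κ`-algebras. -/
abbrev KappaAlg : Type (u + 1) := (IsKappaAlg.{u} p W).FullSubcategory

/-- The category `W_cris` of crystalline `W`-algebras. -/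
abbrev CrisW : Type (u + 1) := (IsCrisW.{u} p W).FullSubcategory

/-- The category `κ_cris` of crystalline `κ`-algebras. -/
abbrev CrisKappa : Type (u + 1) := (IsCrisKappa.{u} p W).FullSubcategory

/-- The flat topology on flat `W`-algebras. -/
def flatTop : GrothendieckTopology (FlatAlg.{u} W)ᵒᵖ :=
  fppf (IsFlatAlg W) (fun f hR hf => IsFlatAlg.of_flat W f hR hf)

/-- The flat topology on `κ`-algebras. -/
def kappaTop : GrothendieckTopology (KappaAlg.{u} p W)ᵒᵖ :=
  fppf (IsKappaAlg p W) (fun f hR _ => IsKappaAlg.of_hom p W f hR)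

/-- Reduction modulo `p` as a functor on `W`-algebras, `R ↦ R / pR`. -/
def modP : CommAlgCat.{u} W ⥤ CommAlgCat.{u} W where
  obj R := CommAlgCat.of W (R ⧸ Ideal.span {(p : R)})
  map {R S} f := CommAlgCat.ofHom (Ideal.quotientMapₐ (Ideal.span {(p : S)}) f.hom (by
    rw [Ideal.span_singleton_le_iff_mem, Ideal.mem_comap, map_natCast]
    exact Ideal.mem_span_singleton_self _))
  map_id R := by
    ext x
    obtain ⟨x, rfl⟩ := Ideal.Quotient.mk_surjective x
    rfl
  map_comp f g := by
    ext x
    obtain ⟨x, rfl⟩ := Ideal.Quotient.mk_surjective x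
    rfl

/-- The functor `R ↦ R / pR` from flat `W`-algebras to `κ`-algebras. -/
def redFlat : FlatAlg.{u} W ⥤ KappaAlg.{u} p W :=
  (IsKappaAlg p W).lift ((IsFlatAlg W).ι ⋙ modP p W) (fun R => natCast_quotient_eq_zero p R.obj)

/-- The reduction map `W_cris → κ_cris`, `R ↦ R / pR`. -/
def redCris : CrisW.{u} p W ⥤ CrisKappa.{u} p W :=
  (IsCrisKappa p W).lift ((IsCrisW p W).ι ⋙ modP p W) (fun R => ⟨R.obj, R.property, ⟨AlgEquiv.refl⟩⟩)

/-- The inclusion of `W_cris` into the flat `W`-algebras. -/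
def crisWIncl : CrisW.{u} p W ⥤ FlatAlg.{u} W := ObjectProperty.ιOfLE (isCrisW_le p W)

/-- The inclusion of `κ_cris` into the `κ`-algebras. -/
def crisKappaIncl : CrisKappa.{u} p W ⥤ KappaAlg.{u} p W :=
  ObjectProperty.ιOfLE (isCrisKappa_le p W)

/-- For a functor `red : Y ⥤ Z` between categories of algebras, a set-valued space `F` over `Y` is
of reduction along `red` by the space `G` over `Z` if `F` is isomorphic to the restriction of `G`
along `red`, and if `G` is, up to isomorphism, the only space over `Z` with this property. -/
def IsReductionBy {Y Z : Type (u + 1)} [Category.{u} Y] [Category.{u} Z] (red : Y ⥤ Z)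
    (F : Y ⥤ Type (u + 1)) (G : Z ⥤ Type (u + 1)) : Prop :=
  Nonempty (F ≅ red ⋙ G) ∧
    ∀ G' : Z ⥤ Type (u + 1), Nonempty (F ≅ red ⋙ G') → Nonempty (G' ≅ G)

end BaseSites

section Kappa

variable (p : ℕ) [Fact p.Prime] (κ : Type u) [Field κ] [Finite κ] [CharP κ p]

/-- An algebra over `W = W(κ)` satisfies `p = 0` if and only if its structure map factors (in a
necessarily unique way) through the projection `W → κ`, that is, if it is a `κ`-algebra. -/
lemma isKappaAlg_iff (R : CommAlgCat.{u} (WittVector p κ)) :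
    IsKappaAlg p (WittVector p κ) R ↔
      ∃! f : κ →+* R, f.comp WittVector.constantCoeff = algebraMap (WittVector p κ) R := by
  have hs := WittVector.constantCoeff_surjective (p := p) (R := κ)
  have hker := WittVector.ker_constantCoeff (p := p) (k := κ)
  constructor
  · intro h
    have hle : RingHom.ker (WittVector.constantCoeff (p := p) (R := κ)) ≤
        RingHom.ker (algebraMap (WittVector p κ) R) := by
      rw [hker, Ideal.span_singleton_le_iff_mem, RingHom.mem_ker, map_natCast]
      exact h
    refine ⟨RingHom.liftOfSurjective _ hs ⟨_, hle⟩, RingHom.liftOfSurjective_comp _ hs ⟨_, hle⟩, ?_⟩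
    intro f hf
    rw [← RingHom.cancel_right hs, hf]
    exact (RingHom.liftOfSurjective_comp _ hs ⟨_, hle⟩).symm
  · rintro ⟨f, hf, -⟩
    change (p : R) = 0
    rw [← map_natCast f p, CharP.cast_eq_zero, map_zero]

end Kappa

/-! ### The presheaves and sheaves of the theorem -/

section Presheaves

variable (p : ℕ) {W H : Type u} [CommRing W] [CommRing H] [HopfAlgebra W H]
  (μ : H →ₐc[W] W[T;T⁻¹])

/-- The presheaf quotient `R ↦ E_μ(R) \ (G(R) × G(R))` on `κ`-algebras, where `G` is the special
fibre of `𝒢`. -/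
def zipPresheaf : KappaAlg.{u} p W ⥤ Type u where
  obj R := ZipQuot R.obj μ
  map f := ↾(ZipQuot.map μ f.hom.hom)
  map_id R := by
    ext x
    obtain ⟨x, rfl⟩ := Quotient.exists_rep x
    rfl
  map_comp f g := by
    ext x
    obtain ⟨x, rfl⟩ := Quotient.exists_rep x
    rfl

/-- The quotient sheaf `E_μ \ G²` on `κ`-algebras. -/
def zipSheaf : KappaAlg.{u} p W ⥤ Type (u + 1) :=
  sheafification (kappaTop p W) (zipPresheaf p μ)

section Mixed

variable (H) (R : Type u) [CommRing R] [Algebra W R]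

/-- Reduction modulo `p`, `𝒢(R) → 𝒢(R / pR) = G(R / pR)`. -/
def ptRed : Pt W H R →* Pt W H (R ⧸ Ideal.span {(p : R)}) :=
  Pt.map H (Ideal.Quotient.mkₐ W (Ideal.span {(p : R)}))

/-- The image in `𝒢(R[1/p])` of the kernel `K₁(R)` of `𝒢(R) → G(R / pR)`. -/
def kOne : Subgroup (Pt W H (Localization.Away (p : R))) :=
  kerLoc H (p : R) (Ideal.Quotient.mkₐ W (Ideal.span {(p : R)}))

end Mixed

/-- The presheaf `R ↦ K₁(R) \ 𝒢(R) μ(p) 𝒢(R) / K₁(R)` on flat `W`-algebras. -/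
def crisPresheaf : FlatAlg.{u} W ⥤ Type u where
  obj R := DoubleQuot (kOne p H R.obj) (cell μ (p : R.obj))
  map {R S} f := ↾(DoubleQuot.map (Pt.map H (locMap f.hom.hom (map_natCast f.hom.hom p)))
    (fun _ hk => map_mem_kerLoc f.hom.hom _ ((modP p W).map f.hom).hom
      (Ideal.quotient_map_comp_mkₐ _ _ _).symm hk)
    (fun _ hx => map_mem_cell μ _ _ hx))
  map_id R := by
    ext x
    obtain ⟨x, rfl⟩ := Quotient.exists_rep x
    refine congrArg (Quotient.mk _) (Subtype.ext ?_)
    exact congrArg (fun f => Pt.map H f x.1) (locMap_id (W := W) (p : R.obj))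
  map_comp f g := by
    ext x
    obtain ⟨x, rfl⟩ := Quotient.exists_rep x
    refine congrArg (Quotient.mk _) (Subtype.ext ?_)
    exact congrArg (fun f => Pt.map H f x.1) (locMap_comp f.hom.hom g.hom.hom
      (map_natCast f.hom.hom p) (map_natCast g.hom.hom p) (map_natCast _ p)).symm

/-- The class of `g μ(p) h` in `K₁(R) \ 𝒢(R) μ(p) 𝒢(R) / K₁(R)`. -/
def crisClass (R : FlatAlg.{u} W) (g h : Pt W H R.obj) : (crisPresheaf p μ).obj R :=
  DoubleQuot.mk (kOne p H R.obj) (cellElt μ (p : R.obj) g h) (cellElt_mem μ _ g h)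

/-- The sheafification of `R ↦ K₁(R) \ 𝒢(R) μ(p) 𝒢(R) / K₁(R)` on flat `W`-algebras. -/
def crisSheaf : FlatAlg.{u} W ⥤ Type (u + 1) :=
  sheafification (flatTop W) (crisPresheaf p μ)

section Loop

variable (W) (R : Type u) {S : Type u} [CommRing R] [Algebra W R] [CommRing S] [Algebra W S]

/-- The projection `R[[t]] → R`, `t ↦ 0`, as a homomorphism of `W`-algebras. -/
def tZero : R⟦X⟧ →ₐ[W] R where
  __ := PowerSeries.constantCoeff (R := R)
  commutes' w := by
    simp [PowerSeries.algebraMap_apply]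

/-- The inclusion of the constants `R → R[[t]]`. -/
def tConst : R →ₐ[W] R⟦X⟧ := IsScalarTower.toAlgHom W R R⟦X⟧

variable {W R}

lemma mapAlgHom_X (f : R →ₐ[W] S) :
    PowerSeries.mapAlgHom f (PowerSeries.X : R⟦X⟧) = PowerSeries.X := by
  simp [PowerSeries.mapAlgHom_apply]

/-- The homomorphism `R((t)) → S((t))` induced by `R → S`, where `R((t)) = R[[t]][1/t]`. -/
def laurentMap (f : R →ₐ[W] S) : Localization.Away (PowerSeries.X : R⟦X⟧) →ₐ[W]
    Localization.Away (PowerSeries.X : S⟦X⟧) :=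
  locMap (PowerSeries.mapAlgHom f) (mapAlgHom_X f)

end Loop

/-- The subsheaf `𝒞^μ` of the loop group `R ↦ G(R((t)))` on `κ`-algebras: the elements that lie in
`G(R[[t]]) μ(t) G(R[[t]])` locally for the flat topology. -/
def loopCell (R : KappaAlg.{u} p W) :
    Set (Pt W H (Localization.Away (PowerSeries.X : R.obj⟦X⟧))) :=
  {x | ∃ 𝒮 ∈ kappaTop p W (op R), ∀ ⦃R' : KappaAlg.{u} p W⦄ (f : R ⟶ R'), 𝒮.arrows f.op →
    Pt.map H (laurentMap f.hom.hom) x ∈ cell μ (PowerSeries.X : R'.obj⟦X⟧)}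

lemma cell_subset_loopCell (R : KappaAlg.{u} p W) :
    cell μ (PowerSeries.X : R.obj⟦X⟧) ⊆ loopCell p μ R :=
  fun _ hx => ⟨⊤, (kappaTop p W).top_mem _, fun _ _ _ => map_mem_cell μ _ _ hx⟩

lemma laurentMap_comp {R S T : Type u} [CommRing R] [Algebra W R] [CommRing S] [Algebra W S]
    [CommRing T] [Algebra W T] (f : R →ₐ[W] S) (g : S →ₐ[W] T) :
    (laurentMap g).comp (laurentMap f) = laurentMap (g.comp f) := by
  have e : (PowerSeries.mapAlgHom g).comp (PowerSeries.mapAlgHom f) =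
      PowerSeries.mapAlgHom (g.comp f) := by
    ext x n
    simp [PowerSeries.mapAlgHom_apply]
  unfold laurentMap
  rw [locMap_comp _ _ (mapAlgHom_X f) (mapAlgHom_X g) (by rw [e, mapAlgHom_X])]
  congr 1

lemma laurentMap_id (R : Type u) [CommRing R] [Algebra W R] :
    laurentMap (AlgHom.id W R) = AlgHom.id W _ := by
  have e : PowerSeries.mapAlgHom (AlgHom.id W R) = AlgHom.id W R⟦X⟧ := by
    ext x n
    simp [PowerSeries.mapAlgHom_apply]
  rw [← locMap_id]
  unfold laurentMap
  congr 1

lemma map_mem_loopCell {R S : KappaAlg.{u} p W} (f : R ⟶ S)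
    {x : Pt W H (Localization.Away (PowerSeries.X : R.obj⟦X⟧))} (hx : x ∈ loopCell p μ R) :
    Pt.map H (laurentMap f.hom.hom) x ∈ loopCell p μ S := by
  obtain ⟨𝒮, h𝒮, h⟩ := hx
  refine ⟨𝒮.pullback f.op, (kappaTop p W).pullback_stable f.op h𝒮, fun R' g hg => ?_⟩
  rw [Pt.map_map, laurentMap_comp]
  exact h (f ≫ g) hg

/-- The presheaf `R ↦ L¹G(R) \ 𝒞^μ(R) / L¹G(R)` on `κ`-algebras, where `L¹G(R)` is the kernel of
`G(R[[t]]) → G(R)`. -/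
def loopPresheaf : KappaAlg.{u} p W ⥤ Type u where
  obj R := DoubleQuot (kerLoc H (PowerSeries.X : R.obj⟦X⟧) (tZero W R.obj)) (loopCell p μ R)
  map {R S} f := ↾(DoubleQuot.map (Pt.map H (laurentMap f.hom.hom))
    (fun _ hk => map_mem_kerLoc _ _ f.hom.hom (by
      ext x
      change PowerSeries.constantCoeff (PowerSeries.map f.hom.hom.toRingHom x) =
        f.hom.hom (PowerSeries.constantCoeff x)
      rw [← PowerSeries.coeff_zero_eq_constantCoeff_apply, PowerSeries.coeff_map,
        PowerSeries.coeff_zero_eq_constantCoeff_apply]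
      rfl) hk)
    (fun _ hx => map_mem_loopCell p μ f hx))
  map_id R := by
    ext x
    obtain ⟨x, rfl⟩ := Quotient.exists_rep x
    refine congrArg (Quotient.mk _) (Subtype.ext ?_)
    exact congrArg (fun f => Pt.map H f x.1) (laurentMap_id (W := W) R.obj)
  map_comp f g := by
    ext x
    obtain ⟨x, rfl⟩ := Quotient.exists_rep x
    refine congrArg (Quotient.mk _) (Subtype.ext ?_)
    exact congrArg (fun f => Pt.map H f x.1) (laurentMap_comp f.hom.hom g.hom.hom).symm

/-- The class of `g μ(t) h` in `L¹G(R) \ 𝒞^μ(R) / L¹G(R)`, for `g, h ∈ G(R[[t]])`. -/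
def loopClass (R : KappaAlg.{u} p W) (g h : Pt W H R.obj⟦X⟧) : (loopPresheaf p μ).obj R :=
  DoubleQuot.mk _ (cellElt μ (PowerSeries.X : R.obj⟦X⟧) g h)
    (cell_subset_loopCell p μ R (cellElt_mem μ _ g h))

/-- The quotient sheaf of `𝒞^μ` by the action of `L¹G × L¹G` by left and right multiplication. -/
def loopSheaf : KappaAlg.{u} p W ⥤ Type (u + 1) :=
  sheafification (kappaTop p W) (loopPresheaf p μ)

end Presheaves

end

end CrisZip

/-! Conjugation through `μ` grades the coordinate ring `H` by weights (`wt`). For `t` in `A`, `degen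
μ t` is the set of pairs `(x, y)` that satisfy the equations of `x = μ(t) y μ(t)⁻¹` without
denominators: `x(f) = tⁿ y(f)` in weight `n ≥ 0` and `y(f) = tⁿ x(f)` in weight `-n`. For a
nonzerodivisor `t` this is the graph of conjugation by `μ(t)` (`mem_degen_iff`); for `t = 0` it is
the zip group (`mem_zipGroup_iff`). Two elements `g μ(t) h` and `g' μ(t) h'` have the same double
class if and only if some pair in `degen μ t` reduces to `(g'⁻¹ g, h' h⁻¹)`
(`exists_cellElt_eq_iff`). Well-definedness therefore says that `degen μ t` reduces into the zip
group, and injectivity is a lifting problem from `degen μ 0` over `A / t` to `degen μ t` over `A`.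

`exists_degen_lift` solves it once the first entry lifts to some `a` in `𝒢(A)`. Modulo a high power
of `t`, the point `a` lies infinitesimally near `P₋`, so it is a product of a point of `P₋` and a
point of `U₊` near `1`. The second factor lifts to `U₊(A)`, because points of `U₊` lift along every
surjection (`uPlus_lift`). After dividing by this lift, the parts of positive weight of `a` are so
divisible by `t` that conjugation by `μ(t)⁻¹` is integral. The remaining error in the second entry
lies in `U₊`, where it lifts and is harmless, since `μ(t)` contracts `U₊` to `1` modulo `t`.

For the sheaves, local surjectivity is what remains. A section of `E_μ \ G²` over `R / p` is an
`E_μ`-torsor embedded in `G²`, with smooth coordinate ring `Q` (`exists_smooth_torsor`). A tubular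
neighbourhood construction maps `Q` to the reduction of a smooth `R`-algebra `Y`
(`exists_smooth_lift`), over which the section comes from points of `𝒢`. Together with `R[1/p]`,
whose reduction is zero, `Y` covers `R`. The same lifting lemma applied to `t` in `A[[t]]`
identifies the loop side with the same zip quotient.

For uniqueness, an isomorphism over `W_cris` must be shown to commute with homomorphisms of
reductions that need not lift. Locally a section is pulled back from the `p`-adic completion of `H ⊗
H`, and homomorphisms from its reduction do lift, by smoothness. Completions of smooth algebras over
crystalline ones carry Frobenius lifts, so the argument stays within crystalline algebras
(`zip_naturality`). -/

namespace CrisZip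

noncomputable section

/-! ### The weight grading of the coordinate ring -/

section Grading

variable {W H : Type u} [CommRing W] [CommRing H] [HopfAlgebra W H]
  {A : Type u} [CommRing A] [Algebra W A] {A' : Type u} [CommRing A'] [Algebra W A']
  (μ : H →ₐc[W] W[T;T⁻¹])

/-- The `W`-algebra homomorphism `W[T, T⁻¹] → A` that sends `T` to the unit `r`. -/
def evalUnit (r : Aˣ) : W[T;T⁻¹] →ₐ[W] A :=
  AddMonoidAlgebra.lift W A ℤ ((Units.coeHom A).comp (zpowersHom Aˣ r))

lemma evalUnit_T (r : Aˣ) (n : ℤ) :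
    evalUnit (W := W) r (LaurentPolynomial.T n) = ((r ^ n : Aˣ) : A) := by
  simp [evalUnit, LaurentPolynomial.T, AddMonoidAlgebra.lift_single, -LaurentPolynomial.single_eq_C_mul_T]

lemma laurent_algHom_ext {f g : W[T;T⁻¹] →ₐ[W] A}
    (h : ∀ n : ℤ, f (LaurentPolynomial.T n) = g (LaurentPolynomial.T n)) : f = g := by
  apply AddMonoidAlgebra.algHom_ext h
  exact Subsingleton.elim _ _

/-- Powers of `T` are group-like, so convolution of points of `𝔾ₘ` is multiplication of units; the
bialgebra homomorphism `μ` transports this to `𝒢`. -/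
lemma cocharAt_mul (r s : Aˣ) : cocharAt μ (r * s) = cocharAt μ r * cocharAt μ s := by
  have key : (toConv (evalUnit (W := W) (r * s)) : WithConv (W[T;T⁻¹] →ₐ[W] A)) =
      toConv (evalUnit r) * toConv (evalUnit s) := by
    apply WithConv.ofConv_injective
    apply laurent_algHom_ext
    intro n
    change evalUnit (W := W) (r * s) (LaurentPolynomial.T n) = _
    rw [evalUnit_T, AlgHom.convMul_def]
    simp [LaurentPolynomial.comul_T, evalUnit_T, mul_zpow]
  apply WithConv.ofConv_injective
  have := AlgHom.convMul_comp_bialgHom_distrib (toConv (evalUnit (W := W) r))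
    (toConv (evalUnit (W := W) s)) μ
  rw [← key] at this
  exact this

lemma cocharAt_one : cocharAt μ (1 : Aˣ) = 1 := by
  have h := cocharAt_mul μ (1 : Aˣ) 1
  rw [one_mul] at h
  exact left_eq_mul.mp h

lemma cocharAt_inv (r : Aˣ) : cocharAt μ r⁻¹ = (cocharAt μ r)⁻¹ := by
  rw [eq_inv_iff_mul_eq_one, ← cocharAt_mul, inv_mul_cancel, cocharAt_one]

/-- The homomorphism `A[T, T⁻¹] → A'` that is `g` on `A` and sends `T` to the unit `r`. -/
def evalLaurent (g : A →ₐ[W] A') (r : A'ˣ) : A[T;T⁻¹] →ₐ[W] A' :=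
  (AlgHom.restrictScalars W (evalUnit (W := A') r)).comp (AddMonoidAlgebra.mapAlgHom ℤ g)

lemma evalLaurent_apply (g : A →ₐ[W] A') (r : A'ˣ) (F : A[T;T⁻¹]) :
    evalLaurent g r F = F.coeff.sum fun n a => g a * ((r ^ n : A'ˣ) : A') := by
  induction F using LaurentPolynomial.induction_on' with
  | add p q hp hq =>
    rw [map_add, hp, hq, AddMonoidAlgebra.coeff_add, Finsupp.sum_add_index']
    · simp
    · intros; rw [map_add, add_mul]
  | C_mul_T n a =>
    rw [← LaurentPolynomial.single_eq_C_mul_T]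
    change evalUnit (W := A') r (AddMonoidAlgebra.mapAlgHom ℤ g (AddMonoidAlgebra.single n a)) = _
    rw [AddMonoidAlgebra.mapAlgHom_single, AddMonoidAlgebra.coeff_single,
      Finsupp.sum_single_index (by simp)]
    simp [evalUnit, AddMonoidAlgebra.lift_single, -LaurentPolynomial.single_eq_C_mul_T]

/-- The universal conjugate `μ(T) g μ(T)⁻¹`, as a homomorphism `H → H[T, T⁻¹]`. -/
def conjHom : H →ₐ[W] H[T;T⁻¹] :=
  (cocharAt μ (unitT H) * Pt.map H (IsScalarTower.toAlgHom W H H[T;T⁻¹])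
    (toConv (AlgHom.id W H)) * (cocharAt μ (unitT H))⁻¹).ofConv

/-- The component of weight `n` of a function on `𝒢`, for the action of `𝔾ₘ` on `𝒢` by
conjugation through `μ`. -/
def wt (n : ℤ) : H →ₗ[W] H where
  toFun f := (conjHom μ f).coeff n
  map_add' f g := by simp
  map_smul' c f := by simp

lemma wt_apply (n : ℤ) (f : H) : wt μ n f = (conjHom μ f).coeff n := rfl

lemma evalLaurent_unitT (g : A →ₐ[W] A') (r : A'ˣ) :
    evalLaurent g r (unitT A : A[T;T⁻¹]) = r := by
  rw [evalLaurent_apply]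
  change (AddMonoidAlgebra.coeff (AddMonoidAlgebra.single 1 1)).sum _ = _
  rw [AddMonoidAlgebra.coeff_single, Finsupp.sum_single_index (by simp)]
  simp

lemma evalLaurent_comp_algebraMap (g : A →ₐ[W] A') (r : A'ˣ) :
    (evalLaurent g r).comp (IsScalarTower.toAlgHom W A A[T;T⁻¹]) = g := by
  ext a
  change evalLaurent g r (AddMonoidAlgebra.single 0 a) = g a
  rw [evalLaurent_apply, AddMonoidAlgebra.coeff_single, Finsupp.sum_single_index (by simp)]
  simp

lemma conj_eq_evalLaurent (g : Pt W H A) (r : Aˣ) :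
    cocharAt μ r * g * (cocharAt μ r)⁻¹ =
      toConv ((evalLaurent g.ofConv r).comp (conjHom μ)) := by
  have : Pt.map H (evalLaurent g.ofConv r) (toConv (conjHom μ)) =
      cocharAt μ r * g * (cocharAt μ r)⁻¹ := by
    have e : (toConv (conjHom μ) : Pt W H H[T;T⁻¹]) =
      cocharAt μ (unitT H) * Pt.map H (IsScalarTower.toAlgHom W H H[T;T⁻¹])
      (toConv (AlgHom.id W H)) * (cocharAt μ (unitT H))⁻¹ := rfl
    rw [e, map_mul, map_mul, map_inv, map_cocharAt μ _ _ r (evalLaurent_unitT _ _), Pt.map_map,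
      evalLaurent_comp_algebraMap]
    rfl
  exact this.symm

lemma conj_apply (g : Pt W H A) (r : Aˣ) (f : H) :
    (cocharAt μ r * g * (cocharAt μ r)⁻¹).ofConv f =
      (conjHom μ f).coeff.sum fun n a => g.ofConv a * ((r ^ n : Aˣ) : A) := by
  rw [conj_eq_evalLaurent]
  exact evalLaurent_apply _ _ _

/-- Conjugation by `μ(1) = 1` is trivial, and putting `T = 1` in the universal conjugate adds up its
coefficients. -/
lemma sum_wt (f : H) : ((conjHom μ f).coeff.sum fun _ a => a) = f := by
  have h := conj_apply μ (toConv (AlgHom.id W H)) 1 f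
  rw [cocharAt_one] at h
  simpa using h.symm

lemma unitT_zpow (k : ℤ) :
    (((unitT A) ^ k : (A[T;T⁻¹])ˣ) : A[T;T⁻¹]) = LaurentPolynomial.T k := by
  obtain ⟨n, rfl | rfl⟩ := k.eq_nat_or_neg
  · rw [zpow_natCast, Units.val_pow_eq_pow_val]
    change (LaurentPolynomial.T 1 : A[T;T⁻¹]) ^ n = _
    simp
  · rw [zpow_neg, zpow_natCast, ← inv_pow, Units.val_pow_eq_pow_val]
    change (LaurentPolynomial.T (-1) : A[T;T⁻¹]) ^ n = _
    simp

/-- The dictionary between conjugation and weights: powers of `T` in the conjugate of a point record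
its values on weight components. Existence of limits thereby becomes vanishing in half of the
weights. -/
lemma coeff_conj_unitT (g : Pt W H A) (n : ℤ) (f : H) :
    ((cocharAt μ (unitT A) * Pt.map H (IsScalarTower.toAlgHom W A A[T;T⁻¹]) g *
      (cocharAt μ (unitT A))⁻¹).ofConv f).coeff n = g.ofConv (wt μ n f) := by
  rw [conj_apply, wt_apply]
  have h3 : ∀ (k : ℤ) (a : H), (Pt.map H (IsScalarTower.toAlgHom W A A[T;T⁻¹]) g).ofConv a *
      (((unitT A) ^ k : (A[T;T⁻¹])ˣ) : A[T;T⁻¹]) = AddMonoidAlgebra.single k (g.ofConv a) := by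
    intro k a
    rw [unitT_zpow, LaurentPolynomial.single_eq_C_mul_T]
    rfl
  simp only [h3]
  rw [Finsupp.sum, AddMonoidAlgebra.coeff_sum, Finsupp.finsetSum_apply]
  simp only [AddMonoidAlgebra.coeff_single, Finsupp.single_apply]
  rw [Finset.sum_ite_eq']
  split_ifs with h
  · rfl
  · rw [Finsupp.notMem_support_iff.mp h, map_zero]

/-- Conjugating twice, with independent variables, is conjugating once by the value of `μ` at their
product. Comparing coefficients, only equal exponents of the two variables survive. -/
lemma wt_wt (m n : ℤ) (f : H) : wt μ n (wt μ m f) = if n = m then wt μ n f else 0 := by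
  let B := H[T;T⁻¹]
  let ι : H →ₐ[W] B := IsScalarTower.toAlgHom W H B
  let ι' : B →ₐ[W] B[T;T⁻¹] := IsScalarTower.toAlgHom W B B[T;T⁻¹]
  let g : Pt W H B := toConv (conjHom μ)
  let s : (B[T;T⁻¹])ˣ := Units.map (ι' : B →* B[T;T⁻¹]) (unitT H)
  have hg : g = cocharAt μ (unitT H) * Pt.map H ι (toConv (AlgHom.id W H)) *
    (cocharAt μ (unitT H))⁻¹ := rfl
  have h1 : cocharAt μ (unitT B) * Pt.map H ι' g * (cocharAt μ (unitT B))⁻¹ =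
      cocharAt μ (unitT B * s) * Pt.map H (ι'.comp ι) (toConv (AlgHom.id W H)) *
        (cocharAt μ (unitT B * s))⁻¹ := by
    rw [hg, map_mul, map_mul, map_inv, map_cocharAt μ ι' (unitT H) s rfl, Pt.map_map, cocharAt_mul]
    group
  have h2 := coeff_conj_unitT μ g m f
  rw [h1, conj_apply] at h2
  have h3 : ∀ (k : ℤ) (a : H), (Pt.map H (ι'.comp ι) (toConv (AlgHom.id W H))).ofConv a *
      (((unitT B * s) ^ k : (B[T;T⁻¹])ˣ) : B[T;T⁻¹]) =
      AddMonoidAlgebra.single k (AddMonoidAlgebra.single k a) := by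
    intro k a
    have hs : ((s ^ k : (B[T;T⁻¹])ˣ) : B[T;T⁻¹]) = LaurentPolynomial.C (LaurentPolynomial.T k) := by
      rw [← map_zpow, Units.coe_map, unitT_zpow]; rfl
    rw [mul_zpow, Units.val_mul, unitT_zpow, hs, LaurentPolynomial.single_eq_C_mul_T,
      LaurentPolynomial.single_eq_C_mul_T, mul_comm (LaurentPolynomial.T k), ← mul_assoc, map_mul]
    rfl
  simp only [h3] at h2
  rw [Finsupp.sum, AddMonoidAlgebra.coeff_sum, Finsupp.finsetSum_apply] at h2
  simp only [AddMonoidAlgebra.coeff_single, Finsupp.single_apply] at h2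
  rw [Finset.sum_ite_eq'] at h2
  have h4 : wt μ n (wt μ m f) = (AddMonoidAlgebra.single m (wt μ m f) : B).coeff n := by
    refine (congrArg (fun F : B => F.coeff n) h2).symm.trans ?_
    split_ifs with hm
    · rfl
    · have h0 : wt μ m f = 0 := Finsupp.notMem_support_iff.mp hm
      rw [h0, AddMonoidAlgebra.single_zero]
  rw [h4, AddMonoidAlgebra.coeff_single, Finsupp.single_apply]
  by_cases h : n = m
  · rw [if_pos h, if_pos h.symm, h]
  · rw [if_neg h, if_neg (Ne.symm h)]

lemma wt_self (n : ℤ) (f : H) : wt μ n (wt μ n f) = wt μ n f := by rw [wt_wt, if_pos rfl]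

lemma wt_of_ne {m n : ℤ} (h : n ≠ m) (f : H) : wt μ n (wt μ m f) = 0 := by rw [wt_wt, if_neg h]

lemma conjHom_wt (n : ℤ) (f : H) : conjHom μ (wt μ n f) = AddMonoidAlgebra.single n (wt μ n f) := by
  ext k
  rw [← wt_apply, wt_wt, AddMonoidAlgebra.coeff_single, Finsupp.single_apply]
  by_cases h : n = k
  · subst h; simp
  · rw [if_neg h, if_neg (Ne.symm h)]

lemma wt_mul_wt (i j : ℤ) (f g : H) :
    wt μ (i + j) (wt μ i f * wt μ j g) = wt μ i f * wt μ j g := by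
  rw [wt_apply, map_mul, conjHom_wt, conjHom_wt, AddMonoidAlgebra.single_mul_single,
    AddMonoidAlgebra.coeff_single, Finsupp.single_eq_same]

lemma wt_one : wt μ 0 1 = (1 : H) := by
  rw [wt_apply, map_one, AddMonoidAlgebra.one_def, AddMonoidAlgebra.coeff_single,
    Finsupp.single_eq_same]

/-- To prove that two additive maps on `H` agree it is enough to do so on weight vectors. -/
lemma addHom_ext_wt {M : Type*} [AddCommMonoid M] {φ ψ : H →+ M}
    (h : ∀ n f, φ (wt μ n f) = ψ (wt μ n f)) : φ = ψ := by
  ext f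
  rw [← sum_wt μ f, Finsupp.sum, map_sum, map_sum]
  exact Finset.sum_congr rfl fun n _ => h n f

lemma algHom_ext_wt {φ ψ : H →ₐ[W] A} (h : ∀ n f, φ (wt μ n f) = ψ (wt μ n f)) : φ = ψ := by
  have := addHom_ext_wt μ (φ := (φ : H →+ A)) (ψ := (ψ : H →+ A)) h
  ext f
  exact DFunLike.congr_fun this f

/-- The algebra homomorphism on `H` with prescribed values on weight vectors. -/
lemma exists_algHom_of_wt (c : ℤ → H →ₗ[W] A) (h1 : c 0 1 = 1)
    (hmul : ∀ i j f g, c (i + j) (wt μ i f * wt μ j g) = c i (wt μ i f) * c j (wt μ j g)) :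
    ∃ φ : H →ₐ[W] A, ∀ n f, φ (wt μ n f) = c n (wt μ n f) := by
  let L : H →ₗ[W] A :=
    { toFun := fun f => (conjHom μ f).coeff.sum fun n a => c n a
      map_add' := fun f g => by
        rw [map_add, AddMonoidAlgebra.coeff_add, Finsupp.sum_add_index'] <;> simp
      map_smul' := fun a f => by
        rw [map_smul, AddMonoidAlgebra.coeff_smul, Finsupp.sum_smul_index' (by simp)]
        simp [Finsupp.smul_sum] }
  have hL : ∀ n f, L (wt μ n f) = c n (wt μ n f) := fun n f => by
    change (conjHom μ (wt μ n f)).coeff.sum _ = _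
    rw [conjHom_wt, AddMonoidAlgebra.coeff_single, Finsupp.sum_single_index (by simp)]
  -- Multiplicativity is an equality of bilinear maps, so it may be tested on weight vectors in one
  -- variable after the other.
  have key : ((LinearMap.mul W H).compr₂ L) = (LinearMap.mul W A).compl₁₂ L L := by
    apply LinearMap.toAddMonoidHom_injective
    apply addHom_ext_wt μ
    intro i f
    apply LinearMap.toAddMonoidHom_injective
    apply addHom_ext_wt μ
    intro j g
    change L (wt μ i f * wt μ j g) = L (wt μ i f) * L (wt μ j g)
    -- The product has to be displayed as a vector of weight `i + j` before `hL` applies to it.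
    rw [← wt_mul_wt, hL, wt_mul_wt, hmul, hL, hL]
  exact ⟨AlgHom.ofLinearMap L (by rw [← wt_one μ, hL, wt_one, h1])
    (fun f g => LinearMap.congr_fun (LinearMap.congr_fun key f) g), hL⟩

/-- The unit is fixed by conjugation, so its conjugate is constant in `T`. -/
lemma one_apply_wt {n : ℤ} (hn : n ≠ 0) (f : H) : (1 : Pt W H A).ofConv (wt μ n f) = 0 := by
  have h := coeff_conj_unitT μ (1 : Pt W H A) n (wt μ n f)
  rw [map_one, mul_one, mul_inv_cancel, wt_self] at h
  rw [← h]
  change (algebraMap W A[T;T⁻¹] _).coeff n = 0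
  rw [LaurentPolynomial.algebraMap_apply, LaurentPolynomial.C_apply, if_neg hn]

/-- A homomorphism whose values lie in the image of an injective homomorphism `j` factors
through `j`. -/
lemma exists_comp_eq_of_injective {B C : Type u} [CommRing B] [Algebra W B] [CommRing C]
    [Algebra W C] (j : B →ₐ[W] C) (hj : Function.Injective j) (φ : A →ₐ[W] C)
    (h : ∀ a, φ a ∈ j.range) : ∃ ψ : A →ₐ[W] B, j.comp ψ = φ := by
  refine ⟨(AlgEquiv.ofInjective j hj).symm.toAlgHom.comp (φ.codRestrict j.range h), ?_⟩
  ext a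
  change j ((AlgEquiv.ofInjective j hj).symm _) = φ a
  rw [← AlgEquiv.ofInjective_apply j hj, AlgEquiv.apply_symm_apply]
  rfl

lemma mem_range_toLaurent_iff (F : A[T;T⁻¹]) :
    (∃ G : A[X], Polynomial.toLaurent G = F) ↔ ∀ n < 0, F.coeff n = 0 := by
  constructor
  · rintro ⟨G, rfl⟩ n hn
    induction G using Polynomial.induction_on' with
    | add p q hp hq => rw [map_add, AddMonoidAlgebra.coeff_add, Finsupp.add_apply, hp, hq, add_zero]
    | monomial k a =>
      rw [Polynomial.toLaurent_C_mul_T, ← LaurentPolynomial.single_eq_C_mul_T,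
        AddMonoidAlgebra.coeff_single, Finsupp.single_eq_of_ne (by lia)]
  · intro h
    refine ⟨∑ n ∈ F.coeff.support, Polynomial.monomial n.toNat (F.coeff n), ?_⟩
    rw [map_sum]
    have e : F = ∑ n ∈ F.coeff.support, AddMonoidAlgebra.single n (F.coeff n) := by
      ext k
      rw [AddMonoidAlgebra.coeff_sum, Finsupp.finsetSum_apply]
      simp only [AddMonoidAlgebra.coeff_single, Finsupp.single_apply]
      rw [Finset.sum_ite_eq']
      split_ifs with hk
      · rfl
      · exact Finsupp.notMem_support_iff.mp hk
    conv_rhs => rw [e]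
    refine Finset.sum_congr rfl fun n hn => ?_
    have : 0 ≤ n := by
      by_contra hc
      exact Finsupp.mem_support_iff.mp hn (h n (by lia))
    rw [Polynomial.toLaurent_C_mul_T, ← LaurentPolynomial.single_eq_C_mul_T, Int.toNat_of_nonneg this]

lemma coeff_toLaurent_zero (G : A[X]) : (Polynomial.toLaurent G).coeff 0 = G.coeff 0 := by
  induction G using Polynomial.induction_on' with
  | add p q hp hq => rw [map_add, AddMonoidAlgebra.coeff_add, Finsupp.add_apply, hp, hq,
      Polynomial.coeff_add]
  | monomial k a =>
    rw [Polynomial.toLaurent_C_mul_T, ← LaurentPolynomial.single_eq_C_mul_T,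
      AddMonoidAlgebra.coeff_single, Finsupp.single_apply, Polynomial.coeff_monomial]
    simp

end Grading

end

end CrisZip

namespace CrisZip

noncomputable section

/-! ### Limits in terms of weights, and the degeneration of `𝒢` to the zip group -/

section Degeneration

variable {W H : Type u} [CommRing W] [CommRing H] [HopfAlgebra W H]
  {A : Type u} [CommRing A] [Algebra W A] {A' : Type u} [CommRing A'] [Algebra W A']
  (μ : H →ₐc[W] W[T;T⁻¹])

/-- The limit component: the homomorphism that agrees with `g` in weight `0` and vanishes in the
other weights, if this is multiplicative. -/
lemma exists_levi (g : Pt W H A) (h : ∀ n f k, n ≠ 0 → g.ofConv (wt μ n f) * g.ofConv (wt μ (-n) k) = 0) :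
    ∃ m : Pt W H A, (∀ f, m.ofConv (wt μ 0 f) = g.ofConv (wt μ 0 f)) ∧
      ∀ n f, n ≠ 0 → m.ofConv (wt μ n f) = 0 := by
  have hmul : ∀ i j f k, (if i + j = 0 then g.ofConv.toLinearMap else 0) (wt μ i f * wt μ j k) =
      (if i = 0 then g.ofConv.toLinearMap else 0) (wt μ i f) *
        (if j = 0 then g.ofConv.toLinearMap else 0) (wt μ j k) := by
    intro i j f k
    by_cases hi : i = 0
    · by_cases hj : j = 0
      · simp [hi, hj]
      · simp [hi, hj]
    · by_cases hij : i + j = 0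
      · have hj : j = -i := by lia
        have hj' : j ≠ 0 := by lia
        simp only [hij, hi, hj', if_true, if_false, AlgHom.toLinearMap_apply, map_mul,
          LinearMap.zero_apply, mul_zero]
        rw [hj]
        exact h i f k hi
      · simp [hij, hi]
  obtain ⟨φ, hφ⟩ := exists_algHom_of_wt μ (fun n => if n = 0 then g.ofConv.toLinearMap else 0)
    (by simp) hmul
  exact ⟨toConv φ, fun f => (hφ 0 f).trans (by simp), fun n f hn => (hφ n f).trans (by simp [hn])⟩

/-- Extending to the affine line means that no negative powers of `T` occur, and the value at `0` is
the constant coefficient. The function `e` is the identity for `τ = T` and negation for `τ = T⁻¹`,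
so that one argument serves both limits. -/
lemma hasLimit_of_coeff {τ : (A[T;T⁻¹])ˣ} {g m : Pt W H A} {e : ℤ → ℤ}
    (he0 : e 0 = 0)
    (he : ∀ n f, ((cocharAt μ τ * Pt.map H (IsScalarTower.toAlgHom W A A[T;T⁻¹]) g *
      (cocharAt μ τ)⁻¹).ofConv f).coeff n = g.ofConv (wt μ (e n) f)) :
    HasLimit μ τ g m ↔ (∀ n < 0, ∀ f, g.ofConv (wt μ (e n) f) = 0) ∧
      ∀ f, m.ofConv f = g.ofConv (wt μ 0 f) := by
  set c := cocharAt μ τ * Pt.map H (IsScalarTower.toAlgHom W A A[T;T⁻¹]) g *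
      (cocharAt μ τ)⁻¹ with hc
  have key : ∀ γ : Pt W H A[X],
      Pt.map H ((Polynomial.toLaurentAlg (R := A)).restrictScalars W) γ = c →
      ∀ f, (Pt.map H ((Polynomial.aeval (R := A) (0 : A)).restrictScalars W) γ).ofConv f =
        g.ofConv (wt μ 0 f) := by
    intro γ hγ f
    have h0 := he 0 f
    rw [he0, ← hγ] at h0
    change (Polynomial.toLaurent (γ.ofConv f)).coeff 0 = _ at h0
    rw [coeff_toLaurent_zero] at h0
    rw [← h0]
    change Polynomial.aeval (0 : A) (γ.ofConv f) = _
    rw [← Polynomial.coeff_zero_eq_aeval_zero]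
  constructor
  · rintro ⟨γ, h1, h2⟩
    refine ⟨fun n hn f => ?_, fun f => ?_⟩
    · rw [← he n f, hc, ← h1]
      exact (mem_range_toLaurent_iff _).mp ⟨γ.ofConv f, rfl⟩ n hn
    · rw [← h2, key γ h1]
  · rintro ⟨h1, h2⟩
    obtain ⟨γ, hγ⟩ := exists_comp_eq_of_injective
      ((Polynomial.toLaurentAlg (R := A)).restrictScalars W) Polynomial.toLaurent_injective
      c.ofConv (fun f => by
        obtain ⟨G, hG⟩ := (mem_range_toLaurent_iff (c.ofConv f)).mpr
          (fun n hn => by rw [he n f, h1 n hn f])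
        exact ⟨G, hG⟩)
    have hγ' : Pt.map H ((Polynomial.toLaurentAlg (R := A)).restrictScalars W) (toConv γ) = c :=
      WithConv.ofConv_injective hγ
    refine ⟨toConv γ, hγ', ?_⟩
    apply WithConv.ofConv_injective
    ext f
    rw [key _ hγ', h2]

lemma hasLimit_unitT_iff {g m : Pt W H A} :
    HasLimit μ (unitT A) g m ↔ (∀ n < 0, ∀ f, g.ofConv (wt μ n f) = 0) ∧
      ∀ f, m.ofConv f = g.ofConv (wt μ 0 f) :=
  hasLimit_of_coeff μ (e := id) rfl (fun n f => coeff_conj_unitT μ g n f)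

lemma coeff_conj_unitT_inv (g : Pt W H A) (n : ℤ) (f : H) :
    ((cocharAt μ (unitT A)⁻¹ * Pt.map H (IsScalarTower.toAlgHom W A A[T;T⁻¹]) g *
      (cocharAt μ (unitT A)⁻¹)⁻¹).ofConv f).coeff n = g.ofConv (wt μ (-n) f) := by
  let ν : A[T;T⁻¹] →ₐ[W] A[T;T⁻¹] :=
    (LaurentPolynomial.invert (R := A)).toAlgHom.restrictScalars W
  have h1 : Pt.map H ν (cocharAt μ (unitT A) * Pt.map H (IsScalarTower.toAlgHom W A A[T;T⁻¹]) g *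
      (cocharAt μ (unitT A))⁻¹) = cocharAt μ (unitT A)⁻¹ *
      Pt.map H (IsScalarTower.toAlgHom W A A[T;T⁻¹]) g * (cocharAt μ (unitT A)⁻¹)⁻¹ := by
    rw [map_mul, map_mul, map_inv, map_cocharAt μ ν (unitT A) (unitT A)⁻¹ (LaurentPolynomial.invert_T 1),
      Pt.map_map]
    congr 4
    ext x : 1
    exact LaurentPolynomial.invert_C x
  rw [← h1, ← coeff_conj_unitT]
  exact LaurentPolynomial.invert_apply _ _

lemma hasLimit_unitT_inv_iff {g m : Pt W H A} :
    HasLimit μ (unitT A)⁻¹ g m ↔ (∀ n > 0, ∀ f, g.ofConv (wt μ n f) = 0) ∧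
      ∀ f, m.ofConv f = g.ofConv (wt μ 0 f) := by
  rw [hasLimit_of_coeff μ (e := Neg.neg) neg_zero (fun n f => coeff_conj_unitT_inv μ g n f)]
  refine and_congr_left fun _ => ⟨fun h n hn f => ?_, fun h n hn f => h _ (by lia) f⟩
  have := h (-n) (by lia) f
  rwa [neg_neg] at this

/-- The pairs `(x, y)` of points with `x = μ(t) y μ(t)⁻¹`, in a form that makes sense also when `t`
is not invertible. For `t = 0` this is the zip group. -/
def degen (t : A) : Set (Pt W H A × Pt W H A) :=
  {x | ∀ (n : ℕ) (f : H), x.1.ofConv (wt μ n f) = t ^ n * x.2.ofConv (wt μ n f) ∧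
    x.2.ofConv (wt μ (-n) f) = t ^ n * x.1.ofConv (wt μ (-n) f)}

lemma mem_degen_zero_iff {x : Pt W H A × Pt W H A} :
    x ∈ degen μ (0 : A) ↔ (∀ n > 0, ∀ f, x.1.ofConv (wt μ n f) = 0) ∧
      (∀ n < 0, ∀ f, x.2.ofConv (wt μ n f) = 0) ∧
      ∀ f, x.1.ofConv (wt μ 0 f) = x.2.ofConv (wt μ 0 f) := by
  constructor
  · intro h
    refine ⟨fun n hn f => ?_, fun n hn f => ?_, fun f => ?_⟩
    · lift n to ℕ using hn.le
      rw [(h n f).1, zero_pow (by lia), zero_mul]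
    · obtain ⟨k, rfl⟩ : ∃ k : ℕ, n = -k := ⟨n.natAbs, by lia⟩
      rw [(h k f).2, zero_pow (by lia), zero_mul]
    · simpa using (h 0 f).1
  · rintro ⟨h1, h2, h3⟩ n f
    rcases Nat.eq_zero_or_pos n with rfl | hn
    · have := h3 f
      simp [this]
    · rw [zero_pow (by lia), zero_mul, zero_mul]
      exact ⟨h1 n (by lia) f, h2 (-n) (by lia) f⟩

/-- Apart from the translation of limits into weights, the point is that the Levi component exists.
Keeping only weight `0` is multiplicative, because of two opposite nonzero weights one is positive,
where the first entry vanishes. -/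
lemma mem_zipGroup_iff {x : Pt W H A × Pt W H A} : x ∈ zipGroup A μ ↔ x ∈ degen μ (0 : A) := by
  rw [mem_degen_zero_iff]
  constructor
  · rintro ⟨m, h1, h2⟩
    rw [hasLimit_unitT_inv_iff] at h1
    rw [hasLimit_unitT_iff] at h2
    refine ⟨h1.1, h2.1, fun f => ?_⟩
    rw [← h1.2, ← h2.2]
  · rintro ⟨h1, h2, h3⟩
    obtain ⟨m, hm, hm'⟩ := exists_levi μ x.1 (fun n f k hn => by
      rcases lt_or_gt_of_ne hn with h | h
      · rw [h1 (-n) (by lia) k, mul_zero]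
      · rw [h1 n h, zero_mul])
    have hm2 : ∀ f, m.ofConv f = x.1.ofConv (wt μ 0 f) := by
      intro f
      have e : (m.ofConv : H →+ A) = (x.1.ofConv : H →+ A).comp (wt μ 0 : H →+ H) := by
        apply addHom_ext_wt μ
        intro n k
        change m.ofConv _ = x.1.ofConv (wt μ 0 (wt μ n k))
        by_cases hn : n = 0
        · subst hn; rw [hm, wt_self]
        · rw [hm' n k hn, wt_of_ne μ (Ne.symm hn), map_zero]
      exact DFunLike.congr_fun e f
    exact ⟨m, (hasLimit_unitT_inv_iff μ).mpr ⟨h1, hm2⟩,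
      (hasLimit_unitT_iff μ).mpr ⟨h2, fun f => (hm2 f).trans (h3 f)⟩⟩

lemma degen_map {t : A} {t' : A'} (q : A →ₐ[W] A') (hq : q t = t') {x : Pt W H A × Pt W H A}
    (hx : x ∈ degen μ t) : (Pt.map H q x.1, Pt.map H q x.2) ∈ degen μ t' := by
  intro n f
  constructor
  · change q (x.1.ofConv _) = t' ^ n * q (x.2.ofConv _)
    rw [(hx n f).1, map_mul, map_pow, hq]
  · change q (x.2.ofConv _) = t' ^ n * q (x.1.ofConv _)
    rw [(hx n f).2, map_mul, map_pow, hq]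

lemma degen_of_map {t : A} {t' : A'} (q : A →ₐ[W] A') (hq : q t = t') (hi : Function.Injective q)
    {x : Pt W H A × Pt W H A}
    (hx : (Pt.map H q x.1, Pt.map H q x.2) ∈ degen μ t') : x ∈ degen μ t := by
  intro n f
  constructor
  · apply hi
    rw [map_mul, map_pow, hq]
    exact (hx n f).1
  · apply hi
    rw [map_mul, map_pow, hq]
    exact (hx n f).2

/-- The graded `A`-algebra `A[u, v] / (u v - t)`, with `u` in degree `1` and `v` in degree `-1`,
embedded into `(A × A)[T, T⁻¹]` by `u ↦ (T, t T)` and `v ↦ (t T⁻¹, T⁻¹)`. -/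
def reesAlg (W : Type u) [CommRing W] [Algebra W A] (t : A) : Subalgebra W (A × A)[T;T⁻¹] where
  carrier := {F | ∀ n : ℕ, (F.coeff n).2 = t ^ n * (F.coeff n).1 ∧
    (F.coeff (-n)).1 = t ^ n * (F.coeff (-n)).2}
  zero_mem' := by simp
  add_mem' := by
    intro F G hF hG n
    rw [AddMonoidAlgebra.coeff_add, Finsupp.add_apply, Finsupp.add_apply, Prod.snd_add,
      Prod.fst_add, Prod.snd_add, Prod.fst_add, (hF n).1, (hF n).2, (hG n).1, (hG n).2]
    constructor <;> ring
  algebraMap_mem' := by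
    intro w n
    rw [LaurentPolynomial.algebraMap_apply, LaurentPolynomial.C_apply, LaurentPolynomial.C_apply]
    rcases Nat.eq_zero_or_pos n with rfl | hn
    · simp
    · simp [hn.ne']
  mul_mem' := by
    intro F G hF hG
    -- A form of the two conditions that is uniform in the sign of `n`: one of the two exponents is
    -- always zero.
    have hpos : ∀ {F : (A × A)[T;T⁻¹]}, (∀ n : ℕ, (F.coeff n).2 = t ^ n * (F.coeff n).1 ∧
        (F.coeff (-n)).1 = t ^ n * (F.coeff (-n)).2) → ∀ n : ℤ, ∃ c : A,
        F.coeff n = (t ^ (-n).toNat * c, t ^ n.toNat * c) := by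
      intro F hF n
      obtain ⟨k, rfl | rfl⟩ := n.eq_nat_or_neg
      · refine ⟨(F.coeff k).1, Prod.ext ?_ ?_⟩
        · simp
        · simpa using (hF k).1
      · refine ⟨(F.coeff (-k)).2, Prod.ext ?_ ?_⟩
        · simpa using (hF k).2
        · simp
    intro n
    have hm : ∀ m : ℤ, (F * G).coeff m = F.coeff.sum fun i a => G.coeff.sum fun j b =>
        if i + j = m then a * b else 0 := by
      intro m
      rw [AddMonoidAlgebra.coeff_mul]
    simp only [hm, Finsupp.sum, Prod.snd_sum, Prod.fst_sum, Finset.mul_sum]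
    constructor
    · refine Finset.sum_congr rfl fun i _ => Finset.sum_congr rfl fun j _ => ?_
      split_ifs with hij
      · obtain ⟨c, hc⟩ := hpos hF i
        obtain ⟨d, hd⟩ := hpos hG j
        rw [hc, hd]
        simp only [Prod.mk_mul_mk]
        -- Since `i + j = n`, the exponents in the second entry exceed those in the first by exactly
        -- `n`.
        have : i.toNat + j.toNat = n + ((-i).toNat + (-j).toNat) := by lia
        calc t ^ i.toNat * c * (t ^ j.toNat * d) = t ^ (i.toNat + j.toNat) * (c * d) := by ring
          _ = _ := by rw [this]; ring
      · simp
    · refine Finset.sum_congr rfl fun i _ => Finset.sum_congr rfl fun j _ => ?_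
      split_ifs with hij
      · obtain ⟨c, hc⟩ := hpos hF i
        obtain ⟨d, hd⟩ := hpos hG j
        rw [hc, hd]
        simp only [Prod.mk_mul_mk]
        have : (-i).toNat + (-j).toNat = n + (i.toNat + j.toNat) := by lia
        calc t ^ (-i).toNat * c * (t ^ (-j).toNat * d) = t ^ ((-i).toNat + (-j).toNat) * (c * d) := by
              ring
          _ = _ := by rw [this]; ring
      · simp

end Degeneration

end

end CrisZip

namespace CrisZip

noncomputable section

/-! ### Infinitesimal lifting for the degeneration -/

lemma exists_lift_of_sq_zero {W H : Type u} [CommRing W] [CommRing H] [Algebra W H] [Algebra.FormallySmooth W H]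
    {B C : Type u} [CommRing B] [Algebra W B] [CommRing C]
    [Algebra W C] (φ : H →ₐ[W] C) (g : B →ₐ[W] C) (hg : Function.Surjective g)
    (h : ∀ a b, g a = 0 → g b = 0 → a * b = 0) : ∃ ψ : H →ₐ[W] B, ∀ f, g (ψ f) = φ f := by
  have hnil : IsNilpotent (RingHom.ker g) := by
    refine ⟨2, ?_⟩
    rw [pow_two, Ideal.zero_eq_bot, eq_bot_iff, Ideal.mul_le]
    intro a ha b hb
    rw [Ideal.mem_bot]
    exact h a b ha hb
  exact ⟨Algebra.FormallySmooth.liftOfSurjective φ g hg hnil,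
    Algebra.FormallySmooth.liftOfSurjective_apply φ g hg hnil⟩

section Lifting

variable {W H : Type u} [CommRing W] [CommRing H] [HopfAlgebra W H]
  {A : Type u} [CommRing A] [Algebra W A] {A' : Type u} [CommRing A'] [Algebra W A']
  (μ : H →ₐc[W] W[T;T⁻¹])

lemma mem_reesAlg_iff {t : A} {F : (A × A)[T;T⁻¹]} : F ∈ reesAlg W t ↔
    ∀ n : ℕ, (F.coeff n).2 = t ^ n * (F.coeff n).1 ∧
      (F.coeff (-n)).1 = t ^ n * (F.coeff (-n)).2 := Iff.rfl

lemma coeff_mapAlgHom {B C : Type u} [CommRing B] [Algebra W B] [CommRing C] [Algebra W C]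
    (φ : B →ₐ[W] C) (F : B[T;T⁻¹]) (n : ℤ) :
    (AddMonoidAlgebra.mapAlgHom ℤ φ F).coeff n = φ (F.coeff n) := by
  simp

/-- The homomorphism of Rees algebras induced by a homomorphism of the coefficient rings. -/
def reesMap (q : A →ₐ[W] A') (t : A) : reesAlg W t →ₐ[W] reesAlg W (q t) :=
  ((AddMonoidAlgebra.mapAlgHom ℤ (q.prodMap q)).comp (reesAlg W t).val).codRestrict _ (by
    intro F n
    have h := F.2 n
    have e : ∀ k, ((((AddMonoidAlgebra.mapAlgHom ℤ (q.prodMap q)).comp (reesAlg W t).val) F).coeff k)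
        = (q (F.1.coeff k).1, q (F.1.coeff k).2) := fun k => coeff_mapAlgHom (q.prodMap q) F.1 k
    rw [e, e]
    simp only [h.1, h.2, map_mul, map_pow, and_self])

lemma coeff_reesMap (q : A →ₐ[W] A') (t : A) (F : reesAlg W t) (k : ℤ) :
    (reesMap q t F).1.coeff k = (q (F.1.coeff k).1, q (F.1.coeff k).2) :=
  coeff_mapAlgHom (q.prodMap q) F.1 k

/-- In degrees `≥ 0` the first entry of a coefficient is free and determines the second; in negative
degrees the roles are exchanged. So it suffices to lift the free entry. -/
lemma reesMap_surjective (q : A →ₐ[W] A') (hq : Function.Surjective q) (t : A) :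
    Function.Surjective (reesMap q t) := by
  intro F
  let s := Function.surjInv hq
  have hs : ∀ a, q (s a) = a := Function.surjInv_eq hq
  let c : ℤ → A × A := fun n => if 0 ≤ n then (s (F.1.coeff n).1, t ^ n.toNat * s (F.1.coeff n).1)
    else (t ^ (-n).toNat * s (F.1.coeff n).2, s (F.1.coeff n).2)
  have hc : ∀ n, (q (c n).1, q (c n).2) = F.1.coeff n := by
    intro n
    by_cases hn : 0 ≤ n
    · simp only [c, if_pos hn, map_mul, map_pow, hs]
      refine Prod.ext rfl ?_
      lift n to ℕ using hn
      simpa using ((F.2 n).1).symm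
    · simp only [c, if_neg hn, map_mul, map_pow, hs]
      refine Prod.ext ?_ rfl
      obtain ⟨k, rfl⟩ : ∃ k : ℕ, n = -k := ⟨n.natAbs, by lia⟩
      simpa using ((F.2 k).2).symm
  -- The section `s` need not send `0` to `0`, so the lifted coefficients are cut off to the support
  -- of `F`.
  let G : (A × A)[T;T⁻¹] := .ofCoeff (Finsupp.onFinset F.1.coeff.support
    (fun n => if n ∈ F.1.coeff.support then c n else 0) (by intro n; simp; tauto))
  have hG : ∀ n, G.coeff n = if n ∈ F.1.coeff.support then c n else 0 := fun n => rfl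
  refine ⟨⟨G, ?_⟩, ?_⟩
  · rw [mem_reesAlg_iff]
    intro n
    rw [hG, hG]
    constructor
    · split_ifs with h
      · simp [c]
      · simp
    · split_ifs with h
      · rcases Nat.eq_zero_or_pos n with rfl | hn
        · simp [c]
        · have : ¬ (0 : ℤ) ≤ -n := by lia
          simp only [c, if_neg this]
          simp
      · simp
  · apply Subtype.ext
    apply LaurentPolynomial.ext
    intro n
    rw [coeff_reesMap]
    change (q (G.coeff n).1, q (G.coeff n).2) = _
    rw [hG]
    split_ifs with h
    · exact hc n
    · rw [Finsupp.notMem_support_iff.mp h]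
      simp

/-- A pair of degrees with sum `i + j` other than `(i, j)` differs from it in both entries, so its
contribution is a product of two elements of `K`. -/
lemma coeff_mul_of_sq_zero {B : Type u} [CommRing B] (K : Ideal B)
    (hK : ∀ a ∈ K, ∀ b ∈ K, a * b = 0) (F G : B[T;T⁻¹]) (i j : ℤ)
    (hF : ∀ n ≠ i, F.coeff n ∈ K) (hG : ∀ n ≠ j, G.coeff n ∈ K) :
    (F * G).coeff (i + j) = F.coeff i * G.coeff j := by
  rw [AddMonoidAlgebra.coeff_mul, Finsupp.sum]
  rw [Finset.sum_eq_single i]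
  · rw [Finsupp.sum, Finset.sum_eq_single j]
    · simp
    · intro n _ hn
      rw [if_neg (by lia)]
    · intro h
      simp [Finsupp.notMem_support_iff.mp h]
  · intro m _ hm
    rw [Finsupp.sum]
    refine Finset.sum_eq_zero fun n _ => ?_
    split_ifs with h
    · exact hK _ (hF m hm) _ (hG n (by lia))
    · rfl
  · intro h
    simp [Finsupp.sum, Finsupp.notMem_support_iff.mp h]

/-- Points of the degeneration lift along square-zero extensions. The proof lifts a graded
homomorphism from `H` to the Rees algebra and takes the graded part of the lift. -/
lemma degen_lift_of_sq_zero [Algebra.FormallySmooth W H] (q : A →ₐ[W] A')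
    (hq : Function.Surjective q) (hk : ∀ a b, q a = 0 → q b = 0 → a * b = 0) (t : A)
    {x : Pt W H A' × Pt W H A'} (hx : x ∈ degen μ (q t)) :
    ∃ y ∈ degen μ t, (Pt.map H q y.1, Pt.map H q y.2) = x := by
  -- A point of the degeneration is a graded homomorphism to the Rees algebra. The entries are
  -- exchanged because in the Rees algebra the second entry is the multiple of the first in
  -- nonnegative degrees.
  let φ : H →ₐ[W] reesAlg W (q t) :=
    ((AddMonoidAlgebra.mapAlgHom ℤ (x.2.ofConv.prod x.1.ofConv)).comp (conjHom μ)).codRestrict _ (by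
      intro f n
      have e : ∀ k, ((((AddMonoidAlgebra.mapAlgHom ℤ (x.2.ofConv.prod x.1.ofConv)).comp
          (conjHom μ)) f).coeff k) = (x.2.ofConv (wt μ k f), x.1.ofConv (wt μ k f)) :=
        fun k => coeff_mapAlgHom _ _ k
      rw [e, e]
      exact hx n f)
  have hφ : ∀ f k, (φ f).1.coeff k = (x.2.ofConv (wt μ k f), x.1.ofConv (wt μ k f)) :=
    fun f k => coeff_mapAlgHom (x.2.ofConv.prod x.1.ofConv) (conjHom μ f) k
  have hz : ∀ F : reesAlg W t, reesMap q t F = 0 →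
      ∀ n, q (F.1.coeff n).1 = 0 ∧ q (F.1.coeff n).2 = 0 := by
    intro F hF n
    have := coeff_reesMap q t F n
    rw [hF] at this
    exact ⟨congrArg Prod.fst this.symm, congrArg Prod.snd this.symm⟩
  have hsq : ∀ F G : reesAlg W t, reesMap q t F = 0 → reesMap q t G = 0 → F * G = 0 := by
    intro F G hF hG
    apply Subtype.ext
    apply LaurentPolynomial.ext
    intro n
    change (F.1 * G.1).coeff n = 0
    rw [AddMonoidAlgebra.coeff_mul]
    refine Finset.sum_eq_zero fun i _ => Finset.sum_eq_zero fun j _ => ?_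
    dsimp only
    split_ifs
    · exact Prod.ext (hk _ _ (hz F hF i).1 (hz G hG j).1) (hk _ _ (hz F hF i).2 (hz G hG j).2)
    · rfl
  obtain ⟨ψ, hψ⟩ := @exists_lift_of_sq_zero W H _ _ _ _ (reesAlg W t)
    (reesAlg W (q t)) _ _ _ _ φ (reesMap q t) (reesMap_surjective q hq t) hsq
  have hψc : ∀ f k, (q ((ψ f).1.coeff k).1, q ((ψ f).1.coeff k).2) =
      (x.2.ofConv (wt μ k f), x.1.ofConv (wt μ k f)) := by
    intro f k
    rw [← coeff_reesMap, hψ, hφ]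
  let K : Ideal (A × A) := RingHom.ker (q.prodMap q)
  have hK : ∀ a ∈ K, ∀ b ∈ K, a * b = 0 := by
    intro a ha b hb
    have ha' : (q a.1, q a.2) = 0 := ha
    have hb' : (q b.1, q b.2) = 0 := hb
    exact Prod.ext (hk _ _ (congrArg Prod.fst ha') (congrArg Prod.fst hb'))
      (hk _ _ (congrArg Prod.snd ha') (congrArg Prod.snd hb'))
  have hψK : ∀ i f n, n ≠ i → (ψ (wt μ i f)).1.coeff n ∈ K := by
    intro i f n hn
    change (q ((ψ (wt μ i f)).1.coeff n).1, q ((ψ (wt μ i f)).1.coeff n).2) = 0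
    rw [hψc, wt_of_ne μ hn, map_zero, map_zero]
    rfl
  -- The lift `ψ` need not be graded, but its coefficients off the expected degree lie in the
  -- square-zero ideal `K`. Discarding them therefore preserves multiplicativity.
  let c : ℤ → H →ₗ[W] A × A := fun n =>
    { toFun := fun f => (ψ f).1.coeff n
      map_add' := fun f g => by simp
      map_smul' := fun a f => by simp }
  obtain ⟨θ, hθ⟩ := exists_algHom_of_wt μ c (by
      change (ψ 1).1.coeff 0 = 1
      rw [map_one]
      change (1 : (A × A)[T;T⁻¹]).coeff 0 = 1
      rw [AddMonoidAlgebra.one_def, AddMonoidAlgebra.coeff_single, Finsupp.single_eq_same])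
    (fun i j f g => by
      change (ψ (wt μ i f * wt μ j g)).1.coeff (i + j) = _
      rw [map_mul]
      exact coeff_mul_of_sq_zero K hK _ _ i j (hψK i f) (hψK j g))
  refine ⟨(toConv ((AlgHom.snd W A A).comp θ), toConv ((AlgHom.fst W A A).comp θ)), ?_, ?_⟩
  · intro n f
    change (θ _).2 = t ^ n * (θ _).1 ∧ (θ _).1 = t ^ n * (θ _).2
    rw [hθ, hθ]
    exact ⟨((ψ (wt μ n f)).2 n).1, ((ψ (wt μ (-n) f)).2 n).2⟩
  · have h1 : ∀ n f, (q (θ (wt μ n f)).1, q (θ (wt μ n f)).2) =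
        (x.2.ofConv (wt μ n f), x.1.ofConv (wt μ n f)) := by
      intro n f
      rw [hθ]
      have := hψc (wt μ n f) n
      rwa [wt_self] at this
    apply Prod.ext
    · apply WithConv.ofConv_injective
      apply algHom_ext_wt μ
      intro n f
      exact congrArg Prod.snd (h1 n f)
    · apply WithConv.ofConv_injective
      apply algHom_ext_wt μ
      intro n f
      exact congrArg Prod.fst (h1 n f)

end Lifting

end

end CrisZip

namespace CrisZip

noncomputable section

/-! ### The algebra that represents the degeneration -/

section DegenAlg

variable {W H : Type u} [CommRing W] [CommRing H] [HopfAlgebra W H]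
  {A : Type u} [CommRing A] [Algebra W A] {B : Type u} [CommRing B] [Algebra W B] [Algebra A B]
  [IsScalarTower W A B]
  (μ : H →ₐc[W] W[T;T⁻¹])

/-- The homomorphism `A ⊗ (H ⊗ H) → B` of `A`-algebras given by a pair of points of `𝒢`. -/
def pairHom (A : Type u) [CommRing A] [Algebra W A] [Algebra A B] [IsScalarTower W A B]
    (x : Pt W H B × Pt W H B) : A ⊗[W] (H ⊗[W] H) →ₐ[A] B :=
  Algebra.TensorProduct.lift (Algebra.ofId A B)
    (Algebra.TensorProduct.lift x.1.ofConv x.2.ofConv fun _ _ => Commute.all _ _)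
    fun _ _ => Commute.all _ _

lemma pairHom_tmul (x : Pt W H B × Pt W H B) (a : A) (f g : H) :
    pairHom A x (a ⊗ₜ (f ⊗ₜ g)) = algebraMap A B a * (x.1.ofConv f * x.2.ofConv g) := by
  simp [pairHom, Algebra.ofId_apply]

/-- The pair of points of `𝒢` given by a homomorphism from `A ⊗ (H ⊗ H)`. -/
def homPair (φ : A ⊗[W] (H ⊗[W] H) →ₐ[A] B) : Pt W H B × Pt W H B :=
  (toConv (((φ.restrictScalars W).comp Algebra.TensorProduct.includeRight).comp
    Algebra.TensorProduct.includeLeft),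
   toConv (((φ.restrictScalars W).comp Algebra.TensorProduct.includeRight).comp
    Algebra.TensorProduct.includeRight))

lemma homPair_fst_apply (φ : A ⊗[W] (H ⊗[W] H) →ₐ[A] B) (f : H) :
    (homPair φ).1.ofConv f = φ (1 ⊗ₜ (f ⊗ₜ 1)) := rfl

lemma homPair_snd_apply (φ : A ⊗[W] (H ⊗[W] H) →ₐ[A] B) (f : H) :
    (homPair φ).2.ofConv f = φ (1 ⊗ₜ (1 ⊗ₜ f)) := rfl

lemma homPair_pairHom (x : Pt W H B × Pt W H B) : homPair (pairHom A x) = x := by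
  apply Prod.ext
  · apply WithConv.ofConv_injective
    ext f
    rw [homPair_fst_apply, pairHom_tmul]
    simp
  · apply WithConv.ofConv_injective
    ext f
    rw [homPair_snd_apply, pairHom_tmul]
    simp

lemma pairHom_homPair (φ : A ⊗[W] (H ⊗[W] H) →ₐ[A] B) : pairHom A (homPair φ) = φ := by
  apply Algebra.TensorProduct.ext
  · ext
  · apply Algebra.TensorProduct.ext
    · ext f
      simp [pairHom_tmul, homPair_fst_apply]
    · ext f
      simp [pairHom_tmul, homPair_snd_apply]

/-- The equations of the degeneration. -/
def degenIdeal (t : A) : Ideal (A ⊗[W] (H ⊗[W] H)) :=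
  Ideal.span (Set.range fun nf : ℕ × H =>
      (1 : A) ⊗ₜ[W] (wt μ nf.1 nf.2 ⊗ₜ[W] (1 : H)) - (t ^ nf.1) ⊗ₜ[W] ((1 : H) ⊗ₜ[W] wt μ nf.1 nf.2)) ⊔
    Ideal.span (Set.range fun nf : ℕ × H =>
      (1 : A) ⊗ₜ[W] ((1 : H) ⊗ₜ[W] wt μ (-nf.1) nf.2) -
        (t ^ nf.1) ⊗ₜ[W] (wt μ (-nf.1) nf.2 ⊗ₜ[W] (1 : H)))

/-- The `A`-algebra that represents the functor `B ↦ degen μ t`. -/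
def DegenAlg (t : A) : Type u := (A ⊗[W] (H ⊗[W] H)) ⧸ degenIdeal μ t

instance (t : A) : CommRing (DegenAlg μ t) := Ideal.Quotient.commRing _

instance (t : A) : Algebra A (DegenAlg μ t) := Ideal.instAlgebraQuotient A (degenIdeal μ t)

/-- The projection onto `DegenAlg μ t`. -/
def degenMk (t : A) : A ⊗[W] (H ⊗[W] H) →ₐ[A] DegenAlg μ t :=
  Ideal.Quotient.mkₐ A (degenIdeal μ t)

lemma degenMk_surjective (t : A) : Function.Surjective (degenMk μ t) :=
  Ideal.Quotient.mk_surjective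

lemma pairHom_degenIdeal {t : A} {x : Pt W H B × Pt W H B} :
    degenIdeal μ t ≤ RingHom.ker (pairHom A x) ↔ x ∈ degen μ (algebraMap A B t) := by
  rw [degenIdeal, sup_le_iff, Ideal.span_le, Ideal.span_le, Set.range_subset_iff,
    Set.range_subset_iff]
  simp only [SetLike.mem_coe, RingHom.mem_ker, map_sub, pairHom_tmul, sub_eq_zero, map_one,
    map_pow, one_mul, mul_one]
  exact ⟨fun h n f => ⟨h.1 (n, f), h.2 (n, f)⟩, fun h => ⟨fun nf => (h nf.1 nf.2).1,
    fun nf => (h nf.1 nf.2).2⟩⟩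

/-- The pair of points given by a homomorphism from `DegenAlg μ t`. -/
def degenPair {t : A} (φ : DegenAlg μ t →ₐ[A] B) : Pt W H B × Pt W H B :=
  homPair (φ.comp (degenMk μ t))

lemma degenPair_mem {t : A} (φ : DegenAlg μ t →ₐ[A] B) :
    degenPair μ φ ∈ degen μ (algebraMap A B t) := by
  rw [← pairHom_degenIdeal, degenPair, pairHom_homPair]
  intro z hz
  rw [RingHom.mem_ker, AlgHom.comp_apply]
  have : degenMk μ t z = 0 := Ideal.Quotient.eq_zero_iff_mem.mpr hz
  rw [this, map_zero]

lemma exists_degenPair_eq {t : A} {x : Pt W H B × Pt W H B}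
    (hx : x ∈ degen μ (algebraMap A B t)) : ∃ φ : DegenAlg μ t →ₐ[A] B, degenPair μ φ = x := by
  refine ⟨Ideal.Quotient.liftₐ _ (pairHom A x) (fun z hz => (pairHom_degenIdeal μ).mpr hx hz), ?_⟩
  exact homPair_pairHom (A := A) x

lemma map_degenPair {t : A} {C : Type u} [CommRing C] [Algebra W C] [Algebra A C]
    [IsScalarTower W A C] (φ : DegenAlg μ t →ₐ[A] B) (q : B →ₐ[A] C) :
    (Pt.map H (q.restrictScalars W) (degenPair μ φ).1,
      Pt.map H (q.restrictScalars W) (degenPair μ φ).2) = degenPair μ (q.comp φ) := rfl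

lemma degenPair_injective {t : A} {φ ψ : DegenAlg μ t →ₐ[A] B}
    (h : degenPair μ φ = degenPair μ ψ) : φ = ψ := by
  have := congrArg (pairHom A) h
  rw [degenPair, degenPair, pairHom_homPair, pairHom_homPair] at this
  exact (AlgHom.cancel_right (degenMk_surjective μ t)).mp this

/-- Square-zero lifting of points, read through representability. For `t = 0` it says that the zip
group of a smooth group is smooth. -/
instance degenAlg_formallySmooth [Algebra.FormallySmooth W H] (t : A) :
    Algebra.FormallySmooth A (DegenAlg μ t) := by
  apply Algebra.FormallySmooth.of_comp_surjective
  intro C _ _ I hI φ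
  let : Algebra W C := Algebra.compHom C (algebraMap W A)
  have : IsScalarTower W A C := IsScalarTower.of_algebraMap_eq' rfl
  obtain ⟨y, hy, hyx⟩ := degen_lift_of_sq_zero μ ((Ideal.Quotient.mkₐ A I).restrictScalars W)
    Ideal.Quotient.mk_surjective (by
      intro a b ha hb
      have ha' : a ∈ I := Ideal.Quotient.eq_zero_iff_mem.mp ha
      have hb' : b ∈ I := Ideal.Quotient.eq_zero_iff_mem.mp hb
      have := Ideal.mul_mem_mul ha' hb'
      rwa [← pow_two, hI] at this) (algebraMap A C t) (x := degenPair μ φ) (degenPair_mem μ φ)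
  obtain ⟨ψ, rfl⟩ := exists_degenPair_eq μ hy
  refine ⟨ψ, degenPair_injective μ ?_⟩
  rw [← map_degenPair]
  exact hyx

instance degenAlg_finitePresentation [IsNoetherianRing A] [Algebra.FiniteType W H] (t : A) :
    Algebra.FinitePresentation A (DegenAlg μ t) :=
  have : Algebra.FiniteType W (H ⊗[W] H) := .trans ‹Algebra.FiniteType W H› inferInstance
  have : Algebra.FiniteType A (DegenAlg μ t) :=
    .of_surjective (degenMk μ t) (degenMk_surjective μ t)
  Algebra.FinitePresentation.of_finiteType.mp this

/-- Points of the zip group lift along nilpotent extensions. -/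
lemma zip_lift_of_nilpotent [Algebra.FormallySmooth W H] {A' : Type u} [CommRing A'] [Algebra W A']
    (q : A →ₐ[W] A') (hq : Function.Surjective q) (hk : IsNilpotent (RingHom.ker q))
    {x : Pt W H A' × Pt W H A'} (hx : x ∈ degen μ 0) :
    ∃ y ∈ degen μ (0 : A), (Pt.map H q y.1, Pt.map H q y.2) = x := by
  -- Taking the parameter to be `0` in `W` makes the representing algebra a formally smooth
  -- `W`-algebra, which can be tested on `A → A'` directly.
  have h0 : algebraMap W A' 0 = 0 := map_zero _
  rw [← h0] at hx
  obtain ⟨φ, rfl⟩ := exists_degenPair_eq μ hx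
  have h1 := Algebra.FormallySmooth.comp_liftOfSurjective φ q hq hk
  refine ⟨degenPair μ (Algebra.FormallySmooth.liftOfSurjective φ q hq hk), ?_, ?_⟩
  · have := degenPair_mem μ (Algebra.FormallySmooth.liftOfSurjective φ q hq hk)
    rwa [map_zero] at this
  · conv_rhs => rw [← h1]
    rfl

end DegenAlg

end

end CrisZip

namespace CrisZip

noncomputable section

/-! ### The unipotent group `U₊` -/

section FiltQuot

variable {W : Type u} [CommRing W] {A : Type u} [CommRing A] [Algebra W A]
  {A' : Type u} [CommRing A'] [Algebra W A'] (q : A →ₐ[W] A') (k : ℕ)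

/-- The ideal of polynomials that vanish modulo `X ^ k` and modulo the kernel of `q`. -/
def filtIdeal : Ideal A[X] where
  carrier := {F | (∀ n < k, F.coeff n = 0) ∧ ∀ n, q (F.coeff n) = 0}
  zero_mem' := by simp
  add_mem' := by
    rintro F G ⟨h1, h2⟩ ⟨h3, h4⟩
    exact ⟨fun n hn => by rw [Polynomial.coeff_add, h1 n hn, h3 n hn, add_zero],
      fun n => by rw [Polynomial.coeff_add, map_add, h2, h4, add_zero]⟩
  smul_mem' := by
    rintro F G ⟨h1, h2⟩
    refine ⟨fun n hn => ?_, fun n => ?_⟩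
    · rw [smul_eq_mul, Polynomial.coeff_mul]
      refine Finset.sum_eq_zero fun i hi => ?_
      rw [h1 i.2 (by have := Finset.HasAntidiagonal.mem_antidiagonal.mp hi; lia), mul_zero]
    · rw [smul_eq_mul, Polynomial.coeff_mul, map_sum]
      refine Finset.sum_eq_zero fun i hi => ?_
      rw [map_mul, h2, mul_zero]

variable {q k} in
lemma mem_filtIdeal {F : A[X]} : F ∈ filtIdeal q k ↔
    (∀ n < k, F.coeff n = 0) ∧ ∀ n, q (F.coeff n) = 0 := Iff.rfl

/-- The quotient of `A[X]` by `filtIdeal q k`. -/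
def FiltQuot : Type u := A[X] ⧸ filtIdeal q k

instance : CommRing (FiltQuot q k) := Ideal.Quotient.commRing _

instance : Algebra W (FiltQuot q k) := Ideal.instAlgebraQuotient W (filtIdeal q k)

/-- The projection onto `FiltQuot q k`. -/
def filtMk : A[X] →ₐ[W] FiltQuot q k := Ideal.Quotient.mkₐ W (filtIdeal q k)

lemma filtMk_surjective : Function.Surjective (filtMk q k) := Ideal.Quotient.mk_surjective

lemma filtMk_eq_iff {F G : A[X]} : filtMk q k F = filtMk q k G ↔ F - G ∈ filtIdeal q k :=
  Ideal.Quotient.eq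

lemma filtMk_eq_zero_iff {F : A[X]} : filtMk q k F = 0 ↔ F ∈ filtIdeal q k :=
  Ideal.Quotient.eq_zero_iff_mem

/-- A linear map on `FiltQuot q k` induced by a linear map on polynomials. -/
def filtLift {M : Type u} [CommRing M] [Algebra W M] (L : A[X] →ₗ[W] M)
    (hL : ∀ F ∈ filtIdeal q k, L F = 0) : FiltQuot q k →ₗ[W] M where
  toFun := QuotientAddGroup.lift (filtIdeal q k).toAddSubgroup L.toAddMonoidHom hL
  map_add' := map_add _
  map_smul' := by
    intro w x
    obtain ⟨F, rfl⟩ := filtMk_surjective q k x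
    rw [← map_smul]
    exact map_smul L w F

/-- The projection to the degree `n` part. -/
def degreePart (n : ℕ) : FiltQuot q k →ₗ[W] FiltQuot q k :=
  filtLift (M := FiltQuot q k) q k ((filtMk q k).toLinearMap ∘ₗ
    ((Polynomial.monomial n).restrictScalars W ∘ₗ (Polynomial.lcoeff A n).restrictScalars W)) (by
      rintro F ⟨h1, h2⟩
      refine (filtMk_eq_zero_iff q k).mpr ⟨fun m hm => ?_, fun m => ?_⟩
      · change (Polynomial.monomial n (F.coeff n)).coeff m = 0
        rw [Polynomial.coeff_monomial]
        split_ifs with h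
        · exact h1 n (by lia)
        · rfl
      · change q ((Polynomial.monomial n (F.coeff n)).coeff m) = 0
        rw [Polynomial.coeff_monomial]
        split_ifs with h
        · exact h2 n
        · exact map_zero q)

lemma degreePart_mk (n : ℕ) (F : A[X]) :
    degreePart q k n (filtMk q k F) = filtMk q k (Polynomial.monomial n (F.coeff n)) := rfl

/-- The coefficient of degree `n < k` on `FiltQuot q k`. -/
def filtCoeff (n : ℕ) (h : n < k) : FiltQuot q k →ₗ[W] A :=
  filtLift q k ((Polynomial.lcoeff A n).restrictScalars W) (fun _ hF => hF.1 n h)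

lemma filtCoeff_mk (n : ℕ) (h : n < k) (F : A[X]) :
    filtCoeff q k n h (filtMk q k F) = F.coeff n := rfl

/-- The transition map from level `k + 1` to level `k`. -/
def filtMap : FiltQuot q (k + 1) →ₐ[W] FiltQuot q k :=
  Ideal.Quotient.factorₐ W (fun _ hF => ⟨fun n hn => hF.1 n (by lia), hF.2⟩)

lemma filtMap_mk (F : A[X]) : filtMap q k (filtMk q (k + 1) F) = filtMk q k F := rfl

lemma filtMap_surjective : Function.Surjective (filtMap q k) := by
  intro x
  obtain ⟨F, rfl⟩ := filtMk_surjective q k x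
  exact ⟨_, filtMap_mk q k F⟩

/-- The product starts in degree `2k ≥ k + 1`. Hence the transition maps `filtMap` are square-zero
extensions from level `1` on. -/
lemma mul_mem_filtIdeal (hk : 1 ≤ k) {F G : A[X]} (hF : F ∈ filtIdeal q k)
    (hG : G ∈ filtIdeal q k) : F * G ∈ filtIdeal q (k + 1) := by
  refine ⟨fun n hn => ?_, fun n => ?_⟩
  · rw [Polynomial.coeff_mul]
    refine Finset.sum_eq_zero fun i hi => ?_
    have := Finset.HasAntidiagonal.mem_antidiagonal.mp hi
    by_cases h : i.1 < k
    · rw [hF.1 _ h, zero_mul]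
    · rw [hG.1 _ (by lia), mul_zero]
  · rw [Polynomial.coeff_mul, map_sum]
    refine Finset.sum_eq_zero fun i hi => ?_
    rw [map_mul, hF.2, zero_mul]

end FiltQuot

section UPlus

variable {W H : Type u} [CommRing W] [CommRing H] [HopfAlgebra W H]
  {A : Type u} [CommRing A] [Algebra W A] {A' : Type u} [CommRing A'] [Algebra W A']
  (μ : H →ₐc[W] W[T;T⁻¹]) (q : A →ₐ[W] A')

/-- A homomorphism to `FiltQuot q k` is graded if it maps the part of weight `n` to the part of
degree `n`, and if it lifts the point `x`. -/
def IsGradedLift (x : Pt W H A') (k : ℕ) (φ : H →ₐ[W] FiltQuot q k) : Prop :=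
  (∀ n : ℕ, ∀ f, ∃ a, q a = x.ofConv (wt μ n f) ∧
    φ (wt μ n f) = filtMk q k (Polynomial.monomial n a)) ∧
  ∀ n < 0, ∀ f, φ (wt μ n f) = 0

/-- Smoothness lifts `φ` along the square-zero extension `filtMap`, and the lift is then replaced by
its graded part. This stays multiplicative because the errors lie in `filtIdeal q k`, and products
of two errors vanish at level `k + 1`. -/
lemma IsGradedLift.succ [Algebra.FormallySmooth W H] {x : Pt W H A'} {k : ℕ}
    (hk : 1 ≤ k) {φ : H →ₐ[W] FiltQuot q k} (hφ : IsGradedLift μ q x k φ) :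
    ∃ ψ : H →ₐ[W] FiltQuot q (k + 1), IsGradedLift μ q x (k + 1) ψ ∧ (filtMap q k).comp ψ = φ := by
  obtain ⟨ψ, hψ⟩ := exists_lift_of_sq_zero φ (filtMap q k) (filtMap_surjective q k) (by
    intro a b ha hb
    obtain ⟨F, rfl⟩ := filtMk_surjective q _ a
    obtain ⟨G, rfl⟩ := filtMk_surjective q _ b
    rw [filtMap_mk, filtMk_eq_zero_iff] at ha hb
    rw [← map_mul, filtMk_eq_zero_iff]
    exact mul_mem_filtIdeal q k hk ha hb)
  have hpos : ∀ (n : ℕ) f, ∃ a u, q a = x.ofConv (wt μ n f) ∧ u ∈ filtIdeal q k ∧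
      φ (wt μ n f) = filtMk q k (Polynomial.monomial n a) ∧
      ψ (wt μ n f) = filtMk q (k + 1) (Polynomial.monomial n a + u) := by
    intro n f
    obtain ⟨a, ha, hf⟩ := hφ.1 n f
    obtain ⟨F, hF⟩ := filtMk_surjective q _ (ψ (wt μ n f))
    refine ⟨a, F - Polynomial.monomial n a, ha, ?_, hf, by rw [add_sub_cancel, hF]⟩
    rw [← filtMk_eq_iff, ← filtMap_mk, hF, hψ, hf]
  have hneg : ∀ n < 0, ∀ f, ∃ u ∈ filtIdeal q k, ψ (wt μ n f) = filtMk q (k + 1) u := by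
    intro n hn f
    obtain ⟨F, hF⟩ := filtMk_surjective q _ (ψ (wt μ n f))
    refine ⟨F, ?_, hF.symm⟩
    rw [← filtMk_eq_zero_iff, ← filtMap_mk, hF, hψ, hφ.2 n hn]
  let c : ℤ → H →ₗ[W] FiltQuot q (k + 1) := fun n =>
    if 0 ≤ n then degreePart q (k + 1) n.toNat ∘ₗ ψ.toLinearMap else 0
  have hcpos : ∀ (n : ℕ) f, c n f = degreePart q (k + 1) n (ψ f) := fun n f => by simp [c]
  have hcneg : ∀ n < 0, c n = 0 := fun n hn => if_neg (by lia)
  have hdeg : ∀ (n : ℕ) (u : A[X]), u ∈ filtIdeal q k →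
      Polynomial.monomial n (u.coeff n) ∈ filtIdeal q k := by
    intro n u hu
    have := (filtMk_eq_zero_iff q k).mpr hu
    rw [← filtMk_eq_zero_iff, ← degreePart_mk, this, map_zero]
  have hX : ∀ (i n : ℕ) (a : A) (u : A[X]),
      (Polynomial.monomial i a * u).coeff (i + n) = a * u.coeff n := by
    intro i n a u
    rw [add_comm, Polynomial.coeff_monomial_mul]
  have hX' : ∀ (i n : ℕ) (a : A) (u : A[X]), n < i →
      (Polynomial.monomial i a * u).coeff n = 0 := by
    intro i n a u hn
    rw [← Polynomial.C_mul_X_pow_eq_monomial, mul_assoc, Polynomial.coeff_C_mul,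
      Polynomial.coeff_X_pow_mul', if_neg (by lia), mul_zero]
  -- The degree `m + n` is less than `m`, so the multiple of `X ^ m` contributes nothing; the other
  -- term is a product of two errors.
  have hmixed : ∀ (m : ℕ) (n : ℤ), n < 0 → ∀ f g, c (m + n) (wt μ m f * wt μ n g) = 0 := by
    intro m n hn f g
    by_cases hmn : (m : ℤ) + n < 0
    · rw [hcneg _ hmn]; rfl
    obtain ⟨l, hl⟩ := Int.eq_ofNat_of_zero_le (not_lt.mp hmn)
    obtain ⟨a, u, -, hu, -, hf⟩ := hpos m f
    obtain ⟨v, hv, hg⟩ := hneg n hn g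
    rw [hl, hcpos, map_mul, hf, hg, ← map_mul, degreePart_mk, add_mul, Polynomial.coeff_add,
      hX' _ _ _ _ (by lia), zero_add, ← degreePart_mk,
      (filtMk_eq_zero_iff q (k + 1)).mpr (mul_mem_filtIdeal q k hk hu hv), map_zero]
  obtain ⟨χ, hχ⟩ := exists_algHom_of_wt μ c (by
      have h := hcpos 0 1
      rw [Nat.cast_zero] at h
      rw [h, map_one, ← map_one (filtMk q (k + 1)), degreePart_mk]
      simp) (by
      intro m n f g
      rcases lt_or_ge m 0 with hm | hm <;> rcases lt_or_ge n 0 with hn | hn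
      · rw [hcneg _ hm, hcneg (m + n) (by lia)]
        simp
      · obtain ⟨n, rfl⟩ := Int.eq_ofNat_of_zero_le hn
        rw [mul_comm, add_comm m, hmixed n m hm, hcneg _ hm]
        simp
      · obtain ⟨m, rfl⟩ := Int.eq_ofNat_of_zero_le hm
        rw [hmixed m n hn, hcneg _ hn]
        simp
      · obtain ⟨n, rfl⟩ := Int.eq_ofNat_of_zero_le hn
        obtain ⟨m, rfl⟩ := Int.eq_ofNat_of_zero_le hm
        obtain ⟨a, u, -, hu, -, hf⟩ := hpos m f
        obtain ⟨b, v, -, hv, -, hg⟩ := hpos n g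
        rw [← Nat.cast_add, hcpos, hcpos, hcpos, map_mul, hf, hg, ← map_mul, degreePart_mk,
          degreePart_mk, degreePart_mk, ← map_mul, filtMk_eq_iff]
        have e1 : (Polynomial.monomial m a + u).coeff m = a + u.coeff m := by simp
        have e2 : (Polynomial.monomial n b + v).coeff n = b + v.coeff n := by simp
        have e3 : ((Polynomial.monomial m a + u) * (Polynomial.monomial n b + v)).coeff (m + n) =
            a * b + a * v.coeff n + b * u.coeff m + (u * v).coeff (m + n) := by
          rw [add_mul, mul_add, mul_add, Polynomial.coeff_add, Polynomial.coeff_add,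
            Polynomial.coeff_add, hX, hX, mul_comm u (Polynomial.monomial n b), add_comm m n, hX]
          simp
          ring
        -- The mixed terms `a v` and `b u` agree on both sides, so only products of two errors
        -- remain.
        have e4 : Polynomial.monomial (m + n) (((Polynomial.monomial m a + u) *
            (Polynomial.monomial n b + v)).coeff (m + n)) -
            Polynomial.monomial m ((Polynomial.monomial m a + u).coeff m) *
            Polynomial.monomial n ((Polynomial.monomial n b + v).coeff n) =
            Polynomial.monomial (m + n) ((u * v).coeff (m + n)) -
              Polynomial.monomial m (u.coeff m) * Polynomial.monomial n (v.coeff n) := by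
          rw [e1, e2, e3]
          simp only [Polynomial.monomial_mul_monomial, ← map_sub]
          congr 1
          ring
        rw [e4]
        refine sub_mem ?_ (mul_mem_filtIdeal q k hk (hdeg _ _ hu) (hdeg _ _ hv))
        rw [← filtMk_eq_zero_iff, ← degreePart_mk,
          (filtMk_eq_zero_iff q (k + 1)).mpr (mul_mem_filtIdeal q k hk hu hv), map_zero])
  have hval : ∀ (n : ℕ) f, ∃ a, q a = x.ofConv (wt μ n f) ∧
      χ (wt μ n f) = filtMk q (k + 1) (Polynomial.monomial n a) ∧
      φ (wt μ n f) = filtMk q k (Polynomial.monomial n a) := by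
    intro n f
    obtain ⟨a, u, ha, hu, hf, hf'⟩ := hpos n f
    refine ⟨a + u.coeff n, by rw [map_add, ha, hu.2, add_zero], ?_, ?_⟩
    · rw [hχ, hcpos, hf', degreePart_mk]
      simp
    · rw [hf, filtMk_eq_iff, ← map_sub, sub_add_cancel_left, map_neg]
      exact neg_mem (hdeg _ _ hu)
  refine ⟨χ, ⟨fun n f => ?_, fun n hn f => ?_⟩, algHom_ext_wt μ fun n f => ?_⟩
  · obtain ⟨a, ha, hf, -⟩ := hval n f
    exact ⟨a, ha, hf⟩
  · rw [hχ, hcneg n hn]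
    rfl
  · rcases lt_or_ge n 0 with hn | hn
    · rw [AlgHom.comp_apply, hφ.2 n hn, hχ, hcneg n hn]
      simp
    · obtain ⟨n, rfl⟩ := Int.eq_ofNat_of_zero_le hn
      obtain ⟨a, -, hf, hf'⟩ := hval n f
      rw [AlgHom.comp_apply, hf, hf', filtMap_mk]

/-- Level `1` embeds into `A'[X] × A` by reduction and constant coefficient. The homomorphism is
assembled from `f ↦ x(f) Xⁿ` in weight `n` and the unit of `𝒢(A)`, which agree in weight `0`.
Prescribing the constant coefficient is what keeps the final lift in `U₊`. -/
lemma exists_isGradedLift_one (hq : Function.Surjective q) {x : Pt W H A'}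
    (hx : (1, x) ∈ degen μ (0 : A')) :
    ∃ φ : H →ₐ[W] FiltQuot q 1, IsGradedLift μ q x 1 φ ∧
      ∀ f, filtCoeff q 1 0 one_pos (φ (wt μ 0 f)) = (1 : Pt W H A).ofConv (wt μ 0 f) := by
  obtain ⟨-, hneg, hzero⟩ := (mem_degen_zero_iff μ).mp hx
  let j₀ : A[X] →ₐ[W] A'[X] × A :=
    (Polynomial.mapAlgHom q).prod ((Polynomial.aeval (R := A) (0 : A)).restrictScalars W)
  have hj₀ : ∀ F, j₀ F = (F.map q.toRingHom, F.coeff 0) := by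
    intro F
    refine Prod.ext rfl ?_
    change Polynomial.aeval (0 : A) F = F.coeff 0
    rw [Polynomial.coeff_zero_eq_aeval_zero]
  have hmem : ∀ F, j₀ F = 0 ↔ F ∈ filtIdeal q 1 := by
    intro F
    rw [hj₀, Prod.mk_eq_zero, mem_filtIdeal, Polynomial.ext_iff, and_comm]
    simp only [Polynomial.coeff_map, Polynomial.coeff_zero, Nat.lt_one_iff, forall_eq]
    rfl
  let j : FiltQuot q 1 →ₐ[W] A'[X] × A :=
    Ideal.Quotient.liftₐ (filtIdeal q 1) j₀ (fun F hF => (hmem F).mpr hF)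
  have hj : ∀ F, j (filtMk q 1 F) = (F.map q.toRingHom, F.coeff 0) := hj₀
  have hinj : Function.Injective j := by
    rw [injective_iff_map_eq_zero]
    intro z hz
    obtain ⟨F, rfl⟩ := filtMk_surjective q 1 z
    exact (filtMk_eq_zero_iff q 1).mpr ((hmem F).mp hz)
  let c : ℤ → H →ₗ[W] A'[X] := fun n =>
    if 0 ≤ n then (Polynomial.monomial n.toNat).restrictScalars W ∘ₗ x.ofConv.toLinearMap else 0
  have hcpos : ∀ (n : ℕ) f, c n f = Polynomial.monomial n (x.ofConv f) := fun n f => by simp [c]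
  have hcneg : ∀ n < 0, c n = 0 := fun n hn => if_neg (by lia)
  have hmixed : ∀ (m : ℕ) (n : ℤ), n < 0 → ∀ f g, c (m + n) (wt μ m f * wt μ n g) = 0 := by
    intro m n hn f g
    by_cases hmn : (m : ℤ) + n < 0
    · rw [hcneg _ hmn]; rfl
    obtain ⟨l, hl⟩ := Int.eq_ofNat_of_zero_le (not_lt.mp hmn)
    rw [hl, hcpos, map_mul, hneg n hn, mul_zero, map_zero]
  obtain ⟨χ, hχ⟩ := exists_algHom_of_wt μ c (by
      have h := hcpos 0 1
      rw [Nat.cast_zero] at h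
      rw [h, map_one]
      rfl) (by
      intro m n f g
      rcases lt_or_ge m 0 with hm | hm <;> rcases lt_or_ge n 0 with hn | hn
      · rw [hcneg _ hm, hcneg (m + n) (by lia)]
        simp
      · obtain ⟨n, rfl⟩ := Int.eq_ofNat_of_zero_le hn
        rw [mul_comm, add_comm m, hmixed n m hm, hcneg _ hm]
        simp
      · obtain ⟨m, rfl⟩ := Int.eq_ofNat_of_zero_le hm
        rw [hmixed m n hn, hcneg _ hn]
        simp
      · obtain ⟨n, rfl⟩ := Int.eq_ofNat_of_zero_le hn
        obtain ⟨m, rfl⟩ := Int.eq_ofNat_of_zero_le hm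
        rw [← Nat.cast_add, hcpos, hcpos, hcpos, map_mul, Polynomial.monomial_mul_monomial])
  have hone : ∀ f, q ((1 : Pt W H A).ofConv f) = (1 : Pt W H A').ofConv f := by
    intro f
    rw [← map_one (Pt.map H q)]
    rfl
  have hval : ∀ (n : ℕ) f, ∃ a, q a = x.ofConv (wt μ n f) ∧
      (χ.prod (1 : Pt W H A).ofConv) (wt μ n f) = j (filtMk q 1 (Polynomial.monomial n a)) ∧
      (n = 0 → a = (1 : Pt W H A).ofConv (wt μ 0 f)) := by
    intro n f
    obtain ⟨a, ha⟩ : ∃ a, q a = x.ofConv (wt μ n f) ∧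
        (n = 0 → a = (1 : Pt W H A).ofConv (wt μ 0 f)) := by
      rcases Nat.eq_zero_or_pos n with rfl | hn
      · exact ⟨_, by rw [hone]; exact hzero f, fun _ => rfl⟩
      · obtain ⟨a, ha⟩ := hq (x.ofConv (wt μ n f))
        exact ⟨a, ha, by lia⟩
    refine ⟨a, ha.1, ?_, ha.2⟩
    rw [hj, AlgHom.prod_apply, hχ, hcpos, Polynomial.map_monomial]
    refine Prod.ext (by rw [← ha.1]; rfl) ?_
    change (1 : Pt W H A).ofConv (wt μ n f) = (Polynomial.monomial n a).coeff 0
    rw [Polynomial.coeff_monomial]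
    split_ifs with h
    · subst h
      exact (ha.2 rfl).symm
    · exact one_apply_wt μ (by exact_mod_cast h) f
  have hval' : ∀ n < 0, ∀ f, (χ.prod (1 : Pt W H A).ofConv) (wt μ n f) = 0 := by
    intro n hn f
    rw [AlgHom.prod_apply, hχ, hcneg n hn, one_apply_wt μ (by lia) f]
    rfl
  obtain ⟨φ, hφ⟩ := exists_comp_eq_of_injective j hinj (χ.prod (1 : Pt W H A).ofConv) (by
    intro f
    rw [← sum_wt μ f, Finsupp.sum, map_sum]
    refine sum_mem fun n _ => ?_
    rw [← wt_apply]
    rcases lt_or_ge n 0 with hn | hn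
    · rw [hval' n hn]
      exact zero_mem _
    · obtain ⟨n, rfl⟩ := Int.eq_ofNat_of_zero_le hn
      obtain ⟨a, -, h, -⟩ := hval n f
      exact ⟨_, h.symm⟩)
  have hφ' : ∀ (n : ℕ) f, ∃ a, q a = x.ofConv (wt μ n f) ∧
      φ (wt μ n f) = filtMk q 1 (Polynomial.monomial n a) ∧
      (n = 0 → a = (1 : Pt W H A).ofConv (wt μ 0 f)) := by
    intro n f
    obtain ⟨a, ha, h, h'⟩ := hval n f
    refine ⟨a, ha, hinj ?_, h'⟩
    rw [← h, ← hφ]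
    rfl
  refine ⟨φ, ⟨fun n f => ?_, fun n hn f => ?_⟩, fun f => ?_⟩
  · obtain ⟨a, ha, h, -⟩ := hφ' n f
    exact ⟨a, ha, h⟩
  · apply hinj
    rw [map_zero, ← hval' n hn f, ← hφ]
    rfl
  · obtain ⟨a, -, h, h'⟩ := hφ' 0 f
    rw [Nat.cast_zero] at h
    rw [h, filtCoeff_mk, Polynomial.coeff_monomial, if_pos rfl, h' rfl]

/-- Points of `U₊` lift along arbitrary surjections. -/
lemma uPlus_lift [Algebra.FormallySmooth W H] (hq : Function.Surjective q) {x : Pt W H A'}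
    (hx : (1, x) ∈ degen μ (0 : A')) :
    ∃ y : Pt W H A, (1, y) ∈ degen μ (0 : A) ∧ Pt.map H q y = x := by
  obtain ⟨φ₁, hφ₁, hφ₁'⟩ := exists_isGradedLift_one μ q hq hx
  -- The index is shifted so that the tower starts at level `1`, where the lift is explicit and from
  -- which `IsGradedLift.succ` applies.
  let S (k : ℕ) : Type u := {φ : H →ₐ[W] FiltQuot q (k + 1) // IsGradedLift μ q x (k + 1) φ}
  have step : ∀ k (s : S k), ∃ s' : S (k + 1), (filtMap q (k + 1)).comp s'.1 = s.1 := by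
    intro k s
    obtain ⟨ψ, h1, h2⟩ := s.2.succ μ q (by lia)
    exact ⟨⟨ψ, h1⟩, h2⟩
  choose next hnext using step
  let s : ∀ k, S k := fun k => Nat.rec ⟨φ₁, hφ₁⟩ next k
  have hs : ∀ k, (filtMap q (k + 1)).comp (s (k + 1)).1 = (s k).1 := fun k => hnext k (s k)
  have hcoeff : ∀ n k (h : n ≤ k) f, filtCoeff q (k + 1) n (by lia) ((s k).1 f) =
      filtCoeff q (n + 1) n (by lia) ((s n).1 f) := by
    intro n k h f
    induction k, h using Nat.le_induction with
    | base => rfl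
    | succ k h ih =>
      rw [← ih, ← hs k, AlgHom.comp_apply]
      obtain ⟨F, hF⟩ := filtMk_surjective q (k + 1 + 1) ((s (k + 1)).1 f)
      rw [← hF, filtMap_mk, filtCoeff_mk, filtCoeff_mk]
  -- In weight `n` only the coefficient of degree `n` is needed, and it is already visible at level
  -- `n + 1` and constant from there on. So the limit takes values in `A` and no completeness is
  -- required.
  let c : ℤ → H →ₗ[W] A := fun n =>
    if 0 ≤ n then filtCoeff q (n.toNat + 1) n.toNat (by lia) ∘ₗ (s n.toNat).1.toLinearMap else 0
  have hcpos : ∀ (n : ℕ) f, c n f = filtCoeff q (n + 1) n (by lia) ((s n).1 f) :=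
    fun n f => by simp [c]
  have hcneg : ∀ n < 0, c n = 0 := fun n hn => if_neg (by lia)
  have hmixed : ∀ (m : ℕ) (n : ℤ), n < 0 → ∀ f g, c (m + n) (wt μ m f * wt μ n g) = 0 := by
    intro m n hn f g
    by_cases hmn : (m : ℤ) + n < 0
    · rw [hcneg _ hmn]; rfl
    obtain ⟨l, hl⟩ := Int.eq_ofNat_of_zero_le (not_lt.mp hmn)
    rw [hl, hcpos, map_mul, (s l).2.2 n hn, mul_zero, map_zero]
  obtain ⟨y, hy⟩ := exists_algHom_of_wt μ c (by
      have h := hcpos 0 1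
      rw [Nat.cast_zero] at h
      rw [h, map_one, ← map_one (filtMk q _), filtCoeff_mk]
      simp) (by
      intro m n f g
      rcases lt_or_ge m 0 with hm | hm <;> rcases lt_or_ge n 0 with hn | hn
      · rw [hcneg _ hm, hcneg (m + n) (by lia)]
        simp
      · obtain ⟨n, rfl⟩ := Int.eq_ofNat_of_zero_le hn
        rw [mul_comm, add_comm m, hmixed n m hm, hcneg _ hm]
        simp
      · obtain ⟨m, rfl⟩ := Int.eq_ofNat_of_zero_le hm
        rw [hmixed m n hn, hcneg _ hn]
        simp
      · obtain ⟨n, rfl⟩ := Int.eq_ofNat_of_zero_le hn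
        obtain ⟨m, rfl⟩ := Int.eq_ofNat_of_zero_le hm
        obtain ⟨a, -, ha⟩ := (s (m + n)).2.1 m f
        obtain ⟨b, -, hb⟩ := (s (m + n)).2.1 n g
        -- Both factors are moved to the stage indexed by `m + n`, where a single algebra
        -- homomorphism computes all three values.
        rw [← Nat.cast_add, hcpos, hcpos, hcpos, ← hcoeff m (m + n) (by lia),
          ← hcoeff n (m + n) (by lia), map_mul, ha, hb, ← map_mul, filtCoeff_mk, filtCoeff_mk,
          filtCoeff_mk, Polynomial.monomial_mul_monomial]
        simp)
  refine ⟨toConv y, (mem_degen_zero_iff μ).mpr ⟨fun n hn f => one_apply_wt μ (by lia) f,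
    fun n hn f => ?_, fun f => ?_⟩, ?_⟩
  · change y _ = 0
    rw [hy, hcneg n hn]
    rfl
  · change _ = y _
    have h := hcpos 0 (wt μ 0 f)
    rw [Nat.cast_zero] at h
    rw [hy, h]
    exact (hφ₁' f).symm
  · apply WithConv.ofConv_injective
    refine algHom_ext_wt μ fun n f => ?_
    change q (y _) = _
    rw [hy]
    rcases lt_or_ge n 0 with hn | hn
    · rw [hcneg n hn, ((mem_degen_zero_iff μ).mp hx).2.1 n hn f]
      exact map_zero q
    · obtain ⟨n, rfl⟩ := Int.eq_ofNat_of_zero_le hn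
      obtain ⟨a, ha, h⟩ := (s n).2.1 n f
      rw [hcpos, h, filtCoeff_mk, Polynomial.coeff_monomial, if_pos rfl, ha]

end UPlus

end

end CrisZip

namespace CrisZip

noncomputable section

/-! ### Infinitesimal decomposition -/

section Decomposition

variable {W H : Type u} [CommRing W] [CommRing H] [HopfAlgebra W H]
  {A : Type u} [CommRing A] [Algebra W A]
  (μ : H →ₐc[W] W[T;T⁻¹])

/-- Points that reduce to `1` modulo a square-zero ideal multiply by adding their differentials. -/
lemma mul_apply_of_sq_zero {I : Ideal A} (hI : ∀ a ∈ I, ∀ b ∈ I, a * b = 0) {g h : Pt W H A}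
    (hg : ∀ f, g.ofConv f - (1 : Pt W H A).ofConv f ∈ I)
    (hh : ∀ f, h.ofConv f - (1 : Pt W H A).ofConv f ∈ I) (f : H) :
    (g * h).ofConv f = g.ofConv f + h.ofConv f - (1 : Pt W H A).ofConv f := by
  have key : ∀ z : H ⊗[W] H,
      Algebra.TensorProduct.lmul' W (Algebra.TensorProduct.map g.ofConv h.ofConv z) =
      Algebra.TensorProduct.lmul' W (Algebra.TensorProduct.map g.ofConv (1 : Pt W H A).ofConv z) +
      Algebra.TensorProduct.lmul' W (Algebra.TensorProduct.map (1 : Pt W H A).ofConv h.ofConv z) -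
      Algebra.TensorProduct.lmul' W
        (Algebra.TensorProduct.map (1 : Pt W H A).ofConv (1 : Pt W H A).ofConv z) := by
    intro z
    induction z using TensorProduct.induction_on with
    | zero => simp
    | add z w hz hw =>
      simp only [map_add, hz, hw]
      ring
    | tmul a b =>
      simp only [Algebra.TensorProduct.map_tmul, Algebra.TensorProduct.lmul'_apply_tmul]
      linear_combination hI _ (hg a) _ (hh b)
  have hmul : ∀ g h : Pt W H A, (g * h).ofConv f = Algebra.TensorProduct.lmul' W
      (Algebra.TensorProduct.map g.ofConv h.ofConv (Coalgebra.comul (R := W) f)) := by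
    intro g h
    rw [AlgHom.convMul_def]
    simp
  rw [hmul g h, key, ← hmul, ← hmul, ← hmul, one_mul, mul_one, one_mul]

lemma map_mk_eq_iff {I : Ideal A} {g h : Pt W H A} :
    Pt.map H (Ideal.Quotient.mkₐ W I) g = Pt.map H (Ideal.Quotient.mkₐ W I) h ↔
      ∀ f, g.ofConv f - h.ofConv f ∈ I := by
  constructor
  · intro e f
    exact Ideal.Quotient.eq.mp (DFunLike.congr_fun (congrArg WithConv.ofConv e) f)
  · intro e
    apply WithConv.ofConv_injective
    ext f
    exact Ideal.Quotient.eq.mpr (e f)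

lemma map_mk_eq_one_iff {I : Ideal A} {g : Pt W H A} :
    Pt.map H (Ideal.Quotient.mkₐ W I) g = 1 ↔
      ∀ f, g.ofConv f - (1 : Pt W H A).ofConv f ∈ I := by
  rw [← map_mk_eq_iff, map_one]

/-- The points of the parabolic subgroup `P₋`. -/
lemma exists_mem_zipGroup_iff {g : Pt W H A} :
    (∃ m, (g, m) ∈ zipGroup A μ) ↔ ∀ n > 0, ∀ f, g.ofConv (wt μ n f) = 0 := by
  constructor
  · rintro ⟨m, hm⟩
    exact ((mem_degen_zero_iff μ).mp ((mem_zipGroup_iff μ).mp hm)).1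
  · intro h
    obtain ⟨m, h0, h1⟩ := exists_levi μ g (fun n f k hn => by
      rcases lt_or_gt_of_ne hn with hn | hn
      · rw [h (-n) (by lia), mul_zero]
      · rw [h n hn, zero_mul])
    exact ⟨m, (mem_zipGroup_iff μ).mpr ((mem_degen_zero_iff μ).mpr
      ⟨h, fun n hn f => h1 n f (by lia), fun f => (h0 f).symm⟩)⟩

/-- The part of a point infinitesimally near to `1` with weights in the set `s`. -/
lemma exists_weightPart {I : Ideal A} (hI : ∀ a ∈ I, ∀ b ∈ I, a * b = 0) {d : Pt W H A}
    (hd : ∀ f, d.ofConv f - (1 : Pt W H A).ofConv f ∈ I) (s : Set ℤ) [DecidablePred (· ∈ s)] :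
    ∃ e : Pt W H A, ∀ n f, e.ofConv (wt μ n f) =
      if n ∈ s then d.ofConv (wt μ n f) else (1 : Pt W H A).ofConv (wt μ n f) := by
  obtain ⟨e, he⟩ := exists_algHom_of_wt μ (A := A)
    (fun n => if n ∈ s then d.ofConv.toLinearMap else (1 : Pt W H A).ofConv.toLinearMap) (by
      split_ifs
      · exact map_one d.ofConv
      · exact map_one (1 : Pt W H A).ofConv) (by
      intro i j f g
      -- This relation settles all cases: in nonzero weight the unit vanishes, so the values of `d`
      -- there lie in `I`, and a product of two of them is zero.
      have hij := hI _ (hd (wt μ i f)) _ (hd (wt μ j g))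
      by_cases hi : i = 0
      · subst hi
        by_cases hj : j = 0
        · subst hj
          rw [zero_add]
          split_ifs
          · exact map_mul d.ofConv _ _
          · exact map_mul (1 : Pt W H A).ofConv _ _
        · have hgj := one_apply_wt μ (A := A) hj g
          rw [hgj] at hij
          rw [zero_add]
          split_ifs
          · exact map_mul d.ofConv _ _
          · change d.ofConv _ = (1 : Pt W H A).ofConv _ * d.ofConv _
            rw [map_mul]
            linear_combination hij
          · change (1 : Pt W H A).ofConv _ = d.ofConv _ * (1 : Pt W H A).ofConv _
            rw [map_mul, hgj, mul_zero, mul_zero]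
          · exact map_mul (1 : Pt W H A).ofConv _ _
      · have hfi := one_apply_wt μ (A := A) hi f
        rw [hfi] at hij
        by_cases hj : j = 0
        · subst hj
          rw [add_zero]
          split_ifs
          · exact map_mul d.ofConv _ _
          · change d.ofConv _ = d.ofConv _ * (1 : Pt W H A).ofConv _
            rw [map_mul]
            linear_combination hij
          · change (1 : Pt W H A).ofConv _ = (1 : Pt W H A).ofConv _ * d.ofConv _
            rw [map_mul, hfi, zero_mul, zero_mul]
          · exact map_mul (1 : Pt W H A).ofConv _ _
        · have hgj := one_apply_wt μ (A := A) hj g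
          rw [hgj] at hij
          have h1 : (if i + j ∈ s then d.ofConv.toLinearMap else (1 : Pt W H A).ofConv.toLinearMap)
              (wt μ i f * wt μ j g) = 0 := by
            split_ifs
            · change d.ofConv _ = 0
              rw [map_mul]
              linear_combination hij
            · change (1 : Pt W H A).ofConv _ = 0
              rw [map_mul, hfi, zero_mul]
          rw [h1]
          split_ifs
          · change 0 = d.ofConv _ * d.ofConv _
            linear_combination -hij
          · change 0 = d.ofConv _ * (1 : Pt W H A).ofConv _
            rw [hgj, mul_zero]
          · change 0 = (1 : Pt W H A).ofConv _ * _
            rw [hfi, zero_mul]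
          · change 0 = (1 : Pt W H A).ofConv _ * _
            rw [hfi, zero_mul])
  refine ⟨toConv e, fun n f => ?_⟩
  change e _ = _
  rw [he]
  split_ifs <;> rfl

/-- The reduction of `g` lies in `P₋` and lifts to `P₋(A)` because the zip group is smooth. The
remaining factor is infinitesimally near `1`, where multiplication adds differentials, so it splits
into its weights `≤ 0`, which go to `P₋`, and its weights `> 0`, which go to `U₊`. -/
lemma exists_decomposition_of_sq_zero [Algebra.FormallySmooth W H] {I : Ideal A}
    (hI : ∀ a ∈ I, ∀ b ∈ I, a * b = 0) {g : Pt W H A}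
    (hg : ∀ n > 0, ∀ f, g.ofConv (wt μ n f) ∈ I) :
    ∃ z k : Pt W H A, g = z * k ∧ (∀ n > 0, ∀ f, z.ofConv (wt μ n f) = 0) ∧
      (1, k) ∈ degen μ (0 : A) ∧ Pt.map H (Ideal.Quotient.mkₐ W I) k = 1 := by
  have hnil : IsNilpotent (RingHom.ker (Ideal.Quotient.mkₐ W I)) := by
    refine ⟨2, ?_⟩
    rw [pow_two, Ideal.zero_eq_bot, eq_bot_iff, Ideal.mul_le]
    intro a ha b hb
    exact hI a (Ideal.Quotient.eq_zero_iff_mem.mp ha) b (Ideal.Quotient.eq_zero_iff_mem.mp hb)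
  obtain ⟨m, hm⟩ := (exists_mem_zipGroup_iff μ (g := Pt.map H (Ideal.Quotient.mkₐ W I) g)).mpr
    (fun n hn f => Ideal.Quotient.eq_zero_iff_mem.mpr (hg n hn f))
  obtain ⟨y, hy, hym⟩ := zip_lift_of_nilpotent μ (Ideal.Quotient.mkₐ W I)
    Ideal.Quotient.mk_surjective hnil ((mem_zipGroup_iff μ).mp hm)
  have hy1 : Pt.map H (Ideal.Quotient.mkₐ W I) y.1 = Pt.map H (Ideal.Quotient.mkₐ W I) g :=
    congrArg Prod.fst hym
  have hd : Pt.map H (Ideal.Quotient.mkₐ W I) (y.1⁻¹ * g) = 1 := by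
    rw [map_mul, map_inv, hy1, inv_mul_cancel]
  rw [map_mk_eq_one_iff] at hd
  obtain ⟨e, he⟩ := exists_weightPart μ hI hd {n | n ≤ 0}
  obtain ⟨k, hk⟩ := exists_weightPart μ hI hd {n | 0 < n}
  have hmem : ∀ {e : Pt W H A} {s : Set ℤ} [DecidablePred (· ∈ s)], (∀ n f, e.ofConv (wt μ n f) =
      if n ∈ s then (y.1⁻¹ * g).ofConv (wt μ n f) else (1 : Pt W H A).ofConv (wt μ n f)) →
      ∀ f, e.ofConv f - (1 : Pt W H A).ofConv f ∈ I := by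
    intro e s _ he f
    rw [← sum_wt μ f, Finsupp.sum, map_sum, map_sum, ← Finset.sum_sub_distrib]
    refine sum_mem fun n _ => ?_
    rw [← wt_apply, he]
    split_ifs
    · exact hd _
    · rw [sub_self]
      exact zero_mem _
  have hek : y.1⁻¹ * g = e * k := by
    apply WithConv.ofConv_injective
    refine algHom_ext_wt μ fun n f => ?_
    rw [mul_apply_of_sq_zero hI (hmem he) (hmem hk), he, hk]
    by_cases hn : n ≤ 0
    · rw [if_pos (show n ∈ {n | n ≤ 0} from hn), if_neg (show n ∉ {n | 0 < n} from not_lt.mpr hn)]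
      ring
    · rw [if_neg (show n ∉ {n | n ≤ 0} from hn),
        if_pos (show n ∈ {n | 0 < n} from not_le.mp hn)]
      ring
  refine ⟨y.1 * e, k, by rw [mul_assoc, ← hek, mul_inv_cancel_left], ?_, ?_, ?_⟩
  · rw [← exists_mem_zipGroup_iff]
    obtain ⟨l, hl⟩ := (exists_mem_zipGroup_iff μ (g := e)).mpr (fun n hn f => by
      rw [he, if_neg (show n ∉ {n | n ≤ 0} from not_le.mpr hn), one_apply_wt μ (by lia)])
    have hyl := (zipGroup A μ).mul_mem ((mem_zipGroup_iff μ).mpr hy) hl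
    exact ⟨y.2 * l, hyl⟩
  · rw [mem_degen_zero_iff]
    refine ⟨fun n hn f => one_apply_wt μ (by lia) f, fun n hn f => ?_, fun f => ?_⟩
    · change k.ofConv _ = 0
      rw [hk, if_neg (show n ∉ {n | 0 < n} from not_lt.mpr hn.le), one_apply_wt μ (by lia)]
    · change _ = k.ofConv _
      rw [hk, if_neg (show (0 : ℤ) ∉ {n | 0 < n} from fun h => lt_irrefl (0 : ℤ) h)]
  · rw [map_mk_eq_one_iff]
    exact hmem hk

lemma uPlus_mul {k l : Pt W H A} (hk : (1, k) ∈ degen μ (0 : A)) (hl : (1, l) ∈ degen μ (0 : A)) :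
    (1, k * l) ∈ degen μ (0 : A) := by
  rw [← mem_zipGroup_iff] at *
  simpa using mul_mem hk hl

/-- A point that lies in `P₋` modulo a nilpotent ideal is the product of a point of `P₋` and a point
of `U₊` infinitesimally near to `1`. -/
lemma exists_decomposition_of_nilpotent [Algebra.FormallySmooth W H] {I : Ideal A} {r : ℕ}
    (hI : I ^ (r + 1) = ⊥) {g : Pt W H A} (hg : ∀ n > 0, ∀ f, g.ofConv (wt μ n f) ∈ I) :
    ∃ z k : Pt W H A, g = z * k ∧ (∀ n > 0, ∀ f, z.ofConv (wt μ n f) = 0) ∧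
      (1, k) ∈ degen μ (0 : A) ∧ Pt.map H (Ideal.Quotient.mkₐ W I) k = 1 := by
  induction r generalizing A with
  | zero =>
    rw [zero_add, pow_one] at hI
    refine ⟨g, 1, (mul_one g).symm, fun n hn f => ?_, ?_, map_one _⟩
    · simpa [hI] using hg n hn f
    · rw [← mem_zipGroup_iff]
      exact one_mem _
  | succ r ih =>
    -- The ideal `J` has square zero since `2 (r + 1) ≥ r + 2`. The factor in `U₊` found over `A ⧸
    -- J` lifts to `A`, and after dividing by it the square-zero case applies.
    let J := I ^ (r + 1)
    have hJI : J ≤ I := Ideal.pow_le_self (by lia)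
    let π := Ideal.Quotient.mkₐ W J
    let I₁ : Ideal (A ⧸ J) := I.map (Ideal.Quotient.mk J)
    have hI₁ : I₁ ^ (r + 1) = ⊥ := by
      rw [← Ideal.map_pow]
      exact Ideal.map_quotient_self J
    obtain ⟨z₁, k₁, h₁, hz₁, hk₁, hk₁'⟩ := ih hI₁ (g := Pt.map H π g) (fun n hn f =>
      Ideal.mem_map_of_mem _ (hg n hn f))
    obtain ⟨k, hk, rfl⟩ := uPlus_lift μ π Ideal.Quotient.mk_surjective hk₁
    have hJ : ∀ a ∈ J, ∀ b ∈ J, a * b = 0 := by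
      intro a ha b hb
      have h := Ideal.mul_mem_mul ha hb
      have h2 : J * J ≤ I ^ (r + 1 + 1) := by
        rw [← pow_add]
        exact Ideal.pow_le_pow_right (by lia)
      rw [hI] at h2
      exact h2 h
    obtain ⟨z, l, h, hz, hl, hl'⟩ := exists_decomposition_of_sq_zero μ hJ (g := g * k⁻¹)
      (fun n hn f => by
        rw [← Ideal.Quotient.eq_zero_iff_mem]
        have e : Pt.map H π (g * k⁻¹) = z₁ := by rw [map_mul, map_inv, h₁, mul_inv_cancel_right]
        exact (DFunLike.congr_fun (congrArg WithConv.ofConv e) _).trans (hz₁ n hn f))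
    refine ⟨z, l * k, by rw [← mul_assoc, ← h, inv_mul_cancel_right], hz, uPlus_mul μ hl hk, ?_⟩
    have hl₁ : Pt.map H (Ideal.Quotient.mkₐ W I) l = 1 := by
      rw [map_mk_eq_one_iff] at hl' ⊢
      exact fun f => hJI (hl' f)
    rw [map_mul, hl₁, one_mul, map_mk_eq_one_iff]
    intro f
    rw [map_mk_eq_one_iff] at hk₁'
    refine (Ideal.mem_quotient_iff_mem hJI).mp ?_
    have h1 : (1 : Pt W H (A ⧸ J)) = Pt.map H π 1 := (map_one _).symm
    have := hk₁' f
    rw [h1] at this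
    exact this

end Decomposition

end

end CrisZip

namespace CrisZip

noncomputable section

/-! ### The degeneration and the cells -/

section Cells

variable {W H : Type u} [CommRing W] [CommRing H] [HopfAlgebra W H]
  {A : Type u} [CommRing A] [Algebra W A]
  (μ : H →ₐc[W] W[T;T⁻¹])

lemma conj_apply_wt (r : Aˣ) (g : Pt W H A) (n : ℤ) (f : H) :
    (cocharAt μ r * g * (cocharAt μ r)⁻¹).ofConv (wt μ n f) =
      g.ofConv (wt μ n f) * ((r ^ n : Aˣ) : A) := by
  rw [conj_apply, conjHom_wt, AddMonoidAlgebra.coeff_single, Finsupp.sum_single_index (by simp)]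

lemma algebraMap_away_injective {t : A} (ht : t ∈ nonZeroDivisors A) :
    Function.Injective (algebraMap A (Localization.Away t)) :=
  IsLocalization.injective _ (Submonoid.powers_le.mpr ht)

lemma coe_unitAway_pow (t : A) (n : ℕ) :
    ((unitAway t ^ n : (Localization.Away t)ˣ) : Localization.Away t) =
      algebraMap A (Localization.Away t) (t ^ n) := by
  rw [Units.val_pow_eq_pow_val, map_pow]
  rfl

/-- For a nonzerodivisor `t`, the degeneration at `t` is the graph of conjugation by `μ(t)`. -/
lemma mem_degen_iff {t : A} (ht : t ∈ nonZeroDivisors A) {x : Pt W H A × Pt W H A} :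
    x ∈ degen μ t ↔
      toLoc t x.1 * cocharAt μ (unitAway t) = cocharAt μ (unitAway t) * toLoc t x.2 := by
  have hinj := algebraMap_away_injective ht
  have hloc : ∀ (y : Pt W H A) f, (toLoc t y).ofConv f = algebraMap A _ (y.ofConv f) :=
    fun _ _ => rfl
  rw [← eq_mul_inv_iff_mul_eq]
  constructor
  · intro h
    apply WithConv.ofConv_injective
    refine algHom_ext_wt μ fun n f => ?_
    rw [conj_apply_wt, hloc, hloc]
    obtain ⟨n, rfl | rfl⟩ := n.eq_nat_or_neg
    · rw [zpow_natCast, coe_unitAway_pow, ← map_mul, mul_comm, (h n f).1]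
    · rw [(h n f).2, zpow_neg, zpow_natCast, Units.eq_mul_inv_iff_mul_eq, coe_unitAway_pow,
        ← map_mul, mul_comm]
  · intro h n f
    have e : ∀ k, algebraMap A (Localization.Away t) (x.1.ofConv (wt μ k f)) = _ := fun k =>
      (DFunLike.congr_fun (congrArg WithConv.ofConv h) (wt μ k f)).trans
        (conj_apply_wt μ (unitAway t) (toLoc t x.2) k f)
    constructor
    · apply hinj
      rw [e, zpow_natCast, coe_unitAway_pow, hloc, ← map_mul, mul_comm]
    · apply hinj
      have := e (-n)
      rw [zpow_neg, zpow_natCast, Units.eq_mul_inv_iff_mul_eq, coe_unitAway_pow, ← map_mul,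
        hloc] at this
      rw [← this, mul_comm]

/-- Over `A[1/t]` the set is the graph of a homomorphism, namely conjugation. -/
lemma degen_mul {t : A} (ht : t ∈ nonZeroDivisors A) {x y : Pt W H A × Pt W H A}
    (hx : x ∈ degen μ t) (hy : y ∈ degen μ t) : x * y ∈ degen μ t := by
  rw [mem_degen_iff μ ht] at *
  rw [Prod.fst_mul, Prod.snd_mul, map_mul, map_mul, mul_assoc, hy, ← mul_assoc, hx, mul_assoc]

/-- The relation between two elements of a cell in terms of the degeneration. -/
lemma exists_cellElt_eq_iff {B : Type u} [CommRing B] [Algebra W B] (q : A →ₐ[W] B) {t : A}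
    (ht : t ∈ nonZeroDivisors A) (g h g' h' : Pt W H A) :
    (∃ k ∈ kerLoc H t q, ∃ k' ∈ kerLoc H t q, cellElt μ t g' h' = k * cellElt μ t g h * k') ↔
      ∃ x ∈ degen μ t, Pt.map H q x.1 = (Pt.map H q g')⁻¹ * Pt.map H q g ∧
        Pt.map H q x.2 = Pt.map H q h' * (Pt.map H q h)⁻¹ := by
  constructor
  · rintro ⟨_, ⟨k, hk, rfl⟩, _, ⟨k', hk', rfl⟩, e⟩
    have hk : Pt.map H q k = 1 := hk
    have hk' : Pt.map H q k' = 1 := hk'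
    -- Obtained by solving `g' μ(t) h' = k g μ(t) h k'` for the factors on the two sides of `μ(t)`.
    refine ⟨(g'⁻¹ * k * g, h' * k'⁻¹ * h⁻¹), ?_, ?_, ?_⟩
    · rw [mem_degen_iff μ ht]
      simp only [map_mul, map_inv, cellElt] at e ⊢
      have e' := congrArg (fun z => (toLoc t g')⁻¹ * z * (toLoc t k')⁻¹ * (toLoc t h)⁻¹) e
      simp only [mul_assoc, inv_mul_cancel_left, mul_inv_cancel, mul_one] at e' ⊢
      exact e'.symm
    · simp [hk]
    · simp [hk']
  · rintro ⟨x, hx, h1, h2⟩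
    rw [mem_degen_iff μ ht] at hx
    refine ⟨toLoc t (g' * x.1 * g⁻¹), ⟨_, ?_, rfl⟩, toLoc t (h⁻¹ * x.2⁻¹ * h'), ⟨_, ?_, rfl⟩, ?_⟩
    · change Pt.map H q _ = 1
      simp [h1]
    · change Pt.map H q _ = 1
      simp [h2]
    · simp only [map_mul, map_inv, cellElt, mul_assoc, inv_mul_cancel_left, mul_inv_cancel_left]
      rw [← mul_assoc (toLoc t x.1), hx]
      simp only [mul_assoc, mul_inv_cancel_left]

/-- The parts of bounded weight generate a finitely generated algebra. -/
lemma exists_bound_of_finiteType [Algebra.FiniteType W H] :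
    ∃ N : ℕ, ∀ L : Subalgebra W H, (∀ n ≤ (N : ℤ), ∀ f, wt μ n f ∈ L) → L = ⊤ := by
  obtain ⟨s, hs⟩ := ‹Algebra.FiniteType W H›
  -- The bound is the largest positive weight that occurs in a finite set of generators, or `0` if
  -- there is none.
  refine ⟨s.sup fun f => (conjHom μ f).coeff.support.sup Int.toNat, fun L hL => ?_⟩
  rw [eq_top_iff, ← hs, Algebra.adjoin_le_iff]
  intro f hf
  rw [SetLike.mem_coe, ← sum_wt μ f, Finsupp.sum]
  refine sum_mem fun n hn => hL n ?_ f
  have h1 : n.toNat ≤ (conjHom μ f).coeff.support.sup Int.toNat := Finset.le_sup hn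
  have h2 := Finset.le_sup (f := fun f => (conjHom μ f).coeff.support.sup Int.toNat)
    (Finset.mem_coe.mp hf)
  have h3 : n.toNat ≤ s.sup fun f => (conjHom μ f).coeff.support.sup Int.toNat := h1.trans h2
  lia

/-- A point all of whose parts of positive weight are divisible by a high power of `t` is the first
entry of a point of the degeneration at `t`. -/
lemma exists_degen_of_dvd {t : A} (ht : t ∈ nonZeroDivisors A) {N : ℕ}
    (hN : ∀ L : Subalgebra W H, (∀ n ≤ (N : ℤ), ∀ f, wt μ n f ∈ L) → L = ⊤) {a : Pt W H A}
    (ha : ∀ n > 0, ∀ f, t ^ N ∣ a.ofConv (wt μ n f)) : ∃ b, (a, b) ∈ degen μ t := by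
  let j := IsScalarTower.toAlgHom W A (Localization.Away t)
  let b₀ := cocharAt μ (unitAway t)⁻¹ * toLoc t a * (cocharAt μ (unitAway t)⁻¹)⁻¹
  -- The functions with integral value at `b₀` form a subalgebra, so weights `≤ N` suffice. In
  -- positive weight `n ≤ N` the conjugation divides by `t ^ n`, which `ha` permits; in the other
  -- weights it multiplies.
  have htop : j.range.comap b₀.ofConv = ⊤ := by
    refine hN _ fun n hn f => ?_
    change b₀.ofConv (wt μ n f) ∈ j.range
    rw [conj_apply_wt]
    rcases lt_or_ge 0 n with h | h
    · obtain ⟨n, rfl⟩ := Int.eq_ofNat_of_zero_le h.le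
      obtain ⟨c, hc⟩ := ha n h f
      refine ⟨t ^ (N - n) * c, ?_⟩
      rw [zpow_natCast, inv_pow, Units.eq_mul_inv_iff_mul_eq, coe_unitAway_pow]
      change algebraMap A _ _ * _ = algebraMap A _ (a.ofConv _)
      rw [← map_mul, hc]
      congr 1
      rw [mul_right_comm, ← pow_add]
      congr 2
      lia
    · obtain ⟨n, rfl⟩ := Int.exists_eq_neg_ofNat h
      refine ⟨a.ofConv (wt μ (-n) f) * t ^ n, ?_⟩
      rw [zpow_neg, zpow_natCast, inv_pow, inv_inv, coe_unitAway_pow]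
      exact map_mul _ _ _
  obtain ⟨b, hb⟩ := exists_comp_eq_of_injective j (algebraMap_away_injective ht) b₀.ofConv
    (fun f => show f ∈ j.range.comap b₀.ofConv from htop ▸ Algebra.mem_top)
  have hb' : toLoc t (toConv b) = b₀ := WithConv.ofConv_injective hb
  refine ⟨toConv b, ?_⟩
  rw [mem_degen_iff μ ht, hb']
  simp only [b₀, cocharAt_inv]
  group

/-- The point `μ(t) k μ(t)⁻¹`, for `k` in `U₊`. -/
lemma exists_degen_of_uPlus (t : A) {k : Pt W H A} (hk : (1, k) ∈ degen μ (0 : A)) :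
    ∃ e, (e, k) ∈ degen μ t ∧ Pt.map H (Ideal.Quotient.mkₐ W (Ideal.span {t})) e = 1 := by
  obtain ⟨-, hneg, hzero⟩ := (mem_degen_zero_iff μ).mp hk
  simp only at hneg hzero
  -- In negative weights `toNat` gives exponent `0`, which does no harm because `k` vanishes there.
  let c : ℤ → H →ₗ[W] A := fun n => LinearMap.mulLeft W (t ^ n.toNat) ∘ₗ k.ofConv.toLinearMap
  have hc : ∀ n f, c n f = t ^ n.toNat * k.ofConv f := fun _ _ => rfl
  obtain ⟨e, he⟩ := exists_algHom_of_wt μ c (by simp [hc]) (by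
    intro i j f g
    rw [hc, hc, hc, map_mul]
    by_cases hi : i < 0
    · rw [hneg i hi]
      ring
    by_cases hj : j < 0
    · rw [hneg j hj]
      ring
    rw [Int.toNat_add (by lia) (by lia), pow_add]
    ring)
  refine ⟨toConv e, fun n f => ⟨?_, ?_⟩, ?_⟩
  · change e _ = _
    rw [he, hc, Int.toNat_natCast]
  · change k.ofConv _ = _ * e _
    rw [he, hc]
    rcases Nat.eq_zero_or_pos n with rfl | hn
    · simp
    · rw [hneg (-n) (by lia)]
      simp
  · rw [map_mk_eq_one_iff]
    intro f
    rw [← sum_wt μ f, Finsupp.sum, map_sum, map_sum, ← Finset.sum_sub_distrib]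
    refine sum_mem fun n _ => ?_
    rw [← wt_apply]
    change e _ - _ ∈ _
    rw [he, hc]
    rcases lt_trichotomy n 0 with hn | rfl | hn
    · rw [hneg n hn, one_apply_wt μ hn.ne]
      simp
    · rw [← hzero]
      simp
    · rw [one_apply_wt μ hn.ne', sub_zero]
      exact Ideal.mul_mem_right _ _ (Ideal.pow_mem_of_mem _ (Ideal.mem_span_singleton_self t) _
        (by lia))

/-- A point of the zip group modulo a nonzerodivisor `t` lifts to the degeneration at `t` as soon as
its first entry lifts to a point of `𝒢`. -/
lemma exists_degen_lift [Algebra.FormallySmooth W H] [Algebra.FiniteType W H] {t : A}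
    (ht : t ∈ nonZeroDivisors A) (a : Pt W H A) {y : Pt W H (A ⧸ Ideal.span {t})}
    (hy : (Pt.map H (Ideal.Quotient.mkₐ W (Ideal.span {t})) a, y) ∈ degen μ 0) :
    ∃ x ∈ degen μ t, Pt.map H (Ideal.Quotient.mkₐ W (Ideal.span {t})) x.1 =
        Pt.map H (Ideal.Quotient.mkₐ W (Ideal.span {t})) a ∧
      Pt.map H (Ideal.Quotient.mkₐ W (Ideal.span {t})) x.2 = y := by
  obtain ⟨N, hN⟩ := exists_bound_of_finiteType μ
  -- The division below needs `t ^ N`; the extra factor ensures that `J` is contained in the ideal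
  -- of `t` even for `N = 0`.
  let J : Ideal A := Ideal.span {t ^ (N + 1)}
  have hJ : J ≤ Ideal.span {t} := by
    rw [Ideal.span_singleton_le_span_singleton]
    exact dvd_pow_self t (by lia)
  let π := Ideal.Quotient.mkₐ W J
  let I : Ideal (A ⧸ J) := (Ideal.span {t}).map (Ideal.Quotient.mk J)
  have hI : I ^ (N + 1) = ⊥ := by
    rw [← Ideal.map_pow, Ideal.span_singleton_pow]
    exact Ideal.map_quotient_self J
  have ha0 : ∀ n > 0, ∀ f, a.ofConv (wt μ n f) ∈ Ideal.span {t} := fun n hn f =>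
    Ideal.Quotient.eq_zero_iff_mem.mp (((mem_degen_zero_iff μ).mp hy).1 n hn f)
  obtain ⟨z, k₀, hzk, hz, hk₀, hk₀'⟩ := exists_decomposition_of_nilpotent μ hI (g := Pt.map H π a)
    (fun n hn f => Ideal.mem_map_of_mem _ (ha0 n hn f))
  -- Dividing `a` by a lift of the factor in `U₊` leaves a point that lies in `P₋` modulo `t ^ (N +
  -- 1)` and still reduces to the same point modulo `t`.
  obtain ⟨k, hk, rfl⟩ := uPlus_lift μ π Ideal.Quotient.mk_surjective hk₀
  have hk' : Pt.map H (Ideal.Quotient.mkₐ W (Ideal.span {t})) k = 1 := by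
    rw [map_mk_eq_one_iff] at hk₀' ⊢
    intro f
    refine (Ideal.mem_quotient_iff_mem hJ).mp ?_
    have h1 : (1 : Pt W H (A ⧸ J)) = Pt.map H π 1 := (map_one _).symm
    have := hk₀' f
    rw [h1] at this
    exact this
  obtain ⟨b, hb⟩ := exists_degen_of_dvd μ ht hN (a := a * k⁻¹) (fun n hn f => by
    have e : Pt.map H π (a * k⁻¹) = z := by rw [map_mul, map_inv, hzk, mul_inv_cancel_right]
    have h0 : Ideal.Quotient.mk J ((a * k⁻¹).ofConv (wt μ n f)) = 0 :=
      (DFunLike.congr_fun (congrArg WithConv.ofConv e) _).trans (hz n hn f)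
    rw [Ideal.Quotient.eq_zero_iff_mem, Ideal.mem_span_singleton] at h0
    exact (pow_dvd_pow t (by lia)).trans h0)
  have hred : (Pt.map H (Ideal.Quotient.mkₐ W (Ideal.span {t})) (a * k⁻¹)) =
      Pt.map H (Ideal.Quotient.mkₐ W (Ideal.span {t})) a := by
    rw [map_mul, map_inv, hk', inv_one, mul_one]
  have ht0 : Ideal.Quotient.mkₐ W (Ideal.span {t}) t = 0 :=
    Ideal.Quotient.eq_zero_iff_mem.mpr (Ideal.mem_span_singleton_self t)
  have hbar := degen_map μ (Ideal.Quotient.mkₐ W (Ideal.span {t})) ht0 hb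
  simp only [hred] at hbar
  rw [← mem_zipGroup_iff] at hbar hy
  -- Both pairs lie in the zip group and have the same first entry, so their quotient is trivial
  -- there and lies in `U₊` in the second entry.
  have hu := (zipGroup (A ⧸ Ideal.span {t}) μ).mul_mem (inv_mem hbar) hy
  rw [Prod.inv_mk, Prod.mk_mul_mk, inv_mul_cancel, mem_zipGroup_iff] at hu
  obtain ⟨v, hv, hvu⟩ := uPlus_lift μ (Ideal.Quotient.mkₐ W (Ideal.span {t}))
    Ideal.Quotient.mk_surjective hu
  -- Conjugation by `μ(t)` makes the correction trivial modulo `t` in the first entry, so only the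
  -- second entry changes.
  obtain ⟨e, he, he'⟩ := exists_degen_of_uPlus μ t hv
  refine ⟨_, degen_mul μ ht hb he, ?_, ?_⟩
  · rw [Prod.fst_mul, map_mul, hred, he', mul_one]
  · rw [Prod.snd_mul, map_mul, hvu, mul_inv_cancel_left]

end Cells

end

end CrisZip

namespace CrisZip

noncomputable section

/-! ### The comparison map of presheaves -/

section Comparison

variable (p : ℕ) {W H : Type u} [CommRing W] [CommRing H] [HopfAlgebra W H]
  (μ : H →ₐc[W] W[T;T⁻¹])

lemma zipQuot_mk_eq_iff {A : Type u} [CommRing A] [Algebra W A] {x y : Pt W H A × Pt W H A} :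
    ZipQuot.mk μ x = ZipQuot.mk μ y ↔ y * x⁻¹ ∈ degen μ (0 : A) := by
  rw [← mem_zipGroup_iff, ← QuotientGroup.rightRel_apply]
  exact Quotient.eq

lemma natCast_mem_nonZeroDivisors (hp : (p : W) ∈ nonZeroDivisors W) (R : Type u) [CommRing R]
    [Algebra W R] [Module.Flat W R] : (p : R) ∈ nonZeroDivisors R := by
  have h := Module.Flat.isSMulRegular_of_nonZeroDivisors (M := R) hp
  rw [mem_nonZeroDivisors_iff_right]
  intro x hx
  apply h
  change (p : W) • x = (p : W) • 0
  rw [smul_zero, Algebra.smul_def, map_natCast, mul_comm, hx]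

lemma mkₐ_natCast (R : Type u) [CommRing R] [Algebra W R] :
    Ideal.Quotient.mkₐ W (Ideal.span {(p : R)}) (p : R) = 0 :=
  Ideal.Quotient.eq_zero_iff_mem.mpr (Ideal.mem_span_singleton_self _)

lemma zipQuot_mk_eq_of_cellElt {R : Type u} [CommRing R] [Algebra W R]
    (hp : (p : R) ∈ nonZeroDivisors R) {g h g' h' : Pt W H R}
    (e : ∃ k ∈ kOne p H R, ∃ k' ∈ kOne p H R,
      cellElt μ (p : R) g' h' = k * cellElt μ (p : R) g h * k') :
    ZipQuot.mk μ ((ptRed p H R g)⁻¹, ptRed p H R h) =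
      ZipQuot.mk μ ((ptRed p H R g')⁻¹, ptRed p H R h') := by
  obtain ⟨x, hx, h1, h2⟩ := (exists_cellElt_eq_iff μ _ hp g h g' h').mp e
  have hx' := degen_map μ _ (mkₐ_natCast p R) hx
  rw [h1, h2] at hx'
  rw [zipQuot_mk_eq_iff, Prod.inv_mk, Prod.mk_mul_mk, inv_inv]
  exact hx'

/-- The first entry of the element of the zip group is the reduction of `g'⁻¹ g`, which is already a
point over `R`. So `exists_degen_lift` applies without any completeness of `R`. -/
lemma cellElt_of_zipQuot_mk_eq [Algebra.FormallySmooth W H] [Algebra.FiniteType W H]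
    {R : Type u} [CommRing R] [Algebra W R]
    (hp : (p : R) ∈ nonZeroDivisors R) {g h g' h' : Pt W H R}
    (e : ZipQuot.mk μ ((ptRed p H R g)⁻¹, ptRed p H R h) =
      ZipQuot.mk μ ((ptRed p H R g')⁻¹, ptRed p H R h')) :
    ∃ k ∈ kOne p H R, ∃ k' ∈ kOne p H R,
      cellElt μ (p : R) g' h' = k * cellElt μ (p : R) g h * k' := by
  rw [zipQuot_mk_eq_iff, Prod.inv_mk, Prod.mk_mul_mk, inv_inv] at e
  have e1 : (ptRed p H R g')⁻¹ * ptRed p H R g = ptRed p H R (g'⁻¹ * g) := by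
    rw [map_mul, map_inv]
  rw [e1] at e
  obtain ⟨x, hx, h1, h2⟩ := exists_degen_lift μ hp (g'⁻¹ * g) e
  refine (exists_cellElt_eq_iff μ _ hp g h g' h').mpr ⟨x, hx, ?_, h2⟩
  rw [h1, map_mul, map_inv]

/-- The map `g μ(p) h ↦ (ḡ⁻¹, h̄)`. -/
def crisToZip (hp : (p : W) ∈ nonZeroDivisors W) :
    crisPresheaf p μ ⟶ redFlat p W ⋙ zipPresheaf p μ where
  -- An element of the cell does not determine its factors, so a factorization is chosen.
  -- `zipQuot_mk_eq_of_cellElt` gives independence of the choice and of the representative at once.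
  app R := ↾(Quotient.lift (fun x : cell μ (p : R.obj) => ZipQuot.mk μ
    ((ptRed p H R.obj x.2.choose)⁻¹, ptRed p H R.obj x.2.choose_spec.choose)) (by
      rintro x y ⟨k, hk, k', hk', e⟩
      have : Module.Flat W R.obj := R.property
      refine zipQuot_mk_eq_of_cellElt p μ (natCast_mem_nonZeroDivisors p hp R.obj)
        ⟨k, hk, k', hk', ?_⟩
      rw [← x.2.choose_spec.choose_spec, ← y.2.choose_spec.choose_spec, e]))
  naturality R S f := by
    ext x
    obtain ⟨⟨_, g, h, rfl⟩, rfl⟩ := Quotient.exists_rep x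
    have : Module.Flat W R.obj := R.property
    have : Module.Flat W S.obj := S.property
    have key : ∀ (R : FlatAlg.{u} W) (x : cell μ (p : R.obj)) (g h : Pt W H R.obj),
        (x : Pt W H _) = cellElt μ (p : R.obj) g h → ZipQuot.mk μ
          ((ptRed p H R.obj x.2.choose)⁻¹, ptRed p H R.obj x.2.choose_spec.choose) =
          ZipQuot.mk μ ((ptRed p H R.obj g)⁻¹, ptRed p H R.obj h) := by
      intro R x g h e
      have : Module.Flat W R.obj := R.property
      refine zipQuot_mk_eq_of_cellElt p μ (natCast_mem_nonZeroDivisors p hp R.obj)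
        ⟨1, one_mem _, 1, one_mem _, ?_⟩
      rw [one_mul, mul_one, ← e]
      exact x.2.choose_spec.choose_spec
    refine (key S ⟨_, map_mem_cell μ f.hom.hom (map_natCast f.hom.hom p)
      (cellElt_mem μ (p : R.obj) g h)⟩ _ _ (map_cellElt μ f.hom.hom _ g h)).trans ?_
    refine Eq.trans ?_ (congrArg (ZipQuot.map μ ((modP p W).map f.hom).hom)
      (key R ⟨_, cellElt_mem μ (p : R.obj) g h⟩ g h rfl).symm)
    rfl

lemma crisToZip_crisClass (hp : (p : W) ∈ nonZeroDivisors W) (R : FlatAlg.{u} W)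
    (g h : Pt W H R.obj) : (crisToZip p μ hp).app R (crisClass p μ R g h) =
      ZipQuot.mk μ ((ptRed p H R.obj g)⁻¹, ptRed p H R.obj h) := by
  have : Module.Flat W R.obj := R.property
  refine zipQuot_mk_eq_of_cellElt p μ (natCast_mem_nonZeroDivisors p hp R.obj)
    ⟨1, one_mem _, 1, one_mem _, ?_⟩
  rw [one_mul, mul_one]
  exact (cellElt_mem μ (p : R.obj) g h).choose_spec.choose_spec

lemma exists_crisClass_eq (R : FlatAlg.{u} W) (x : (crisPresheaf p μ).obj R) :
    ∃ g h, crisClass p μ R g h = x := by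
  obtain ⟨⟨_, g, h, rfl⟩, rfl⟩ := Quotient.exists_rep x
  exact ⟨g, h, rfl⟩

lemma crisToZip_injective [Algebra.FormallySmooth W H] [Algebra.FiniteType W H]
    (hp : (p : W) ∈ nonZeroDivisors W) (R : FlatAlg.{u} W) :
    Function.Injective ((crisToZip p μ hp).app R) := by
  intro x y e
  obtain ⟨g, h, rfl⟩ := exists_crisClass_eq p μ R x
  obtain ⟨g', h', rfl⟩ := exists_crisClass_eq p μ R y
  have : Module.Flat W R.obj := R.property
  rw [crisToZip_crisClass, crisToZip_crisClass] at e
  exact Quotient.sound (cellElt_of_zipQuot_mk_eq p μ (natCast_mem_nonZeroDivisors p hp R.obj) e)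

lemma exists_ptRed_eq [Algebra.FormallySmooth W H] (R : Type u) [CommRing R] [Algebra W R]
    [IsAdicComplete (Ideal.span {(p : R)}) R] (x : Pt W H (R ⧸ Ideal.span {(p : R)})) :
    ∃ g, ptRed p H R g = x := by
  obtain ⟨g, hg⟩ := Algebra.FormallySmooth.exists_mkₐ_comp_eq_of_isAdicComplete x.ofConv
  exact ⟨toConv g, WithConv.ofConv_injective hg⟩

/-- Only surjectivity is new: when `R` is complete, points of the smooth group over `R / p` lift to
`R`. -/
lemma crisToZip_bijective [Algebra.FormallySmooth W H] [Algebra.FiniteType W H]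
    (hp : (p : W) ∈ nonZeroDivisors W) (R : FlatAlg.{u} W)
    (hR : IsAdicComplete (Ideal.span {(p : R.obj)}) R.obj) :
    Function.Bijective ((crisToZip p μ hp).app R) := by
  refine ⟨crisToZip_injective p μ hp R, fun x => ?_⟩
  obtain ⟨x, rfl⟩ : ∃ y, ZipQuot.mk μ y = x := Quotient.exists_rep x
  obtain ⟨g, hg⟩ := exists_ptRed_eq p R.obj x.1
  obtain ⟨h, hh⟩ := exists_ptRed_eq p R.obj x.2
  refine ⟨crisClass p μ R g⁻¹ h, ?_⟩
  rw [crisToZip_crisClass, map_inv, inv_inv, hg, hh]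
  rfl

end Comparison

end

end CrisZip

namespace CrisZip

noncomputable section

/-! ### Lifting smooth quotients -/

section PresLoc

variable {R X ι : Type u} [CommRing R] [CommRing X] [Algebra R X]

/-- The localization at `d` of the quotient of a polynomial ring by the polynomials `F i`. -/
def PresLoc (F : ι → MvPolynomial ι X) (d : MvPolynomial ι X) : Type u :=
  Localization.Away (Ideal.Quotient.mk (Ideal.span (Set.range F)) d)

variable (F : ι → MvPolynomial ι X) (d : MvPolynomial ι X)

instance : CommRing (PresLoc F d) :=
  inferInstanceAs (CommRing (Localization.Away (Ideal.Quotient.mk (Ideal.span (Set.range F)) d)))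

instance : Algebra R (PresLoc F d) :=
  inferInstanceAs (Algebra R
    (Localization.Away (Ideal.Quotient.mk (Ideal.span (Set.range F)) d)))

instance : Algebra (MvPolynomial ι X ⧸ Ideal.span (Set.range F)) (PresLoc F d) :=
  inferInstanceAs (Algebra (MvPolynomial ι X ⧸ Ideal.span (Set.range F))
    (Localization.Away (Ideal.Quotient.mk (Ideal.span (Set.range F)) d)))

instance : IsScalarTower R (MvPolynomial ι X ⧸ Ideal.span (Set.range F)) (PresLoc F d) :=
  inferInstanceAs (IsScalarTower R (MvPolynomial ι X ⧸ Ideal.span (Set.range F))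
    (Localization.Away (Ideal.Quotient.mk (Ideal.span (Set.range F)) d)))

instance : IsLocalization.Away (Ideal.Quotient.mk (Ideal.span (Set.range F)) d) (PresLoc F d) :=
  inferInstanceAs (IsLocalization.Away (Ideal.Quotient.mk (Ideal.span (Set.range F)) d)
    (Localization.Away (Ideal.Quotient.mk (Ideal.span (Set.range F)) d)))

/-- The projection from polynomials to `PresLoc F d`. -/
def presMk : MvPolynomial ι X →ₐ[R] PresLoc F d :=
  (IsScalarTower.toAlgHom R (MvPolynomial ι X ⧸ Ideal.span (Set.range F)) (PresLoc F d)).comp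
    (Ideal.Quotient.mkₐ R (Ideal.span (Set.range F)))

lemma presMk_apply_eq_zero (i : ι) : presMk (R := R) F d (F i) = 0 := by
  have h : Ideal.Quotient.mkₐ R (Ideal.span (Set.range F)) (F i) = 0 :=
    Ideal.Quotient.eq_zero_iff_mem.mpr (Ideal.subset_span ⟨i, rfl⟩)
  rw [presMk, AlgHom.comp_apply, h, map_zero]

lemma isUnit_presMk : IsUnit (presMk (R := R) F d d) :=
  IsLocalization.Away.algebraMap_isUnit (Ideal.Quotient.mk (Ideal.span (Set.range F)) d)

variable {F d} in
lemma presLoc_algHom_ext {C : Type u} [CommRing C] [Algebra R C] {φ ψ : PresLoc F d →ₐ[R] C}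
    (h : φ.comp (presMk F d) = ψ.comp (presMk F d)) : φ = ψ := by
  apply AlgHom.coe_ringHom_injective
  apply IsLocalization.ringHom_ext
    (Submonoid.powers (Ideal.Quotient.mk (Ideal.span (Set.range F)) d))
  apply Ideal.Quotient.ringHom_ext
  exact congrArg (AlgHom.toRingHom) h

variable {F d} in
lemma exists_presLoc_algHom {C : Type u} [CommRing C] [Algebra R C]
    (φ : MvPolynomial ι X →ₐ[R] C) (h : ∀ i, φ (F i) = 0) (hd : IsUnit (φ d)) :
    ∃ ψ : PresLoc F d →ₐ[R] C, ψ.comp (presMk F d) = φ := by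
  have hle : ∀ z ∈ Ideal.span (Set.range F), φ z = 0 := by
    intro z hz
    have : Ideal.span (Set.range F) ≤ RingHom.ker φ := by
      rw [Ideal.span_le]
      rintro _ ⟨i, rfl⟩
      exact h i
    exact this hz
  refine ⟨IsLocalization.liftAlgHom
    (M := Submonoid.powers (Ideal.Quotient.mk (Ideal.span (Set.range F)) d))
    (f := Ideal.Quotient.liftₐ (Ideal.span (Set.range F)) φ hle) ?_, ?_⟩
  · rintro ⟨_, n, rfl⟩
    simp only [map_pow]
    exact hd.pow n
  · refine AlgHom.ext fun z => ?_
    exact IsLocalization.lift_eq _ _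

instance [Finite ι] [Algebra.FinitePresentation R X] :
    Algebra.FinitePresentation R (PresLoc F d) := by
  have h1 : Algebra.FinitePresentation R (MvPolynomial ι X) :=
    Algebra.FinitePresentation.trans R X _
  have h2 : Algebra.FinitePresentation R (MvPolynomial ι X ⧸ Ideal.span (Set.range F)) :=
    Algebra.FinitePresentation.quotient ⟨(Set.finite_range F).toFinset, by simp⟩
  have h3 : Algebra.FinitePresentation (MvPolynomial ι X ⧸ Ideal.span (Set.range F))
      (PresLoc F d) :=
    IsLocalization.Away.finitePresentation (Ideal.Quotient.mk (Ideal.span (Set.range F)) d)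
  exact Algebra.FinitePresentation.trans R (MvPolynomial ι X ⧸ Ideal.span (Set.range F)) _

end PresLoc

/-! ### Deforming the equations of a smooth quotient -/

section Deformation

variable {R X ι : Type u} [CommRing R] [CommRing X] [Algebra R X] [Fintype ι]
  (f : ι → X) (D : Derivation R X (ι → X))

/-- The matrix of derivatives of the generators `f i`. -/
def jacM : Matrix ι ι X := Matrix.of fun i j => D (f i) j

/-- The matrix of derivatives of the entries of `jacM`, contracted with the variables. -/
def jacE : Matrix ι ι (MvPolynomial ι X) :=
  Matrix.of fun i l => ∑ k, MvPolynomial.C (D (jacM f D i k) l) * MvPolynomial.X k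

/-- The equations `f = (1 - M) y`. -/
def jacF (i : ι) : MvPolynomial ι X :=
  MvPolynomial.C (f i) - MvPolynomial.X i + ∑ k, MvPolynomial.C (jacM f D i k) * MvPolynomial.X k

/-- The Jacobian matrix of the equations `jacF` with respect to suitable derivations. -/
def jacG [DecidableEq ι] : Matrix ι ι (MvPolynomial ι X) :=
  (jacM f D).map MvPolynomial.C * (jacM f D).map MvPolynomial.C +
    (1 - (jacM f D).map MvPolynomial.C) * (1 - (jacM f D).map MvPolynomial.C) +
    jacE f D * (jacM f D).map MvPolynomial.C

/-- A homomorphism to a square-zero extension, changed by a derivation. -/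
lemma exists_algHom_add_derivation {C : Type u} [CommRing C] [Algebra R C] (ψ : X →ₐ[R] C)
    {N : Ideal C} (hN : ∀ a ∈ N, ∀ b ∈ N, a * b = 0) (n : ι → C) (hn : ∀ i, n i ∈ N) :
    ∃ τ : X →ₐ[R] C, ∀ x, τ x = ψ x + ∑ k, n k * ψ (D x k) := by
  refine ⟨AlgHom.ofLinearMap (ψ.toLinearMap + ∑ k, (LinearMap.mulLeft R (n k)) ∘ₗ ψ.toLinearMap ∘ₗ
    (LinearMap.proj k : (ι → X) →ₗ[R] X) ∘ₗ D.toLinearMap) ?_ ?_, ?_⟩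
  · simp
  · intro x y
    have h : ∀ x, (ψ.toLinearMap + ∑ k, (LinearMap.mulLeft R (n k)) ∘ₗ ψ.toLinearMap ∘ₗ
        (LinearMap.proj k : (ι → X) →ₗ[R] X) ∘ₗ D.toLinearMap) x =
        ψ x + ∑ k, n k * ψ (D x k) := by
      intro x
      simp
    have hmem : ∀ x, ∑ k, n k * ψ (D x k) ∈ N := fun x =>
      sum_mem fun k _ => Ideal.mul_mem_right _ _ (hn k)
    rw [h, h, h, D.leibniz]
    have e : ∑ k, n k * ψ ((x • D y + y • D x) k) =
        ψ x * ∑ k, n k * ψ (D y k) + ψ y * ∑ k, n k * ψ (D x k) := by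
      rw [Finset.mul_sum, Finset.mul_sum, ← Finset.sum_add_distrib]
      refine Finset.sum_congr rfl fun k _ => ?_
      simp only [Pi.add_apply, Pi.smul_apply, smul_eq_mul, map_add, map_mul]
      ring
    rw [e, map_mul]
    linear_combination -hN _ (hmem x) _ (hmem y)
  · intro x
    simp

/-- The lifted equations can be solved in square-zero extensions. -/
lemma presLoc_formallySmooth [DecidableEq ι] [Algebra.FormallySmooth R X] (h : MvPolynomial ι X) :
    Algebra.FormallySmooth R (PresLoc (jacF f D) ((jacG f D).det * h)) := by
  apply Algebra.FormallySmooth.of_comp_surjective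
  intro C _ _ N hN φ
  have hN' : ∀ a ∈ N, ∀ b ∈ N, a * b = 0 := by
    intro a ha b hb
    have := Ideal.mul_mem_mul ha hb
    rwa [← pow_two, hN] at this
  have hnil : IsNilpotent N := ⟨2, hN⟩
  let φP := φ.comp (presMk (R := R) (jacF f D) ((jacG f D).det * h))
  -- Any lift of the `X`-part and any lifts `y` of the variables satisfy the equations modulo `N`; a
  -- Newton step then makes them exact.
  let ψ : X →ₐ[R] C := Algebra.FormallySmooth.lift N hnil
    (φP.comp (IsScalarTower.toAlgHom R X (MvPolynomial ι X)))
  have hψ : ∀ x, Ideal.Quotient.mk N (ψ x) = φP (MvPolynomial.C x) := fun x =>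
    Algebra.FormallySmooth.mk_lift N hnil _ x
  choose y hy using fun k => Ideal.Quotient.mk_surjective (I := N) (φP (MvPolynomial.X k))
  let ev : MvPolynomial ι X →+* C := MvPolynomial.eval₂Hom ψ.toRingHom y
  have hevC : ∀ x, ev (MvPolynomial.C x) = ψ x := fun x => MvPolynomial.eval₂Hom_C _ _ _
  have hevX : ∀ k, ev (MvPolynomial.X k) = y k := fun k => MvPolynomial.eval₂Hom_X' _ _ _
  have hev : ∀ z, Ideal.Quotient.mk N (ev z) = φP z := by
    intro z
    have : (Ideal.Quotient.mk N).comp ev = φP.toRingHom := by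
      apply MvPolynomial.ringHom_ext
      · intro x
        rw [RingHom.comp_apply, hevC, hψ]
        rfl
      · intro k
        rw [RingHom.comp_apply, hevX, hy]
        rfl
    exact DFunLike.congr_fun this z
  have hunit : ∀ c : C, IsUnit (Ideal.Quotient.mk N c) → IsUnit c := fun c hc =>
    (hnil.isUnit_quotient_mk_iff).mp hc
  have hFN : ∀ i, ev (jacF f D i) ∈ N := by
    intro i
    rw [← Ideal.Quotient.eq_zero_iff_mem, hev]
    change φ (presMk (R := R) _ _ _) = 0
    rw [presMk_apply_eq_zero, map_zero]
  let Mc : Matrix ι ι C := (jacM f D).map ψ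
  let Ec : Matrix ι ι C := (jacE f D).map ev
  let Gc : Matrix ι ι C := Mc * Mc + (1 - Mc) * (1 - Mc) + Ec * Mc
  have hMc : ev.mapMatrix ((jacM f D).map MvPolynomial.C) = Mc := by
    ext i j
    exact hevC _
  have hGc : ev.mapMatrix (jacG f D) = Gc := by
    simp only [jacG, map_add, map_mul, map_sub, map_one, hMc]
    rfl
  have hdet : IsUnit Gc.det := by
    rw [← hGc, ← RingHom.map_det]
    apply hunit
    rw [hev]
    have h1 : IsUnit (φP ((jacG f D).det * h)) := (isUnit_presMk (R := R) _ _).map φ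
    rw [map_mul] at h1
    exact isUnit_of_mul_isUnit_left h1
  let Fc : ι → C := fun i => ev (jacF f D i)
  let v : ι → C := -(Gc⁻¹.mulVec Fc)
  have hGv : Gc.mulVec v = -Fc := by
    simp only [v, Matrix.mulVec_neg, Matrix.mulVec_mulVec, Matrix.mul_nonsing_inv Gc hdet,
      Matrix.one_mulVec]
  have hmulN : ∀ (A : Matrix ι ι C) (w : ι → C), (∀ i, w i ∈ N) → ∀ i, A.mulVec w i ∈ N :=
    fun A w hw i => sum_mem fun j _ => Ideal.mul_mem_left _ _ (hw j)
  have hvN : ∀ i, v i ∈ N := fun i => neg_mem (hmulN _ _ hFN i)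
  -- The `X`-part is moved along `D` by `M v`, and `y` by `-(1 - M) v`. To first order this changes
  -- the equations by `M (M v) + (1 - M)((1 - M) v) + E (M v) = G v`, and `v` was chosen with `G v =
  -- -F`.
  let n : ι → C := Mc.mulVec v
  let w : ι → C := (1 - Mc).mulVec v
  have hnN : ∀ i, n i ∈ N := hmulN _ _ hvN
  have hwN : ∀ i, w i ∈ N := hmulN _ _ hvN
  obtain ⟨τ, hτ⟩ := exists_algHom_add_derivation D ψ hN' n hnN
  let χ : MvPolynomial ι X →ₐ[R] C :=
    { MvPolynomial.eval₂Hom τ.toRingHom (fun k => y k - w k) with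
      commutes' := fun r => by
        change MvPolynomial.eval₂ τ.toRingHom _ (algebraMap R (MvPolynomial ι X) r) = _
        rw [IsScalarTower.algebraMap_apply R X (MvPolynomial ι X), MvPolynomial.algebraMap_eq,
          MvPolynomial.eval₂_C]
        exact τ.commutes r }
  have hχC : ∀ x, χ (MvPolynomial.C x) = τ x := fun x => MvPolynomial.eval₂Hom_C _ _ _
  have hχX : ∀ k, χ (MvPolynomial.X k) = y k - w k := fun k => MvPolynomial.eval₂Hom_X' _ _ _
  have hχ : ∀ z, Ideal.Quotient.mk N (χ z) = φP z := by
    intro z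
    have : (Ideal.Quotient.mk N).comp χ.toRingHom = φP.toRingHom := by
      apply MvPolynomial.ringHom_ext
      · intro x
        change Ideal.Quotient.mk N (χ (MvPolynomial.C x)) = φP (MvPolynomial.C x)
        rw [hχC, hτ, map_add, hψ, Ideal.Quotient.eq_zero_iff_mem.mpr, add_zero]
        exact sum_mem fun k _ => Ideal.mul_mem_right _ _ (hnN k)
      · intro k
        change Ideal.Quotient.mk N (χ (MvPolynomial.X k)) = φP (MvPolynomial.X k)
        rw [hχX, map_sub, hy, Ideal.Quotient.eq_zero_iff_mem.mpr (hwN k), sub_zero]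
    exact DFunLike.congr_fun this z
  have hE : ∀ i, Ec.mulVec n i = ∑ k, (∑ l, n l * ψ (D (jacM f D i k) l)) * y k := by
    intro i
    have : ∀ l, Ec i l = ∑ k, ψ (D (jacM f D i k) l) * y k := by
      intro l
      change ev (jacE f D i l) = _
      simp only [jacE, Matrix.of_apply, map_sum, map_mul, hevC, hevX]
    simp only [Matrix.mulVec, dotProduct, this, Finset.sum_mul]
    rw [Finset.sum_comm]
    refine Finset.sum_congr rfl fun k _ => Finset.sum_congr rfl fun l _ => ?_
    ring
  have hχF : ∀ i, χ (jacF f D i) = 0 := by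
    intro i
    have hk : ∀ k, τ (jacM f D i k) * (y k - w k) = Mc i k * y k - Mc i k * w k +
        (∑ l, n l * ψ (D (jacM f D i k) l)) * y k := by
      intro k
      rw [hτ]
      have := hN' _ (sum_mem fun l _ => Ideal.mul_mem_right (ψ (D (jacM f D i k) l)) _ (hnN l) :
        ∑ l, n l * ψ (D (jacM f D i k) l) ∈ N) _ (hwN k)
      change (Mc i k + _) * _ = _
      linear_combination -this
    have hF : Fc i = ψ (f i) - y i + ∑ k, Mc i k * y k := by
      simp only [Fc, jacF, map_add, map_sub, map_sum, map_mul, hevC, hevX]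
      rfl
    have hG := congrFun hGv i
    have hG' : Gc.mulVec v i = Mc.mulVec n i + (w i - Mc.mulVec w i) + Ec.mulVec n i := by
      simp only [Gc, Matrix.add_mulVec, ← Matrix.mulVec_mulVec, Matrix.sub_mulVec,
        Matrix.one_mulVec, Pi.add_apply, Pi.sub_apply, n, w]
    rw [hG', hE] at hG
    have e1 : χ (jacF f D i) = ψ (f i) + ∑ k, n k * ψ (D (f i) k) - (y i - w i) +
        ∑ k, τ (jacM f D i k) * (y k - w k) := by
      simp only [jacF, map_add, map_sub, map_sum, map_mul, hχC, hχX]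
      rw [hτ]
    have e2 : Mc.mulVec n i = ∑ k, n k * ψ (D (f i) k) := by
      simp only [Matrix.mulVec, dotProduct]
      exact Finset.sum_congr rfl fun k _ => mul_comm _ _
    have e3 : Mc.mulVec w i = ∑ k, Mc i k * w k := rfl
    rw [e1]
    simp only [hk, Finset.sum_add_distrib, Finset.sum_sub_distrib]
    rw [Pi.neg_apply, hF, e2, e3] at hG
    linear_combination hG
  obtain ⟨θ, hθ⟩ := exists_presLoc_algHom χ hχF (d := (jacG f D).det * h) (by
    apply hunit
    rw [hχ]
    exact (isUnit_presMk (R := R) _ _).map φ)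
  refine ⟨θ, presLoc_algHom_ext ?_⟩
  refine AlgHom.ext fun z => ?_
  change Ideal.Quotient.mk N ((θ.comp (presMk _ _)) z) = φP z
  rw [hθ, hχ]

/-- A smooth quotient of the reduction of a smooth algebra lifts, up to retracts, to a smooth
algebra. -/
theorem exists_smooth_lift {R X Q : Type u} [CommRing R] [CommRing X] [Algebra R X]
    [Algebra.Smooth R X] {I : Ideal R} (hI : I.FG) [CommRing Q] [Algebra R Q] [Algebra (R ⧸ I) Q]
    [IsScalarTower R (R ⧸ I) Q] [Algebra.Smooth (R ⧸ I) Q] (π : X →ₐ[R] Q)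
    (hπ : Function.Surjective π) :
    ∃ (Y : Type u) (_ : CommRing Y) (_ : Algebra R Y), Algebra.Smooth R Y ∧
      ∃ (a : X →ₐ[R] Y) (s : Y →ₐ[R] Q), s.comp a = π ∧
        ∀ x, π x = 0 → a x ∈ I.map (algebraMap R Y) := by
  classical
  let J : Ideal X := RingHom.ker π
  have hIQ : ∀ r ∈ I, algebraMap R Q r = 0 := by
    intro r hr
    rw [IsScalarTower.algebraMap_apply R (R ⧸ I) Q, Ideal.Quotient.algebraMap_eq,
      Ideal.Quotient.eq_zero_iff_mem.mpr hr, map_zero]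
  have hIJ : I.map (algebraMap R X) ≤ J := by
    rw [Ideal.map_le_iff_le_comap]
    intro r hr
    change π (algebraMap R X r) = 0
    rw [AlgHom.commutes, hIQ r hr]
  have : Algebra.FinitePresentation R (R ⧸ I) := Algebra.FinitePresentation.quotient hI
  have : Algebra.FinitePresentation R Q := Algebra.FinitePresentation.trans R (R ⧸ I) Q
  have hJ : J.FG := Algebra.FinitePresentation.ker_fG_of_surjective π hπ
  obtain ⟨m, f₀, hf₀⟩ := Submodule.fg_iff_exists_fin_generating_family.mp hJ
  let ι : Type u := ULift.{u} (Fin m)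
  let f : ι → X := fun i => f₀ i.down
  have hf : Ideal.span (Set.range f) = J := by
    rw [← hf₀]
    congr 1
    exact ULift.down_surjective.range_comp f₀
  have hfJ : ∀ i, f i ∈ J := fun i => hf ▸ Ideal.subset_span ⟨i, rfl⟩
  -- `X ⧸ K` is an algebra over `R ⧸ I` and a square-zero extension of `Q`, so smoothness of `Q`
  -- provides a section.
  let K : Ideal X := J * J ⊔ I.map (algebraMap R X)
  have hKJ : K ≤ J := sup_le Ideal.mul_le_left hIJ
  -- The section modulo `J ^ 2`.
  have hIK : I ≤ K.comap (algebraMap R X) := by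
    rw [← Ideal.map_le_iff_le_comap]
    exact le_sup_right
  let : Algebra (R ⧸ I) (X ⧸ K) := (Ideal.quotientMap K (algebraMap R X) hIK).toAlgebra
  let g : (X ⧸ K) →ₐ[R ⧸ I] Q :=
    { Ideal.Quotient.lift K π.toRingHom (fun x hx => hKJ hx) with
      commutes' := by
        intro r
        obtain ⟨r, rfl⟩ := Ideal.Quotient.mk_surjective r
        change π (algebraMap R X r) = algebraMap (R ⧸ I) Q (algebraMap R (R ⧸ I) r)
        rw [AlgHom.commutes, ← IsScalarTower.algebraMap_apply] }
  have hg : ∀ x, g (Ideal.Quotient.mk K x) = π x := fun _ => rfl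
  have hgs : Function.Surjective g := by
    intro z
    obtain ⟨x, rfl⟩ := hπ z
    exact ⟨_, hg x⟩
  have hgsq : ∀ a b, g a = 0 → g b = 0 → a * b = 0 := by
    intro a b ha hb
    obtain ⟨a, rfl⟩ := Ideal.Quotient.mk_surjective a
    obtain ⟨b, rfl⟩ := Ideal.Quotient.mk_surjective b
    rw [← map_mul, Ideal.Quotient.eq_zero_iff_mem]
    exact Ideal.mem_sup_left (Ideal.mul_mem_mul ha hb)
  obtain ⟨σ, hσ⟩ := exists_lift_of_sq_zero (AlgHom.id (R ⧸ I) Q) g hgs hgsq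
  -- The derivation with values in `J / K` and its lift to a derivation with values in `ι → X`.
  let Λ : (ι → X) →ₗ[X] X ⧸ K := Fintype.linearCombination X (fun j => Ideal.Quotient.mk K (f j))
  have hΛ : ∀ v, Λ v = Ideal.Quotient.mk K (∑ j, v j * f j) := by
    intro v
    rw [Fintype.linearCombination_apply, map_sum]
    rfl
  have hmemΛ : ∀ z : X ⧸ K, g z = 0 → z ∈ LinearMap.range Λ := by
    intro z hz
    obtain ⟨x, rfl⟩ := Ideal.Quotient.mk_surjective z
    have hx : x ∈ J := hz
    rw [← hf, Ideal.mem_span_range_iff_exists_fun] at hx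
    obtain ⟨c, rfl⟩ := hx
    exact ⟨c, hΛ c⟩
  have hδ0 : ∀ x, g (Ideal.Quotient.mk K x - σ (π x)) = 0 := by
    intro x
    rw [map_sub, hσ, hg]
    exact sub_self _
  let δ : Derivation R X (LinearMap.range Λ) := Derivation.mk'
    { toFun := fun x => ⟨Ideal.Quotient.mk K x - σ (π x), hmemΛ _ (hδ0 x)⟩
      map_add' := fun x y => by
        ext
        simp only [map_add, Submodule.coe_add]
        ring
      map_smul' := fun r x => by
        ext
        change Ideal.Quotient.mk K (r • x) - σ (π (r • x)) =
          r • (Ideal.Quotient.mk K x - σ (π x))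
        have h1 : σ (π (r • x)) = r • σ (π x) := by
          rw [map_smul, Algebra.smul_def, map_mul,
            IsScalarTower.algebraMap_apply R (R ⧸ I) Q, AlgHom.commutes, Algebra.smul_def]
          rfl
        rw [h1, smul_sub]
        rfl } (by
      intro x y
      ext
      change Ideal.Quotient.mk K (x * y) - σ (π (x * y)) =
        Ideal.Quotient.mk K x * (Ideal.Quotient.mk K y - σ (π y)) +
        Ideal.Quotient.mk K y * (Ideal.Quotient.mk K x - σ (π x))
      have := hgsq _ _ (hδ0 x) (hδ0 y)
      rw [map_mul, map_mul, map_mul]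
      linear_combination -this)
  -- The differentials of the smooth algebra `X` are projective, so the derivation into `J / K`
  -- lifts along the generators `f`.
  obtain ⟨L, hL⟩ := Module.projective_lifting_property Λ.rangeRestrict δ.liftKaehlerDifferential
    Λ.surjective_rangeRestrict
  let D : Derivation R X (ι → X) := L.compDer (KaehlerDifferential.D R X)
  have hD : ∀ x, Ideal.Quotient.mk K (∑ j, D x j * f j) = Ideal.Quotient.mk K x - σ (π x) := by
    intro x
    have h1 : Λ.rangeRestrict (L (KaehlerDifferential.D R X x)) = δ x := by
      rw [← LinearMap.comp_apply, hL, Derivation.liftKaehlerDifferential_comp_D]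
    rw [← hΛ]
    exact congrArg Subtype.val h1
  have hfK : ∀ i, f i - ∑ j, jacM f D i j * f j ∈ K := by
    intro i
    rw [← Ideal.Quotient.eq_zero_iff_mem, map_sub]
    change _ - Ideal.Quotient.mk K (∑ j, D (f i) j * f j) = 0
    rw [hD, show π (f i) = 0 from hfJ i, map_zero, sub_zero, sub_self]
  have hDK : ∀ x ∈ K, ∀ k, D x k ∈ J := by
    intro x hx k
    obtain ⟨a, ha, b, hb, rfl⟩ := Submodule.mem_sup.mp hx
    rw [map_add]
    refine add_mem ?_ ?_
    · clear hx
      induction ha using Submodule.mul_induction_on' with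
      | mem_mul_mem u hu v hv =>
        rw [D.leibniz]
        exact add_mem (Ideal.mul_mem_right _ _ hu) (Ideal.mul_mem_right _ _ hv)
      | add u _ v _ hu hv =>
        rw [map_add]
        exact add_mem hu hv
    · refine Submodule.span_induction ?_ ?_ ?_ ?_ hb
      · rintro _ ⟨r, -, rfl⟩
        rw [D.map_algebraMap]
        exact zero_mem _
      · rw [map_zero]
        exact zero_mem _
      · intro u v _ _ hu hv
        rw [map_add]
        exact add_mem hu hv
      · intro c u hu hu'
        rw [smul_eq_mul, D.leibniz]
        exact add_mem (Ideal.mul_mem_left _ _ hu') (Ideal.mul_mem_right _ _ (hIJ hu))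
  -- Differentiate `f ≡ M f` modulo `K`: derivatives of elements of `K` lie in `J`, and so do the
  -- terms that contain `f`. Hence `M` becomes idempotent over `Q`; it projects onto the conormal
  -- module `J / K`. The variables `y` serve to absorb the complement.
  have hMM : ∀ i k, jacM f D i k - (jacM f D * jacM f D) i k ∈ J := by
    intro i k
    have h1 := hDK _ (hfK i) k
    rw [map_sub, map_sum] at h1
    have h2 : ∀ j, D (jacM f D i j * f j) = jacM f D i j • D (f j) + f j • D (jacM f D i j) :=
      fun j => D.leibniz _ _
    simp only [h2, Pi.sub_apply, Finset.sum_apply, Pi.add_apply, Pi.smul_apply, smul_eq_mul,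
      Finset.sum_add_distrib] at h1
    have h3 : ∑ j, f j * D (jacM f D i j) k ∈ J :=
      sum_mem fun j _ => Ideal.mul_mem_right _ _ (hfJ j)
    have h4 := add_mem h1 h3
    rw [← sub_sub, sub_add_cancel] at h4
    exact h4
  -- The equation `f = (1 - M) y` implies that `J` is contained in `𝔪 J`.
  let P := MvPolynomial ι X
  let M := jacM f D
  let Jp : Ideal P := J.map MvPolynomial.C
  let 𝔪 : Ideal P := Jp ⊔ Ideal.span (Set.range MvPolynomial.X)
  let 𝔞 : Ideal P := Ideal.span (Set.range (jacF f D)) ⊔ I.map (algebraMap R P)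
  have hX𝔪 : ∀ k, (MvPolynomial.X k : P) ∈ 𝔪 := fun k =>
    Ideal.mem_sup_right (Ideal.subset_span ⟨k, rfl⟩)
  have hle : Jp ≤ 𝔞 ⊔ 𝔪 • Jp := by
    have hCK : ∀ x ∈ K, MvPolynomial.C x ∈ 𝔞 ⊔ 𝔪 • Jp := by
      intro x hx
      have h1 : K.map (MvPolynomial.C : X →+* P) ≤ 𝔞 ⊔ 𝔪 • Jp := by
        rw [Ideal.map_sup, Ideal.map_mul, Ideal.map_map, sup_le_iff]
        constructor
        · exact le_sup_of_le_right (Ideal.mul_mono_left le_sup_left)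
        · exact le_sup_of_le_left le_sup_right
      exact h1 (Ideal.mem_map_of_mem _ hx)
    have hspan : Jp = Ideal.span (Set.range fun i => (MvPolynomial.C (f i) : P)) := by
      change Ideal.map _ J = _
      rw [← hf, Ideal.map_span, ← Set.range_comp]
      rfl
    conv_lhs => rw [hspan]
    rw [Ideal.span_le]
    rintro _ ⟨i, rfl⟩
    have e : (MvPolynomial.C (f i) : P) = MvPolynomial.C (f i - ∑ j, M i j * f j) +
        ∑ j, MvPolynomial.C (M i j) * jacF f D j +
        ∑ k, MvPolynomial.C (M i k - (M * M) i k) * MvPolynomial.X k := by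
      have e1 : ∑ j, MvPolynomial.C (M i j) * jacF f D j =
          ∑ j, (MvPolynomial.C (M i j) * MvPolynomial.C (f j) : P) -
          ∑ j, (MvPolynomial.C (M i j) * MvPolynomial.X j : P) +
          ∑ k, (MvPolynomial.C ((M * M) i k) * MvPolynomial.X k : P) := by
        simp only [jacF, mul_add, mul_sub, Finset.sum_add_distrib, Finset.sum_sub_distrib,
          Finset.mul_sum, Matrix.mul_apply, map_sum, map_mul, Finset.sum_mul]
        congr 1
        rw [Finset.sum_comm]
        refine Finset.sum_congr rfl fun k _ => Finset.sum_congr rfl fun l _ => ?_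
        rw [mul_assoc]
      rw [e1]
      simp only [map_sub, map_sum, map_mul, sub_mul, Finset.sum_sub_distrib]
      ring
    change (MvPolynomial.C (f i) : P) ∈ 𝔞 ⊔ 𝔪 • Jp
    rw [e]
    refine add_mem (add_mem (hCK _ (hfK i)) ?_) ?_
    · exact Ideal.mem_sup_left (sum_mem fun j _ => Ideal.mul_mem_left _ _
        (Ideal.mem_sup_left (Ideal.subset_span ⟨j, rfl⟩)))
    · refine Ideal.mem_sup_right (sum_mem fun k _ => ?_)
      rw [mul_comm]
      exact Ideal.mul_mem_mul (hX𝔪 k) (Ideal.mem_map_of_mem _ (hMM i k))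
  -- Nakayama: inverting an element that is `1` at the zero section puts `J` into the ideal
  -- generated by the equations and `I`.
  obtain ⟨h, hh1, hh⟩ := Submodule.exists_sub_one_mem_and_smul_eq_zero_of_fg_of_le_smul 𝔪
    (Submodule.map 𝔞.mkQ Jp) (Submodule.FG.map _ (Ideal.FG.map hJ _)) (by
      refine (Submodule.map_mono hle).trans ?_
      rw [Submodule.map_sup, Submodule.map_smul'', Submodule.mkQ_map_self, bot_sup_eq])
  have hhJ : ∀ x ∈ J, h * MvPolynomial.C x ∈ 𝔞 := by
    intro x hx
    have h1 := hh _ (Submodule.mem_map_of_mem (f := 𝔞.mkQ) (Ideal.mem_map_of_mem _ hx))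
    rw [← map_smul, Submodule.mkQ_apply, Submodule.Quotient.mk_eq_zero] at h1
    exact h1
  -- Evaluation at `y = 0`.
  let ev : P →ₐ[R] Q :=
    { MvPolynomial.eval₂Hom π.toRingHom (fun _ => 0) with
      commutes' := fun r => by
        change MvPolynomial.eval₂ π.toRingHom _ (algebraMap R (MvPolynomial ι X) r) = _
        rw [IsScalarTower.algebraMap_apply R X (MvPolynomial ι X), MvPolynomial.algebraMap_eq,
          MvPolynomial.eval₂_C]
        exact π.commutes r }
  have hevC : ∀ x, ev (MvPolynomial.C x) = π x := fun x => MvPolynomial.eval₂Hom_C _ _ _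
  have hevX : ∀ k, ev (MvPolynomial.X k) = 0 := fun k => MvPolynomial.eval₂Hom_X' _ _ _
  have hevF : ∀ i, ev (jacF f D i) = 0 := by
    intro i
    simp only [jacF, map_add, map_sub, map_sum, map_mul, hevC, hevX, mul_zero,
      Finset.sum_const_zero, sub_zero, add_zero]
    exact hfJ i
  have hev𝔪 : ∀ z ∈ 𝔪, ev z = 0 := by
    have : 𝔪 ≤ RingHom.ker ev := by
      refine sup_le ?_ ?_
      · rw [Ideal.map_le_iff_le_comap]
        intro x hx
        exact (hevC x).trans hx
      · rw [Ideal.span_le]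
        rintro _ ⟨k, rfl⟩
        exact hevX k
    exact fun z hz => this hz
  have hevh : ev h = 1 := by
    have := hev𝔪 _ hh1
    rwa [map_sub, map_one, sub_eq_zero] at this
  -- At `y = 0` the matrix `E` vanishes and `M` is idempotent, so the Jacobian is `M + (1 - M) = 1`.
  -- The zero section therefore survives inverting the determinant and `h`.
  have hevG : ev (jacG f D).det = 1 := by
    have h1 : ev.toRingHom.mapMatrix (jacG f D) = 1 := by
      have hM : ev.toRingHom.mapMatrix ((jacM f D).map MvPolynomial.C) = M.map π := by
        ext i j
        exact hevC _
      have hE : ev.toRingHom.mapMatrix (jacE f D) = 0 := by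
        ext i j
        change ev (∑ k, MvPolynomial.C _ * MvPolynomial.X k) = 0
        simp only [map_sum, map_mul, hevX, mul_zero, Finset.sum_const_zero]
      have hMM' : M.map π * M.map π = M.map π := by
        ext i k
        have h2 : π (M i k - (M * M) i k) = 0 := hMM i k
        rw [map_sub, sub_eq_zero] at h2
        change _ = π (M i k)
        rw [h2, ← Matrix.map_mul]
        rfl
      simp only [jacG, map_add, map_mul, map_sub, map_one, hM, hE, zero_mul, add_zero, sub_mul,
        mul_sub, one_mul, mul_one, hMM']
      abel
    have h2 := RingHom.map_det ev.toRingHom (jacG f D)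
    rw [h1, Matrix.det_one] at h2
    exact h2
  let d : P := (jacG f D).det * h
  have hsm : Algebra.FormallySmooth R (PresLoc (jacF f D) d) := presLoc_formallySmooth f D h
  obtain ⟨s, hs⟩ := exists_presLoc_algHom (F := jacF f D) (d := d) ev hevF (by
    rw [map_mul, hevG, hevh, mul_one]
    exact isUnit_one)
  refine ⟨PresLoc (jacF f D) d, inferInstance, inferInstance, ⟨hsm, inferInstance⟩,
    (presMk (jacF f D) d).comp (IsScalarTower.toAlgHom R X P), s, ?_, ?_⟩
  · rw [← AlgHom.comp_assoc, hs]
    ext x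
    exact hevC x
  · intro x hx
    have h1 : presMk (R := R) (jacF f D) d (h * MvPolynomial.C x) ∈
        I.map (algebraMap R (PresLoc (jacF f D) d)) := by
      have h2 : 𝔞 ≤ (I.map (algebraMap R (PresLoc (jacF f D) d))).comap
          (presMk (R := R) (jacF f D) d) := by
        refine sup_le ?_ ?_
        · rw [Ideal.span_le]
          rintro _ ⟨i, rfl⟩
          rw [SetLike.mem_coe, Ideal.mem_comap, presMk_apply_eq_zero]
          exact zero_mem _
        · rw [Ideal.map_le_iff_le_comap]
          intro r hr
          rw [Ideal.mem_comap, Ideal.mem_comap, AlgHom.commutes]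
          exact Ideal.mem_map_of_mem _ hr
      exact h2 (hhJ x hx)
    have hu : IsUnit (presMk (R := R) (jacF f D) d h) := by
      have := isUnit_presMk (R := R) (jacF f D) d
      rw [map_mul] at this
      exact isUnit_of_mul_isUnit_right this
    rw [map_mul] at h1
    exact (Ideal.unit_mul_mem_iff_mem _ hu).mp h1

end Deformation

end

end CrisZip

namespace CrisZip

noncomputable section

/-! ### Torsors under the zip group -/

section Torsor

variable {W H : Type u} [CommRing W] [CommRing H] [HopfAlgebra W H]
  {A : Type u} [CommRing A] [Algebra W A] (μ : H →ₐc[W] W[T;T⁻¹])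

/-- The pair of points induced by a homomorphism of the coefficient rings. -/
def pairMap {B C : Type u} [CommRing B] [Algebra W B] [CommRing C] [Algebra W C] (φ : B →ₐ[W] C) :
    Pt W H B × Pt W H B →* Pt W H C × Pt W H C := (Pt.map H φ).prodMap (Pt.map H φ)

lemma pairMap_apply {B C : Type u} [CommRing B] [Algebra W B] [CommRing C] [Algebra W C]
    (φ : B →ₐ[W] C) (x : Pt W H B × Pt W H B) :
    pairMap φ x = (Pt.map H φ x.1, Pt.map H φ x.2) := rfl

lemma pairMap_pairMap {B C D : Type u} [CommRing B] [Algebra W B] [CommRing C] [Algebra W C]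
    [CommRing D] [Algebra W D] (φ : B →ₐ[W] C) (ψ : C →ₐ[W] D) (x : Pt W H B × Pt W H B) :
    pairMap ψ (pairMap φ x) = pairMap (ψ.comp φ) x := rfl

lemma homPair_comp {B C : Type u} [CommRing B] [Algebra W B] [CommRing C] [Algebra W C]
    [Algebra A B] [Algebra A C] [IsScalarTower W A B] [IsScalarTower W A C]
    (φ : A ⊗[W] (H ⊗[W] H) →ₐ[A] B) (ψ : B →ₐ[A] C) :
    homPair (ψ.comp φ) = pairMap (ψ.restrictScalars W) (homPair φ) := rfl

/-- The points with values in a subalgebra. -/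
lemma mem_range_map_val_iff {B : Type u} [CommRing B] [Algebra W B] (L : Subalgebra W B)
    (g : Pt W H B) : g ∈ (Pt.map H L.val).range ↔ ∀ f, g.ofConv f ∈ L := by
  constructor
  · rintro ⟨h, rfl⟩ f
    exact (h.ofConv f).2
  · intro hg
    exact ⟨toConv (g.ofConv.codRestrict L hg), rfl⟩

/-- The coordinates of the two universal points generate `DegenAlg μ t` over `A`. -/
lemma degenPair_id_mem (t : A) (z : DegenAlg μ t) {B : Type u} [CommRing B] [Algebra W B]
    [Algebra A B] [IsScalarTower W A B] (φ : DegenAlg μ t →ₐ[A] B) (L : Subalgebra A B)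
    (h1 : ∀ f, (degenPair μ φ).1.ofConv f ∈ L) (h2 : ∀ f, (degenPair μ φ).2.ofConv f ∈ L) :
    φ z ∈ L := by
  obtain ⟨z, rfl⟩ := degenMk_surjective μ t z
  induction z using TensorProduct.induction_on with
  | zero =>
    rw [map_zero, map_zero]
    exact zero_mem _
  | add z w hz hw =>
    rw [map_add, map_add]
    exact add_mem hz hw
  | tmul a z =>
    induction z using TensorProduct.induction_on with
    | zero =>
      rw [TensorProduct.tmul_zero, map_zero, map_zero]
      exact zero_mem _
    | add z w hz hw =>
      rw [TensorProduct.tmul_add, map_add, map_add]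
      exact add_mem hz hw
    | tmul f g =>
      have e : a ⊗ₜ[W] (f ⊗ₜ[W] g) = a • (((1 : A) ⊗ₜ[W] (f ⊗ₜ[W] (1 : H))) *
          ((1 : A) ⊗ₜ[W] ((1 : H) ⊗ₜ[W] g))) := by
        simp [Algebra.TensorProduct.tmul_mul_tmul, TensorProduct.smul_tmul']
      rw [e, map_smul, map_smul, map_mul, map_mul]
      exact L.smul_mem (L.mul_mem (h1 f) (h2 g)) a

/-- The hypothesis `hc` is the descent condition for the orbit of `c` under the zip group. The
descended orbit is a torsor that is closed in `𝒢²` over `A`. Its coordinate ring is obtained without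
general descent theory, as the image of `A ⊗ (H ⊗ H)` in the functions on the orbit over `S`;
smoothness is then checked after base change to `S`. -/
theorem exists_smooth_torsor [IsNoetherianRing W] [Algebra.Smooth W H]
    {S : Type u} [CommRing S] [Algebra W S] [Algebra A S] [IsScalarTower W A S]
    [Module.FaithfullyFlat A S] (c : Pt W H S × Pt W H S)
    (hc : pairMap ((Algebra.TensorProduct.includeRight : S →ₐ[A] S ⊗[A] S).restrictScalars W) c *
      (pairMap ((Algebra.TensorProduct.includeLeft : S →ₐ[A] S ⊗[A] S).restrictScalars W) c)⁻¹ ∈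
        degen μ 0) :
    ∃ (Q : Type u) (_ : CommRing Q) (_ : Algebra A Q) (_ : Algebra W Q) (_ : IsScalarTower W A Q),
      Algebra.Smooth A Q ∧ Nonempty (Q →ₐ[A] S) ∧
      ∃ θ : A ⊗[W] (H ⊗[W] H) →ₐ[A] Q, Function.Surjective θ ∧
        pairMap ((Algebra.TensorProduct.includeRight : Q →ₐ[A] S ⊗[A] Q).restrictScalars W)
            (homPair θ) *
          (pairMap ((Algebra.TensorProduct.includeLeft : S →ₐ[A] S ⊗[A] Q).restrictScalars W)
            c)⁻¹ ∈ degen μ 0 := by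
  let C₀ := DegenAlg μ (0 : W)
  let D := S ⊗[W] C₀
  let iC : C₀ →ₐ[W] D := Algebra.TensorProduct.includeRight
  let iS : S →ₐ[A] D := Algebra.TensorProduct.includeLeft
  let e : Pt W H D × Pt W H D := degenPair μ iC
  have he : e ∈ degen μ (0 : D) := by
    have := degenPair_mem μ iC
    rwa [map_zero] at this
  let cD : Pt W H D × Pt W H D := pairMap (iS.restrictScalars W) c
  -- The universal point of the orbit: the action is free, so the orbit over `S` is the zip group
  -- over `S`, with coordinate ring `D`.
  let x := e * cD
  let θ : A ⊗[W] (H ⊗[W] H) →ₐ[A] D := pairHom A x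
  let Q := θ.range
  let m : S ⊗[A] Q →ₐ[S] D := Algebra.TensorProduct.lift (Algebra.ofId S D) Q.val
    fun _ _ => Commute.all _ _
  have hm : ∀ s (q : Q), m (s ⊗ₜ q) = algebraMap S D s * q := fun s q => by
    simp [m, Algebra.ofId_apply]
  have hmQ : ∀ z : Q, m ((Algebra.TensorProduct.includeRight : Q →ₐ[A] S ⊗[A] Q) z) = z :=
    fun z => by
      change m (1 ⊗ₜ z) = z
      rw [hm, map_one, one_mul]
  have hmS : ∀ s : S, m ((Algebra.TensorProduct.includeLeft : S →ₐ[A] S ⊗[A] Q) s) = iS s :=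
    fun s => by
      change m (s ⊗ₜ 1) = iS s
      rw [hm]
      change algebraMap S D s * 1 = _
      rw [mul_one]
      rfl
  -- surjectivity
  have hsurj : Function.Surjective m := by
    rw [← AlgHom.range_eq_top]
    let L := m.range.restrictScalars W
    have hx : ∀ f, x.1.ofConv f ∈ L ∧ x.2.ofConv f ∈ L := by
      intro f
      have h := homPair_pairHom (A := A) x
      constructor
      · rw [← h, homPair_fst_apply]
        exact ⟨1 ⊗ₜ ⟨_, ⟨_, rfl⟩⟩, hmQ _⟩
      · rw [← h, homPair_snd_apply]
        exact ⟨1 ⊗ₜ ⟨_, ⟨_, rfl⟩⟩, hmQ _⟩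
    have hcD : ∀ f, cD.1.ofConv f ∈ L ∧ cD.2.ofConv f ∈ L := fun f =>
      ⟨⟨_, hmS _⟩, ⟨_, hmS _⟩⟩
    -- Points with values in a subalgebra form a group, so `e = x c⁻¹` has coordinates in the image
    -- as soon as `x` and `c` do.
    have he1 : ∀ f, e.1.ofConv f ∈ L := by
      rw [← mem_range_map_val_iff]
      have : e.1 = x.1 * cD.1⁻¹ := (mul_inv_cancel_right e.1 cD.1).symm
      rw [this]
      exact mul_mem ((mem_range_map_val_iff L _).mpr fun f => (hx f).1)
        (inv_mem ((mem_range_map_val_iff L _).mpr fun f => (hcD f).1))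
    have he2 : ∀ f, e.2.ofConv f ∈ L := by
      rw [← mem_range_map_val_iff]
      have : e.2 = x.2 * cD.2⁻¹ := (mul_inv_cancel_right e.2 cD.2).symm
      rw [this]
      exact mul_mem ((mem_range_map_val_iff L _).mpr fun f => (hx f).2)
        (inv_mem ((mem_range_map_val_iff L _).mpr fun f => (hcD f).2))
    rw [eq_top_iff]
    rintro z -
    induction z using TensorProduct.induction_on with
    | zero => exact zero_mem _
    | add z w hz hw => exact add_mem hz hw
    | tmul s z =>
      have h1 : iC z ∈ L := degenPair_id_mem μ (0 : W) z iC L he1 he2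
      have h2 : s ⊗ₜ[W] z = s • (iC z) := by
        change s ⊗ₜ[W] z = s • ((1 : S) ⊗ₜ[W] z)
        rw [TensorProduct.smul_tmul', smul_eq_mul, mul_one]
      rw [h2]
      exact m.range.smul_mem h1 s
  -- injectivity
  let iR : D →ₐ[A] S ⊗[A] D := Algebra.TensorProduct.includeRight
  let iL : S →ₐ[A] S ⊗[A] D := Algebra.TensorProduct.includeLeft
  -- The element of the zip group over `S ⊗ D` that carries `c` on the left factor to `x` on the
  -- right factor. It defines `α`, and `α` composed with `m` is the base change of the inclusion of
  -- `Q`, which is injective by flatness.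
  let ε := pairMap (iR.restrictScalars W) x * (pairMap (iL.restrictScalars W) c)⁻¹
  have hε : ε ∈ degen μ (0 : S ⊗[A] D) := by
    have h1 := degen_map μ (iR.restrictScalars W) (map_zero _) he
    have h2 := degen_map μ ((Algebra.TensorProduct.map (AlgHom.id A S) iS).restrictScalars W)
      (map_zero _) hc
    rw [← mem_zipGroup_iff] at h1 h2 ⊢
    have h3 := mul_mem h1 h2
    have e1 : ((Algebra.TensorProduct.map (AlgHom.id A S) iS).restrictScalars W).comp
        ((Algebra.TensorProduct.includeRight : S →ₐ[A] S ⊗[A] S).restrictScalars W) =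
        (iR.restrictScalars W).comp (iS.restrictScalars W) := by
      ext s
      simp [iR]
    have e2 : ((Algebra.TensorProduct.map (AlgHom.id A S) iS).restrictScalars W).comp
        ((Algebra.TensorProduct.includeLeft : S →ₐ[A] S ⊗[A] S).restrictScalars W) =
        iL.restrictScalars W := by
      ext s
      simp [iL]
    rw [← pairMap_apply, ← pairMap_apply, map_mul, map_inv, pairMap_pairMap, pairMap_pairMap, e1,
      e2, ← pairMap_pairMap, ← mul_assoc, ← map_mul] at h3
    exact h3
  have hε' : ε ∈ degen μ (algebraMap W (S ⊗[A] D) 0) := by rwa [map_zero]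
  obtain ⟨ψ, hψ⟩ := exists_degenPair_eq (A := W) (B := S ⊗[A] D) μ hε'
  let α : D →ₐ[S] S ⊗[A] D := Algebra.TensorProduct.lift (Algebra.ofId S (S ⊗[A] D)) ψ
    fun _ _ => Commute.all _ _
  have hαθ : (α.restrictScalars A).comp θ = iR.comp θ := by
    have key : homPair ((α.restrictScalars A).comp θ) = homPair (iR.comp θ) := by
      rw [homPair_comp, homPair_comp, homPair_pairHom]
      have e1 : pairMap ((α.restrictScalars A).restrictScalars W) e = ε := by
        have e0 : (α.restrictScalars W).comp iC = ψ := by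
          ext z
          refine (Algebra.TensorProduct.lift_tmul (Algebra.ofId S (S ⊗[A] D)) ψ
            (fun _ _ => Commute.all _ _) 1 z).trans ?_
          rw [map_one, one_mul]
        rw [← hψ, ← e0]
        rfl
      have e2 : pairMap ((α.restrictScalars A).restrictScalars W) cD =
          pairMap (iL.restrictScalars W) c := by
        rw [pairMap_pairMap]
        congr 2
        ext s
        refine (Algebra.TensorProduct.lift_tmul (Algebra.ofId S (S ⊗[A] D)) ψ
          (fun _ _ => Commute.all _ _) s 1).trans ?_
        rw [map_one, mul_one]
        rfl
      rw [map_mul, e1, e2, inv_mul_cancel_right]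
    rw [← pairHom_homPair ((α.restrictScalars A).comp θ), key, pairHom_homPair]
  have hinj : Function.Injective m := by
    have h1 : ∀ z, α (m z) = (Algebra.TensorProduct.map (AlgHom.id S S) Q.val) z := by
      have : α.comp m = Algebra.TensorProduct.map (AlgHom.id S S) Q.val := by
        ext q
        obtain ⟨_, z, rfl⟩ := q
        have := DFunLike.congr_fun hαθ z
        change α (m (1 ⊗ₜ _)) = 1 ⊗ₜ[A] (θ z)
        rw [hm, map_one, one_mul]
        exact this
      exact fun z => DFunLike.congr_fun this z
    have h2 : Function.Injective (Algebra.TensorProduct.map (AlgHom.id S S) Q.val) :=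
      Module.Flat.lTensor_preserves_injective_linearMap (M := S) Q.val.toLinearMap
        Subtype.val_injective
    intro z w hzw
    apply h2
    rw [← h1, ← h1, hzw]
  let E : S ⊗[A] Q ≃ₐ[S] D := AlgEquiv.ofBijective m ⟨hinj, hsurj⟩
  have hC₀ : Algebra.Smooth W C₀ := ⟨inferInstance, inferInstance⟩
  have hsm : Algebra.Smooth S (S ⊗[A] Q) := Algebra.Smooth.of_equiv E.symm
  refine ⟨Q, inferInstance, inferInstance, inferInstance, inferInstance,
    Algebra.Smooth.of_smooth_tensorProduct_of_faithfullyFlat S, ?_, θ.rangeRestrict,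
    θ.rangeRestrict_surjective, ?_⟩
  · obtain ⟨η, -⟩ := exists_degenPair_eq (A := W) (B := S) (t := 0) μ (x := 1) (by
      rw [map_zero, ← mem_zipGroup_iff]
      exact one_mem _)
    exact ⟨((Algebra.TensorProduct.lift (AlgHom.id S S) η fun _ _ => Commute.all _ _ :
      D →ₐ[S] S).restrictScalars A).comp Q.val⟩
  · refine degen_of_map μ (m.restrictScalars W) (map_zero _) hinj ?_
    rw [← pairMap_apply, map_mul, map_inv, pairMap_pairMap, pairMap_pairMap]
    have e1 : (m.restrictScalars W).comp
        ((Algebra.TensorProduct.includeRight : Q →ₐ[A] S ⊗[A] Q).restrictScalars W) =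
        Q.val.restrictScalars W := by
      ext z
      exact hmQ z
    have e2 : (m.restrictScalars W).comp
        ((Algebra.TensorProduct.includeLeft : S →ₐ[A] S ⊗[A] Q).restrictScalars W) =
        iS.restrictScalars W := by
      ext z
      exact hmS z
    rw [e1, e2]
    have e3 : pairMap (Q.val.restrictScalars W) (homPair θ.rangeRestrict) = x := by
      rw [← homPair_comp]
      exact homPair_pairHom (A := A) x
    rw [e3, mul_inv_cancel_right]
    exact he

end Torsor

end

end CrisZip

namespace CrisZip

noncomputable section

/-! ### Generalities on the flat site -/

section Site

variable {W : Type u} [CommRing W] {P : ObjectProperty (CommAlgCat.{u} W)}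

/-- A family of flat homomorphisms of finite presentation that is jointly surjective on spectra. -/
structure IsFppfCover {X : P.FullSubcategory} {I : Type} {Y : I → P.FullSubcategory}
    (f : ∀ i, X ⟶ Y i) : Prop where
  flat : ∀ i, (f i).hom.hom.toRingHom.Flat
  finitePresentation : ∀ i, (f i).hom.hom.toRingHom.FinitePresentation
  surjective : ∀ q : PrimeSpectrum X.obj, ∃ i,
    q ∈ Set.range (PrimeSpectrum.comap (f i).hom.hom.toRingHom)

/-- The tensor product. Its universal property is recorded for all `W`-algebras `T`, since it is
used below with flat `X`, `Y`, `Z` and a target in which `p = 0`. -/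
lemma exists_pushout
    (hP : ∀ {R S : CommAlgCat.{u} W} (f : R ⟶ S), P R → f.hom.toRingHom.Flat → P S)
    {X Y Z : P.FullSubcategory} (f : X ⟶ Y) (g : X ⟶ Z) (hf : f.hom.hom.toRingHom.Flat) :
    ∃ (V : P.FullSubcategory) (j₁ : Z ⟶ V) (j₂ : Y ⟶ V), g ≫ j₁ = f ≫ j₂ ∧
      j₁.hom.hom.toRingHom.Flat ∧
      (f.hom.hom.toRingHom.FinitePresentation → j₁.hom.hom.toRingHom.FinitePresentation) ∧
      (∀ q : PrimeSpectrum Z.obj, PrimeSpectrum.comap g.hom.hom.toRingHom q ∈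
          Set.range (PrimeSpectrum.comap f.hom.hom.toRingHom) →
        q ∈ Set.range (PrimeSpectrum.comap j₁.hom.hom.toRingHom)) ∧
      ∀ (T : CommAlgCat.{u} W) (a : Z.obj ⟶ T) (b : Y.obj ⟶ T), g.hom ≫ a = f.hom ≫ b →
        ∃ c : V.obj ⟶ T, j₁.hom ≫ c = a ∧ j₂.hom ≫ c = b := by
  let : Algebra X.obj Z.obj := g.hom.hom.toRingHom.toAlgebra
  have : IsScalarTower W X.obj Z.obj :=
    IsScalarTower.of_algebraMap_eq' g.hom.hom.comp_algebraMap.symm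
  let : Algebra X.obj Y.obj := f.hom.hom.toRingHom.toAlgebra
  have : IsScalarTower W X.obj Y.obj :=
    IsScalarTower.of_algebraMap_eq' f.hom.hom.comp_algebraMap.symm
  let in₁ : Z.obj ⟶ CommAlgCat.of W (Z.obj ⊗[X.obj] Y.obj) :=
    CommAlgCat.ofHom Algebra.TensorProduct.includeLeft
  let in₂ : Y.obj ⟶ CommAlgCat.of W (Z.obj ⊗[X.obj] Y.obj) :=
    CommAlgCat.ofHom (Algebra.TensorProduct.includeRight.restrictScalars W)
  have flat : in₁.hom.toRingHom.Flat :=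
    RingHom.Flat.isStableUnderBaseChange.tensorProduct Z.obj hf
  let V : P.FullSubcategory := ⟨CommAlgCat.of W (Z.obj ⊗[X.obj] Y.obj), hP in₁ Z.property flat⟩
  refine ⟨V, ObjectProperty.homMk in₁, ObjectProperty.homMk in₂, ?_, flat, fun h =>
    RingHom.finitePresentation_isStableUnderBaseChange.tensorProduct Z.obj h,
    fun q hq => mem_range_comap_includeLeft q hq, ?_⟩
  · ext x
    exact ((Algebra.TensorProduct.includeRight :
      Y.obj →ₐ[X.obj] Z.obj ⊗[X.obj] Y.obj).commutes x).symm
  · intro T a b h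
    let : Algebra X.obj T := (a.hom.toRingHom.comp g.hom.hom.toRingHom).toAlgebra
    let a' : Z.obj →ₐ[X.obj] T := { a.hom.toRingHom with commutes' := fun _ => rfl }
    let b' : Y.obj →ₐ[X.obj] T :=
      { b.hom.toRingHom with
        commutes' := fun x => (congrArg (fun k : X.obj ⟶ T => k.hom x) h).symm }
    let c := Algebra.TensorProduct.productMap a' b'
    have : IsScalarTower W X.obj T := IsScalarTower.of_algebraMap_eq' (by
      ext w
      change _ = a.hom (g.hom.hom (algebraMap W X.obj w))
      rw [AlgHom.commutes, AlgHom.commutes])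
    refine ⟨CommAlgCat.ofHom (c.restrictScalars W), ?_, ?_⟩
    · ext z
      exact Algebra.TensorProduct.productMap_left_apply a' b' z
    · ext z
      exact Algebra.TensorProduct.productMap_right_apply a' b' z

variable {hP : ∀ {R S : CommAlgCat.{u} W} (f : R ⟶ S), P R → f.hom.toRingHom.Flat → P S}

lemma IsFppfCover.generate_mem {X : P.FullSubcategory} {I : Type} [Finite I]
    {Y : I → P.FullSubcategory} {f : ∀ i, X ⟶ Y i} (hf : IsFppfCover f) :
    Sieve.generate (Presieve.ofArrows (fun i => op (Y i)) fun i => (f i).op) ∈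
      fppf P hP (op X) :=
  ⟨I, inferInstance, Y, f, fun i => ⟨hf.flat i, hf.finitePresentation i⟩, hf.surjective,
    fun i => Sieve.le_generate _ _ _ (Presieve.ofArrows.mk i)⟩

/-- A set-valued functor on algebras is a sheaf for the flat topology. -/
def IsFppfSheaf (hP : ∀ {R S : CommAlgCat.{u} W} (f : R ⟶ S), P R → f.hom.toRingHom.Flat → P S)
    (Z : P.FullSubcategory ⥤ Type (u + 1)) : Prop :=
  Presieve.IsSheaf (fppf P hP) (unopUnop _ ⋙ Z)

lemma IsFppfSheaf.eq_of_cover {Z : P.FullSubcategory ⥤ Type (u + 1)} (hZ : IsFppfSheaf hP Z)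
    {X : P.FullSubcategory} {I : Type} [Finite I] {Y : I → P.FullSubcategory}
    {f : ∀ i, X ⟶ Y i} (hf : IsFppfCover f) {z z' : Z.obj X}
    (h : ∀ i, Z.map (f i) z = Z.map (f i) z') : z = z' := by
  have h1 := (hZ _ (hf.generate_mem (hP := hP))).isSeparatedFor
  rw [← Presieve.isSeparatedFor_iff_generate] at h1
  refine h1.ext (P := unopUnop _ ⋙ Z) (X := op X) ?_
  rintro _ _ ⟨i⟩
  exact h i

lemma IsFppfSheaf.exists_glue {Z : P.FullSubcategory ⥤ Type (u + 1)} (hZ : IsFppfSheaf hP Z)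
    {X : P.FullSubcategory} {I : Type} [Finite I] {Y : I → P.FullSubcategory}
    {f : ∀ i, X ⟶ Y i} (hf : IsFppfCover f) (y : ∀ i, Z.obj (Y i))
    (h : ∀ i j (T : P.FullSubcategory) (a : Y i ⟶ T) (b : Y j ⟶ T), f i ≫ a = f j ≫ b →
      Z.map a (y i) = Z.map b (y j)) : ∃ z : Z.obj X, ∀ i, Z.map (f i) z = y i := by
  have h1 := hZ _ (hf.generate_mem (hP := hP))
  rw [← Presieve.isSheafFor_iff_generate, Presieve.isSheafFor_arrows_iff] at h1
  obtain ⟨z, hz, -⟩ := h1 y fun i j T a b e => h i j T.unop a.unop b.unop (congrArg (·.unop) e)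
  exact ⟨z, hz⟩

lemma IsFppfCover.exists_baseChange
    (hP : ∀ {R S : CommAlgCat.{u} W} (f : R ⟶ S), P R → f.hom.toRingHom.Flat → P S)
    {X : P.FullSubcategory} {I : Type}
    {Y : I → P.FullSubcategory} {f : ∀ i, X ⟶ Y i} (hf : IsFppfCover f) {T : P.FullSubcategory}
    (g : X ⟶ T) : ∃ (V : I → P.FullSubcategory) (j₁ : ∀ i, T ⟶ V i) (j₂ : ∀ i, Y i ⟶ V i),
      (∀ i, g ≫ j₁ i = f i ≫ j₂ i) ∧ IsFppfCover j₁ := by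
  choose V j₁ j₂ h1 h2 h3 h4 _ using fun i => exists_pushout hP (f i) g (hf.flat i)
  refine ⟨V, j₁, j₂, h1, h2, fun i => h3 i (hf.finitePresentation i), fun q => ?_⟩
  obtain ⟨i, hi⟩ := hf.surjective (PrimeSpectrum.comap g.hom.hom.toRingHom q)
  exact ⟨i, h4 i q hi⟩

/-- A covering sieve contains one generated by a finite cover. Passing to the larger sieve needs
separatedness for pullbacks of the cover, and these are refined by base changes. -/
lemma isFppfSheaf_of_cover (Z : P.FullSubcategory ⥤ Type (u + 1))
    (sep : ∀ {X : P.FullSubcategory} {I : Type} [Finite I] {Y : I → P.FullSubcategory}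
      {f : ∀ i, X ⟶ Y i} (_ : IsFppfCover f) {z z' : Z.obj X}
      (_ : ∀ i, Z.map (f i) z = Z.map (f i) z'), z = z')
    (glue : ∀ {X : P.FullSubcategory} {I : Type} [Finite I] {Y : I → P.FullSubcategory}
      {f : ∀ i, X ⟶ Y i} (_ : IsFppfCover f) (y : ∀ i, Z.obj (Y i))
      (_ : ∀ i j (T : P.FullSubcategory) (a : Y i ⟶ T) (b : Y j ⟶ T), f i ≫ a = f j ≫ b →
        Z.map a (y i) = Z.map b (y j)), ∃ z : Z.obj X, ∀ i, Z.map (f i) z = y i) :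
    IsFppfSheaf hP Z := by
  rintro X 𝒮 ⟨I, hI, Y, f, hf, hs, hm⟩
  have hf : IsFppfCover f := ⟨fun i => (hf i).1, fun i => (hf i).2, hs⟩
  refine Presieve.isSheafFor_subsieve_aux (unopUnop _ ⋙ Z)
    (S := Sieve.generate (Presieve.ofArrows (fun i => op (Y i)) fun i => (f i).op)) ?_ ?_ ?_
  · change Sieve.generate _ ≤ 𝒮
    rw [Sieve.generate_le_iff]
    rintro _ _ ⟨i⟩
    exact hm i
  · rw [← Presieve.isSheafFor_iff_generate, Presieve.isSheafFor_arrows_iff]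
    intro y hy
    obtain ⟨z, hz⟩ := glue hf y fun i j T a b e => hy i j (op T) a.op b.op (congrArg (·.op) e)
    exact ⟨z, hz, fun z' hz' => sep hf fun i => (hz' i).trans (hz i).symm⟩
  · intro T g _ x z z' hz hz'
    obtain ⟨V, j₁, j₂, h1, h2⟩ := hf.exists_baseChange hP g.unop
    refine sep h2 fun i => ?_
    have h3 : (Sieve.generate
        (Presieve.ofArrows (fun i => op (Y i)) fun i => (f i).op)).pullback g (j₁ i).op :=
      ⟨op (Y i), (j₂ i).op, (f i).op, Presieve.ofArrows.mk i, (congrArg (·.op) (h1 i)).symm⟩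
    exact (hz _ h3).trans (hz' _ h3).symm

lemma isFppfSheaf_sheafification (F : P.FullSubcategory ⥤ Type u) :
    IsFppfSheaf hP (sheafification (fppf P hP) F) :=
  (isSheaf_iff_isSheaf_of_type _ _).mp ((presheafToSheaf (fppf P hP) (Type (u + 1))).obj _).property

lemma toSheafification_naturality (J : GrothendieckTopology P.FullSubcategoryᵒᵖ)
    (F : P.FullSubcategory ⥤ Type u) {R S : P.FullSubcategory} (f : R ⟶ S) (x : F.obj R) :
    (sheafification J F).map f (toSheafification J F x) = toSheafification J F (F.map f x) :=
  (NatTrans.naturality_apply (toSheafify J (unopUnop _ ⋙ F ⋙ uliftFunctor.{u + 1, u}))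
    f.op.op (ULift.up.{u + 1, u} x : ULift.{u + 1, u} (F.obj R))).symm

/-- Every section of the sheafification is locally a section of the presheaf. -/
lemma exists_cover_toSheafification (F : P.FullSubcategory ⥤ Type u) {X : P.FullSubcategory}
    (z : (sheafification (fppf P hP) F).obj X) :
    ∃ (I : Type) (_ : Finite I) (Y : I → P.FullSubcategory) (f : ∀ i, X ⟶ Y i)
      (_ : IsFppfCover f) (x : ∀ i, F.obj (Y i)),
      ∀ i, (sheafification (fppf P hP) F).map (f i) z = toSheafification (fppf P hP) F (x i) := by
  obtain ⟨I, hI, Y, f, hf, hs, hm⟩ := Presheaf.imageSieve_mem (fppf P hP)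
    (toSheafify (fppf P hP) (unopUnop _ ⋙ F ⋙ uliftFunctor.{u + 1, u})) (U := op (op X)) z
  choose x hx using hm
  exact ⟨I, hI, Y, f, ⟨fun i => (hf i).1, fun i => (hf i).2, hs⟩, fun i => (x i).down,
    fun i => (hx i).symm⟩

/-- Sections of a presheaf with the same image in the sheafification agree locally. -/
lemma exists_cover_of_toSheafification_eq (F : P.FullSubcategory ⥤ Type u)
    {X : P.FullSubcategory} {x y : F.obj X}
    (h : toSheafification (fppf P hP) F x = toSheafification (fppf P hP) F y) :
    ∃ (I : Type) (_ : Finite I) (Y : I → P.FullSubcategory) (f : ∀ i, X ⟶ Y i)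
      (_ : IsFppfCover f), ∀ i, F.map (f i) x = F.map (f i) y := by
  obtain ⟨I, hI, Y, f, hf, hs, hm⟩ := Presheaf.equalizerSieve_mem (fppf P hP)
    (toSheafify (fppf P hP) (unopUnop _ ⋙ F ⋙ uliftFunctor.{u + 1, u})) (X := op (op X))
    (ULift.up.{u + 1, u} x : ULift.{u + 1, u} (F.obj X))
    (ULift.up.{u + 1, u} y : ULift.{u + 1, u} (F.obj X)) h
  exact ⟨I, hI, Y, f, ⟨fun i => (hf i).1, fun i => (hf i).2, hs⟩,
    fun i => congrArg ULift.down (hm i)⟩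

end Site

end

end CrisZip

namespace CrisZip

noncomputable section

/-! ### Recognizing a sheafification -/

section Sheafification

variable {W : Type u} [CommRing W] {P : ObjectProperty (CommAlgCat.{u} W)}
  {hP : ∀ {R S : CommAlgCat.{u} W} (f : R ⟶ S), P R → f.hom.toRingHom.Flat → P S}

/-- A natural family of injective, locally surjective maps from a presheaf to a sheaf identifies
the sheaf with the sheafification. -/
theorem exists_sheafification_iso (F : P.FullSubcategory ⥤ Type u)
    (Z : P.FullSubcategory ⥤ Type (u + 1)) (hZ : IsFppfSheaf hP Z)
    (α : ∀ R, F.obj R → Z.obj R)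
    (nat : ∀ {R S : P.FullSubcategory} (f : R ⟶ S) (x : F.obj R),
      α S (F.map f x) = Z.map f (α R x))
    (inj : ∀ R, Function.Injective (α R))
    (surj : ∀ (X : P.FullSubcategory) (z : Z.obj X),
      ∃ (I : Type) (_ : Finite I) (Y : I → P.FullSubcategory) (f : ∀ i, X ⟶ Y i)
      (_ : IsFppfCover f) (x : ∀ i, F.obj (Y i)), ∀ i, Z.map (f i) z = α (Y i) (x i)) :
    ∃ Φ : sheafification (fppf P hP) F ≅ Z,
      ∀ R (x : F.obj R), Φ.hom.app R (toSheafification (fppf P hP) F x) = α R x := by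
  let F' : P.FullSubcategoryᵒᵖᵒᵖ ⥤ Type (u + 1) := unopUnop _ ⋙ F ⋙ uliftFunctor.{u + 1, u}
  let Z' : P.FullSubcategoryᵒᵖᵒᵖ ⥤ Type (u + 1) := unopUnop _ ⋙ Z
  have hZ' : Presheaf.IsSheaf (fppf P hP) Z' := (isSheaf_iff_isSheaf_of_type _ _).mpr hZ
  let a : F' ⟶ Z' :=
    { app := fun R => ↾fun x : ULift.{u + 1, u} (F.obj R.unop.unop) => α R.unop.unop x.down
      naturality := by
        intro R S f
        ext x
        exact nat f.unop.unop (ULift.down x) }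
  have h1 : Presheaf.IsLocallyInjective (fppf P hP) a :=
    Presheaf.isLocallyInjective_of_injective _ _ fun R x y e => ULift.down_injective (inj _ e)
  have h2 : Presheaf.IsLocallySurjective (fppf P hP) a := by
    refine ⟨fun {X} z => ?_⟩
    obtain ⟨I, hI, Y, f, hf, x, hx⟩ := surj X.unop z
    exact ⟨I, hI, Y, f, fun i => ⟨hf.flat i, hf.finitePresentation i⟩, hf.surjective,
      fun i => ⟨ULift.up (x i), (hx i).symm⟩⟩
  let b : sheafify (fppf P hP) F' ⟶ Z' := sheafifyLift (fppf P hP) a hZ'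
  have hb : toSheafify (fppf P hP) F' ≫ b = a := toSheafify_sheafifyLift _ _ _
  have h3 : Presheaf.IsLocallyInjective (fppf P hP) b := by
    rw [← Presheaf.comp_isLocallyInjective_iff (fppf P hP) (toSheafify (fppf P hP) F'), hb]
    exact h1
  have h4 : Presheaf.IsLocallySurjective (fppf P hP) b := by
    rw [← Presheaf.comp_isLocallySurjective_iff (fppf P hP) (toSheafify (fppf P hP) F'), hb]
    exact h2
  let b' : (presheafToSheaf (fppf P hP) (Type (u + 1))).obj F' ⟶ ⟨Z', hZ'⟩ := ⟨b⟩
  have h5 : IsIso b' := (Sheaf.isLocallyBijective_iff_isIso b').mp ⟨h3, h4⟩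
  have h6 : IsIso b := inferInstanceAs (IsIso ((sheafToPresheaf _ _).map b'))
  refine ⟨Functor.isoWhiskerLeft (opOp _) (asIso b), fun R x => ?_⟩
  exact congrArg (fun k : F' ⟶ Z' => k.app (op (op R)) (ULift.up x)) hb

end Sheafification

/-! ### Covers and sheaves under reduction modulo `p` -/

section Reduction

variable (p : ℕ) {W : Type u} [CommRing W]

/-- `S / p` is the base change of `S` along `R → R / p`. -/
def quotientBaseChange (R S : Type u) [CommRing R] [CommRing S] [Algebra R S] :
    (R ⧸ Ideal.span {(p : R)}) ⊗[R] S ≃ₐ[R] S ⧸ Ideal.span {(p : S)} := by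
  let φ : (R ⧸ Ideal.span {(p : R)}) →ₐ[R] S ⧸ Ideal.span {(p : S)} :=
    Ideal.Quotient.liftₐ _ (Algebra.ofId R _) fun a ha => by
      obtain ⟨b, rfl⟩ := Ideal.mem_span_singleton.mp ha
      rw [map_mul, map_natCast, natCast_quotient_eq_zero, zero_mul]
  let ψ : S ⧸ Ideal.span {(p : S)} →ₐ[R] (R ⧸ Ideal.span {(p : R)}) ⊗[R] S :=
    Ideal.Quotient.liftₐ _ Algebra.TensorProduct.includeRight fun a ha => by
      obtain ⟨b, rfl⟩ := Ideal.mem_span_singleton.mp ha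
      rw [map_mul, map_natCast, ← map_natCast (Algebra.TensorProduct.includeLeft :
        (R ⧸ Ideal.span {(p : R)}) →ₐ[R] (R ⧸ Ideal.span {(p : R)}) ⊗[R] S),
        natCast_quotient_eq_zero, map_zero, zero_mul]
  exact AlgEquiv.ofAlgHom (Algebra.TensorProduct.productMap φ (Ideal.Quotient.mkₐ R _)) ψ
    (by
      apply Ideal.Quotient.algHom_ext
      ext s
      change Algebra.TensorProduct.productMap φ (Ideal.Quotient.mkₐ R _) (1 ⊗ₜ s) = _
      simp)
    (by
      apply Algebra.TensorProduct.ext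
      · exact Ideal.Quotient.algHom_ext _ (Subsingleton.elim _ _)
      · ext s
        change ψ (Algebra.TensorProduct.productMap φ (Ideal.Quotient.mkₐ R _) (1 ⊗ₜ s)) = 1 ⊗ₜ s
        rw [Algebra.TensorProduct.productMap_apply_tmul, map_one, one_mul]
        rfl)

lemma quotientBaseChange_tmul_one (R S : Type u) [CommRing R] [CommRing S] [Algebra R S] (r : R) :
    quotientBaseChange p R S (Ideal.Quotient.mk _ r ⊗ₜ 1) =
      Ideal.Quotient.mk _ (algebraMap R S r) :=
  (quotientBaseChange p R S).commutes r

/-- Reduction modulo `p` is a base change, up to an isomorphism of the target. Properties stable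
under base change thus pass to reductions. -/
lemma redFlat_map_eq {R S : FlatAlg.{u} W} (f : R ⟶ S) :
    letI := f.hom.hom.toRingHom.toAlgebra
    ((redFlat p W).map f).hom.hom.toRingHom = (quotientBaseChange p R.obj S.obj).toRingEquiv.toRingHom.comp
      (algebraMap (R.obj ⧸ Ideal.span {(p : R.obj)})
        ((R.obj ⧸ Ideal.span {(p : R.obj)}) ⊗[R.obj] S.obj)) := by
  let := f.hom.hom.toRingHom.toAlgebra
  apply Ideal.Quotient.ringHom_ext
  ext r
  exact (quotientBaseChange_tmul_one p R.obj S.obj r).symm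

lemma flat_redFlat {R S : FlatAlg.{u} W} {f : R ⟶ S} (hf : f.hom.hom.toRingHom.Flat) :
    ((redFlat p W).map f).hom.hom.toRingHom.Flat := by
  let := f.hom.hom.toRingHom.toAlgebra
  rw [redFlat_map_eq]
  exact RingHom.Flat.respectsIso.1 _ _
    (RingHom.Flat.isStableUnderBaseChange.tensorProduct (R.obj ⧸ Ideal.span {(p : R.obj)}) hf)

lemma finitePresentation_redFlat {R S : FlatAlg.{u} W} {f : R ⟶ S}
    (hf : f.hom.hom.toRingHom.FinitePresentation) :
    ((redFlat p W).map f).hom.hom.toRingHom.FinitePresentation := by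
  let := f.hom.hom.toRingHom.toAlgebra
  rw [redFlat_map_eq]
  exact RingHom.finitePresentation_respectsIso.1 _ _
    (RingHom.finitePresentation_isStableUnderBaseChange.tensorProduct
      (R.obj ⧸ Ideal.span {(p : R.obj)}) hf)

lemma mem_range_comap_redFlat {R S : FlatAlg.{u} W} {f : R ⟶ S}
    {q : PrimeSpectrum (R.obj ⧸ Ideal.span {(p : R.obj)})}
    (hq : PrimeSpectrum.comap (Ideal.Quotient.mk _) q ∈
      Set.range (PrimeSpectrum.comap f.hom.hom.toRingHom)) :
    q ∈ Set.range (PrimeSpectrum.comap ((redFlat p W).map f).hom.hom.toRingHom) := by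
  let := f.hom.hom.toRingHom.toAlgebra
  obtain ⟨q', rfl⟩ := mem_range_comap_includeLeft (T := S.obj) q hq
  refine ⟨PrimeSpectrum.comap (quotientBaseChange p R.obj S.obj).symm.toRingEquiv.toRingHom q', ?_⟩
  rw [redFlat_map_eq]
  ext x
  change (quotientBaseChange p R.obj S.obj).symm (quotientBaseChange p R.obj S.obj
    (algebraMap (R.obj ⧸ Ideal.span {(p : R.obj)}) _ x)) ∈ q'.asIdeal ↔ _
  rw [AlgEquiv.symm_apply_apply]
  rfl

lemma IsFppfCover.redFlat {X : FlatAlg.{u} W} {I : Type} {Y : I → FlatAlg.{u} W}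
    {f : ∀ i, X ⟶ Y i} (hf : IsFppfCover f) :
    IsFppfCover fun i => (redFlat p W).map (f i) := by
  refine ⟨fun i => flat_redFlat p (hf.flat i),
    fun i => finitePresentation_redFlat p (hf.finitePresentation i), fun q => ?_⟩
  obtain ⟨i, hi⟩ := hf.surjective (PrimeSpectrum.comap (Ideal.Quotient.mk _) q)
  exact ⟨i, mem_range_comap_redFlat p hi⟩

/-- The functor `R ↦ Z(R / p)` is a sheaf on flat algebras if `Z` is a sheaf on `κ`-algebras. -/
theorem isFppfSheaf_redFlat_comp {Z : KappaAlg.{u} p W ⥤ Type (u + 1)}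
    (hZ : IsFppfSheaf (fun f hR _ => IsKappaAlg.of_hom p W f hR) Z) :
    IsFppfSheaf (fun f hR hf => IsFlatAlg.of_flat W f hR hf) (redFlat p W ⋙ Z) := by
  refine isFppfSheaf_of_cover _ (fun {X I _ Y f} hf {z z'} h => hZ.eq_of_cover (hf.redFlat p) h)
    fun {X I _ Y f} hf y h => hZ.exists_glue (hf.redFlat p) y fun i j T a b e => ?_
  -- Compatibility is given only over flat algebras, while `T` is a `κ`-algebra. The two
  -- homomorphisms to `T` factor through the reduction of the flat algebra `Y i ⊗ Y j` over `X`,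
  -- where compatibility is known.
  obtain ⟨V, j₁, j₂, h1, -, -, -, h2⟩ :=
    exists_pushout (fun f hR hf => IsFlatAlg.of_flat W f hR hf) (f i) (f j) (hf.flat i)
  let π (R : FlatAlg.{u} W) : R.obj ⟶ ((redFlat p W).obj R).obj :=
    CommAlgCat.ofHom (Ideal.Quotient.mkₐ W _)
  obtain ⟨c, hc1, hc2⟩ := h2 T.obj (π (Y j) ≫ b.hom) (π (Y i) ≫ a.hom) (by
    ext x
    exact (congrArg (fun k : (redFlat p W).obj X ⟶ T => k.hom.hom (Ideal.Quotient.mk _ x)) e).symm)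
  have hpT : (p : T.obj) = 0 := T.property
  let c' : (redFlat p W).obj V ⟶ T := ObjectProperty.homMk (CommAlgCat.ofHom
    (Ideal.Quotient.liftₐ _ c.hom fun x hx => by
      obtain ⟨y, rfl⟩ := Ideal.mem_span_singleton.mp hx
      rw [map_mul, map_natCast, hpT, zero_mul]))
  have e1 : (redFlat p W).map j₁ ≫ c' = b := by
    ext x
    obtain ⟨x, rfl⟩ := Ideal.Quotient.mk_surjective x
    exact congrArg (fun k : (Y j).obj ⟶ T.obj => k.hom x) hc1
  have e2 : (redFlat p W).map j₂ ≫ c' = a := by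
    ext x
    obtain ⟨x, rfl⟩ := Ideal.Quotient.mk_surjective x
    exact congrArg (fun k : (Y i).obj ⟶ T.obj => k.hom x) hc2
  rw [← e1, ← e2, Functor.map_comp_apply, Functor.map_comp_apply]
  exact congrArg (Z.map c') (h i j V j₂ j₁ h1.symm)

end Reduction

end

end CrisZip

namespace CrisZip

noncomputable section

/-! ### Finite products of rings -/

section Pi

lemma flat_pi {A : Type u} [CommRing A] {I : Type} [Finite I] (B : I → Type u)
    [∀ i, AddCommGroup (B i)] [∀ i, Module A (B i)] [∀ i, Module.Flat A (B i)] :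
    Module.Flat A (∀ i, B i) := by
  classical
  have := Fintype.ofFinite I
  exact Module.Flat.of_linearEquiv (DFinsupp.linearEquivFunOnFintype (R := A) (M := B)).symm

lemma faithfullyFlat_pi {A : Type u} [CommRing A] {I : Type} [Finite I] (B : I → Type u)
    [∀ i, CommRing (B i)] [∀ i, Algebra A (B i)] (flat : ∀ i, Module.Flat A (B i))
    (surj : ∀ q : PrimeSpectrum A, ∃ i, q ∈ Set.range (PrimeSpectrum.comap (algebraMap A (B i)))) :
    Module.FaithfullyFlat A (∀ i, B i) := by
  have := flat_pi B (A := A)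
  refine Module.FaithfullyFlat.of_comap_surjective fun q => ?_
  obtain ⟨i, q, rfl⟩ := surj q
  exact ⟨PrimeSpectrum.comap (Pi.evalRingHom B i) q, rfl⟩

lemma isLocalization_evalRingHom {I : Type} [DecidableEq I] (B : I → Type u)
    [∀ i, CommRing (B i)] (i : I) : letI := (Pi.evalRingHom B i).toAlgebra
    IsLocalization.Away (Pi.single i 1 : ∀ i, B i) (B i) := by
  let := (Pi.evalRingHom B i).toAlgebra
  refine IsLocalization.away_of_isIdempotentElem ?_ (RingHom.ker_evalRingHom B i)
    (Function.surjective_eval i)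
  change Pi.single i 1 * Pi.single i 1 = (Pi.single i 1 : ∀ i, B i)
  rw [← Pi.single_mul, one_mul]

lemma flat_evalRingHom {I : Type} (B : I → Type u) [∀ i, CommRing (B i)] (i : I) :
    (Pi.evalRingHom B i).Flat := by
  classical
  let := (Pi.evalRingHom B i).toAlgebra
  have := isLocalization_evalRingHom B i
  exact IsLocalization.flat (B i) (Submonoid.powers (Pi.single i 1 : ∀ i, B i))

lemma finitePresentation_evalRingHom {I : Type} (B : I → Type u) [∀ i, CommRing (B i)] (i : I) :
    (Pi.evalRingHom B i).FinitePresentation := by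
  classical
  let := (Pi.evalRingHom B i).toAlgebra
  have := isLocalization_evalRingHom B i
  exact IsLocalization.Away.finitePresentation (Pi.single i 1 : ∀ i, B i)

end Pi

/-! ### Classes in the quotient sheaf by the zip group -/

section Zip

variable (p : ℕ) {W H : Type u} [CommRing W] [CommRing H] [HopfAlgebra W H]
  (μ : H →ₐc[W] W[T;T⁻¹])

lemma IsFppfCover.eq_of_map_eq {P : ObjectProperty (CommAlgCat.{u} W)} {X : P.FullSubcategory}
    {I : Type} [Finite I] {Y : I → P.FullSubcategory} {f : ∀ i, X ⟶ Y i} (hf : IsFppfCover f)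
    {x y : X.obj} (h : ∀ i, (f i).hom.hom x = (f i).hom.hom y) : x = y := by
  let (i : I) : Algebra X.obj (Y i).obj := (f i).hom.hom.toRingHom.toAlgebra
  have := faithfullyFlat_pi (A := X.obj) (fun i => (Y i).obj) hf.flat hf.surjective
  apply FaithfulSMul.algebraMap_injective X.obj (∀ i, (Y i).obj)
  ext i
  exact h i

lemma isFppfSheaf_zipSheaf :
    IsFppfSheaf (fun f hR _ => IsKappaAlg.of_hom p W f hR) (zipSheaf p μ) :=
  isFppfSheaf_sheafification _

/-- The quotient presheaf by the zip group is separated. -/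
lemma toSheafification_zip_injective (A : KappaAlg.{u} p W) :
    Function.Injective (toSheafification (kappaTop p W) (zipPresheaf p μ) (R := A)) := by
  intro x y h
  obtain ⟨x, rfl⟩ : ∃ a, ZipQuot.mk μ a = x := Quotient.exists_rep x
  obtain ⟨y, rfl⟩ : ∃ a, ZipQuot.mk μ a = y := Quotient.exists_rep y
  obtain ⟨I, _, Y, f, hf, hxy⟩ := exists_cover_of_toSheafification_eq _ h
  have hi : ∀ i, pairMap (f i).hom.hom (y * x⁻¹) ∈ degen μ 0 := fun i => by
    rw [map_mul, map_inv]
    exact (zipQuot_mk_eq_iff μ).mp (hxy i)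
  -- Membership in the zip group is a system of equations between ring elements, and these can be
  -- tested on a cover.
  refine (zipQuot_mk_eq_iff μ).mpr fun n g => ⟨?_, ?_⟩
  · refine hf.eq_of_map_eq fun i => ?_
    rw [map_mul, map_pow, map_zero]
    exact (hi i n g).1
  · refine hf.eq_of_map_eq fun i => ?_
    rw [map_mul, map_pow, map_zero]
    exact (hi i n g).2

/-- A ring of characteristic `p` as an object of the category of `κ`-algebras. -/
abbrev kappaOf (Q : Type u) [CommRing Q] [Algebra W Q] (hQ : (p : Q) = 0) : KappaAlg.{u} p W :=
  ⟨CommAlgCat.of W Q, hQ⟩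

/-- The class of a pair of points in the sheaf quotient by the zip group. -/
def zipClass {A : KappaAlg.{u} p W} (x : Pt W H A.obj × Pt W H A.obj) : (zipSheaf p μ).obj A :=
  toSheafification (kappaTop p W) (zipPresheaf p μ) (ZipQuot.mk μ x)

lemma zipClass_map {A B : KappaAlg.{u} p W} (f : A ⟶ B) (x : Pt W H A.obj × Pt W H A.obj) :
    (zipSheaf p μ).map f (zipClass p μ x) = zipClass p μ (pairMap f.hom.hom x) :=
  toSheafification_naturality _ _ f _

lemma zipClass_eq_iff {A : KappaAlg.{u} p W} {x y : Pt W H A.obj × Pt W H A.obj} :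
    zipClass p μ x = zipClass p μ y ↔ y * x⁻¹ ∈ degen μ (0 : A.obj) :=
  ((toSheafification_zip_injective p μ A).eq_iff).trans (zipQuot_mk_eq_iff μ)

end Zip

end

end CrisZip

namespace CrisZip

noncomputable section

/-! ### Representing sections over smooth covers -/

section SmoothCover

variable (p : ℕ) {W H : Type u} [CommRing W] [CommRing H] [HopfAlgebra W H]
  (μ : H →ₐc[W] W[T;T⁻¹])

/-- The structure map of an algebra over a `κ`-algebra. -/
abbrev kappaOfHom (A : KappaAlg.{u} p W) (Q : Type u) [CommRing Q] [Algebra W Q]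
    [Algebra A.obj Q] [IsScalarTower W A.obj Q] (hQ : (p : Q) = 0) :
    A ⟶ kappaOf p (W := W) Q hQ :=
  ObjectProperty.homMk (CommAlgCat.ofHom (IsScalarTower.toAlgHom W A.obj Q))

lemma zipClass_kappaOf_eq_iff {B : Type u} [CommRing B] [Algebra W B] (hB : (p : B) = 0)
    {x y : Pt W H B × Pt W H B} :
    zipClass p μ (A := kappaOf p B hB) x = zipClass p μ (A := kappaOf p B hB) y ↔
      y * x⁻¹ ∈ degen μ (0 : B) :=
  zipClass_eq_iff p μ

/-- A finite cover is replaced by the product of its rings, because the torsor construction works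
with one faithfully flat algebra. Points with values in the product are families of points. -/
lemma exists_cover_zipClass (A : KappaAlg.{u} p W) (s : (zipSheaf p μ).obj A) :
    ∃ (S : KappaAlg.{u} p W) (f : A ⟶ S) (_ : IsFppfCover fun _ : Unit => f)
      (c : Pt W H S.obj × Pt W H S.obj), (zipSheaf p μ).map f s = zipClass p μ c := by
  obtain ⟨I, _, Y, f, hf, x, hx⟩ := exists_cover_toSheafification _ s
  choose c hc using fun i => (Quotient.exists_rep (x i) : ∃ a, ZipQuot.mk μ a = x i)
  let (i : I) : Algebra A.obj (Y i).obj := (f i).hom.hom.toRingHom.toAlgebra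
  have (i : I) : IsScalarTower W A.obj (Y i).obj :=
    IsScalarTower.of_algebraMap_eq' (f i).hom.hom.comp_algebraMap.symm
  have (i : I) : Algebra.FinitePresentation A.obj (Y i).obj := hf.finitePresentation i
  have (i : I) : Module.Flat A.obj (Y i).obj := hf.flat i
  have hS : (p : ∀ i, (Y i).obj) = 0 := funext fun i => (Y i).property
  let S : KappaAlg.{u} p W := kappaOf p (∀ i, (Y i).obj) hS
  let pr (i : I) : S ⟶ Y i :=
    ObjectProperty.homMk (CommAlgCat.ofHom (Pi.evalAlgHom W (fun i => (Y i).obj) i))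
  have hpr : IsFppfCover pr := by
    refine ⟨fun i => flat_evalRingHom (fun i => (Y i).obj) i,
      fun i => finitePresentation_evalRingHom (fun i => (Y i).obj) i, fun q => ?_⟩
    obtain ⟨i, q, rfl⟩ := PrimeSpectrum.exists_comap_evalRingHom_eq q
    exact ⟨i, q, rfl⟩
  let cS : Pt W H S.obj × Pt W H S.obj :=
    (toConv (AlgHom.pi fun i => (c i).1.ofConv), toConv (AlgHom.pi fun i => (c i).2.ofConv))
  have hfpr : ∀ i, kappaOfHom p A (∀ i, (Y i).obj) hS ≫ pr i = f i := fun i => rfl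
  refine ⟨S, kappaOfHom p A (∀ i, (Y i).obj) hS, ⟨fun _ => ?_, fun _ => ?_, fun q => ⟨(), ?_⟩⟩, cS,
    (isFppfSheaf_zipSheaf p μ).eq_of_cover hpr fun i => ?_⟩
  · exact flat_pi (A := A.obj) fun i => (Y i).obj
  · exact Algebra.FinitePresentation.pi (R := A.obj) fun i => (Y i).obj
  · obtain ⟨i, q, rfl⟩ := hf.surjective q
    exact ⟨PrimeSpectrum.comap (pr i).hom.hom.toRingHom q, rfl⟩
  · rw [zipClass_map, ← Functor.map_comp_apply, hfpr]
    exact (hx i).trans (congrArg _ (hc i).symm)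

/-- Sections of the quotient sheaf by the zip group are represented by points after base change
to a smooth cover, which can be chosen to be closed in `G × G`. -/
theorem exists_smooth_zipClass [IsNoetherianRing W] [Algebra.Smooth W H] (A : KappaAlg.{u} p W)
    (s : (zipSheaf p μ).obj A) :
    ∃ (Q : Type u) (_ : CommRing Q) (_ : Algebra A.obj Q) (_ : Algebra W Q)
      (_ : IsScalarTower W A.obj Q) (hQ : (p : Q) = 0), Algebra.Smooth A.obj Q ∧
      Function.Surjective (PrimeSpectrum.comap (algebraMap A.obj Q)) ∧
      ∃ θ : A.obj ⊗[W] (H ⊗[W] H) →ₐ[A.obj] Q, Function.Surjective θ ∧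
        (zipSheaf p μ).map (kappaOfHom p A Q hQ) s =
          zipClass p μ (A := kappaOf p Q hQ) (homPair θ) := by
  obtain ⟨S, f, hf, c, hsS⟩ := exists_cover_zipClass p μ A s
  have hpA : (p : A.obj) = 0 := A.property
  let : Algebra A.obj S.obj := f.hom.hom.toRingHom.toAlgebra
  have : IsScalarTower W A.obj S.obj :=
    IsScalarTower.of_algebraMap_eq' f.hom.hom.comp_algebraMap.symm
  have : Module.Flat A.obj S.obj := hf.flat ()
  have : Module.FaithfullyFlat A.obj S.obj := Module.FaithfullyFlat.of_comap_surjective fun q =>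
    (hf.surjective q).choose_spec
  have hSS : (p : S.obj ⊗[A.obj] S.obj) = 0 := by
    rw [← map_natCast (algebraMap A.obj (S.obj ⊗[A.obj] S.obj)), hpA, map_zero]
  let i₁ : S ⟶ kappaOf p (S.obj ⊗[A.obj] S.obj) hSS := ObjectProperty.homMk (CommAlgCat.ofHom
    ((Algebra.TensorProduct.includeLeft : S.obj →ₐ[A.obj] S.obj ⊗[A.obj] S.obj).restrictScalars W))
  let i₂ : S ⟶ kappaOf p (S.obj ⊗[A.obj] S.obj) hSS := ObjectProperty.homMk (CommAlgCat.ofHom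
    ((Algebra.TensorProduct.includeRight : S.obj →ₐ[A.obj] S.obj ⊗[A.obj] S.obj).restrictScalars W))
  have hi : f ≫ i₁ = f ≫ i₂ := by
    ext a
    exact ((Algebra.TensorProduct.includeRight :
      S.obj →ₐ[A.obj] S.obj ⊗[A.obj] S.obj).commutes a).symm
  -- Both pullbacks of `c` represent the same section, so they differ by the zip group: this is the
  -- descent condition.
  have hcc : zipClass p μ (pairMap i₁.hom.hom c) = zipClass p μ (pairMap i₂.hom.hom c) := by
    rw [← zipClass_map, ← zipClass_map, ← hsS, ← Functor.map_comp_apply,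
      ← Functor.map_comp_apply, hi]
  obtain ⟨Q, _, _, _, _, hsm, ⟨η⟩, θ, hθ, hd⟩ :=
    exists_smooth_torsor μ (A := A.obj) (S := S.obj) c
      ((zipClass_kappaOf_eq_iff p μ hSS).mp hcc)
  have hQ : (p : Q) = 0 := by
    rw [← map_natCast (algebraMap A.obj Q), hpA, map_zero]
  refine ⟨Q, _, _, _, inferInstance, hQ, hsm, fun q => ?_, θ, hθ, ?_⟩
  · obtain ⟨-, q, rfl⟩ := hf.surjective q
    -- Primes of `A` come from `S`, and `Q → S` brings them to `Q`.
    refine ⟨PrimeSpectrum.comap η.toRingHom q, ?_⟩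
    rw [← PrimeSpectrum.comap_comp_apply, η.toRingHom_eq_coe, η.comp_algebraMap]
    rfl
  -- The equality of sections over `Q` may be checked after base change to `S`. There `hd` compares
  -- the universal point of the torsor with `c`.
  · obtain ⟨V, j₁, j₂, hj, hV⟩ := hf.exists_baseChange
      (fun f hR _ => IsKappaAlg.of_hom p W f hR) (kappaOfHom p A Q hQ)
    refine (isFppfSheaf_zipSheaf p μ).eq_of_cover hV fun i => ?_
    let : Algebra A.obj (V i).obj :=
      ((j₁ i).hom.hom.toRingHom.comp (algebraMap A.obj Q)).toAlgebra
    have : IsScalarTower W A.obj (V i).obj :=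
      IsScalarTower.of_algebraMap_eq' ((kappaOfHom p A Q hQ) ≫ j₁ i).hom.hom.comp_algebraMap.symm
    let a : S.obj →ₐ[A.obj] (V i).obj :=
      { (j₂ i).hom.hom.toRingHom with
        commutes' := fun x =>
          (congrArg (fun k : A ⟶ V i => k.hom.hom x) (hj i)).symm }
    let b : Q →ₐ[A.obj] (V i).obj := { (j₁ i).hom.hom.toRingHom with commutes' := fun _ => rfl }
    let m : S.obj ⊗[A.obj] Q →ₐ[A.obj] (V i).obj := Algebra.TensorProduct.productMap a b
    have hd' := degen_map μ (m.restrictScalars W) (map_zero _) hd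
    rw [← pairMap_apply, map_mul, map_inv, pairMap_pairMap, pairMap_pairMap] at hd'
    have e1 : (m.restrictScalars W).comp ((Algebra.TensorProduct.includeRight :
        Q →ₐ[A.obj] S.obj ⊗[A.obj] Q).restrictScalars W) = (j₁ i).hom.hom := by
      ext z
      exact Algebra.TensorProduct.productMap_right_apply a b z
    have e2 : (m.restrictScalars W).comp ((Algebra.TensorProduct.includeLeft :
        S.obj →ₐ[A.obj] S.obj ⊗[A.obj] Q).restrictScalars W) = (j₂ i).hom.hom := by
      ext z
      exact Algebra.TensorProduct.productMap_left_apply a b z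
    rw [e1, e2] at hd'
    rw [zipClass_map, ← Functor.map_comp_apply, hj, Functor.map_comp_apply, hsS, zipClass_map]
    exact (zipClass_eq_iff p μ).mpr hd'

end SmoothCover

end

end CrisZip

namespace CrisZip

noncomputable section

/-! ### Lifting sections to smooth algebras over `R` -/

section SmoothLift

variable (p : ℕ)

/-- A smooth algebra over `R / p` maps to the reduction of a smooth algebra over `R` with the same
image in the spectrum. -/
lemma exists_smooth_lift_mod {R X Q : Type u} [CommRing R] [CommRing X] [Algebra R X]
    [Algebra.Smooth R X] [CommRing Q] [Algebra R Q] [Algebra (R ⧸ Ideal.span {(p : R)}) Q]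
    [IsScalarTower R (R ⧸ Ideal.span {(p : R)}) Q]
    [Algebra.Smooth (R ⧸ Ideal.span {(p : R)}) Q] (π : X →ₐ[R] Q) (hπ : Function.Surjective π) :
    ∃ (Y : Type u) (_ : CommRing Y) (_ : Algebra R Y), Algebra.Smooth R Y ∧
      ∃ (a : X →ₐ[R] Y) (_ : Y →ₐ[R] Q) (τ : Q →ₐ[R] Y ⧸ Ideal.span {(p : Y)}),
        ∀ x, τ (π x) = Ideal.Quotient.mk _ (a x) := by
  obtain ⟨Y, _, _, hY, a, s, -, ha⟩ := exists_smooth_lift (Submodule.fg_span_singleton (p : R)) π hπ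
  have hI : (Ideal.span {(p : R)}).map (algebraMap R Y) = Ideal.span {(p : Y)} := by
    rw [Ideal.map_span, Set.image_singleton, map_natCast]
  have hk : ∀ x, x ∈ RingHom.ker π → (Ideal.Quotient.mkₐ R (Ideal.span {(p : Y)})).comp a x = 0 :=
    fun x hx => Ideal.Quotient.eq_zero_iff_mem.mpr (hI ▸ ha x hx)
  let e := Ideal.quotientKerAlgEquivOfSurjective hπ
  refine ⟨Y, _, _, hY, a, s, (Ideal.Quotient.liftₐ (RingHom.ker π) _ hk).comp e.symm, fun x => ?_⟩
  have : e.symm (π x) = Ideal.Quotient.mk _ x := by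
    rw [AlgEquiv.symm_apply_eq]
    rfl
  change Ideal.Quotient.liftₐ (RingHom.ker π) _ hk (e.symm (π x)) = _
  rw [this]
  rfl

variable {W H : Type u} [CommRing W] [CommRing H] [HopfAlgebra W H] (μ : H →ₐc[W] W[T;T⁻¹])

/-- Sections of the quotient sheaf by the zip group over `R / p` are represented by points of
`𝒢 × 𝒢` with values in a smooth algebra over `R` whose spectrum covers that of `R / p`. -/
theorem exists_smooth_lift_zipClass [IsNoetherianRing W] [Algebra.Smooth W H] (R : FlatAlg.{u} W)
    (s : (zipSheaf p μ).obj ((redFlat p W).obj R)) :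
    ∃ (Y : FlatAlg.{u} W) (f : R ⟶ Y), f.hom.hom.toRingHom.Smooth ∧
      (∀ q : PrimeSpectrum R.obj, (p : R.obj) ∈ q.asIdeal →
        q ∈ Set.range (PrimeSpectrum.comap f.hom.hom.toRingHom)) ∧
      ∃ x : Pt W H Y.obj × Pt W H Y.obj, (zipSheaf p μ).map ((redFlat p W).map f) s =
        zipClass p μ (A := (redFlat p W).obj Y)
          (pairMap (Ideal.Quotient.mkₐ W (Ideal.span {(p : Y.obj)})) x) := by
  obtain ⟨Q, _, iQ, _, hWQ, hQ, hsm, hsurj, θ, hθ, hs⟩ := exists_smooth_zipClass p μ _ s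
  let Rb := R.obj ⧸ Ideal.span {(p : R.obj)}
  let : Algebra Rb Q := iQ
  let : Algebra R.obj Q := ((algebraMap Rb Q).comp (Ideal.Quotient.mk _)).toAlgebra
  have : IsScalarTower R.obj Rb Q := IsScalarTower.of_algebraMap_eq' rfl
  have : IsScalarTower W Rb Q := hWQ
  have : IsScalarTower W R.obj Q := IsScalarTower.of_algebraMap_eq' (by
    rw [IsScalarTower.algebraMap_eq W Rb Q]
    rfl)
  have : Algebra.Smooth Rb Q := hsm
  let θ' : Rb ⊗[W] (H ⊗[W] H) →ₐ[Rb] Q := θ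
  -- The torsor is closed in `𝒢²` over `R` as well. This presents `Q` as a quotient of a smooth
  -- `R`-algebra, as the lifting theorem requires.
  let π : R.obj ⊗[W] (H ⊗[W] H) →ₐ[R.obj] Q := pairHom R.obj (homPair θ')
  have hπ' : ∀ a z, π (a ⊗ₜ z) = θ' (Ideal.Quotient.mk _ a ⊗ₜ z) := by
    intro a z
    induction z using TensorProduct.induction_on with
    | zero => simp only [TensorProduct.tmul_zero, map_zero]
    | add z w hz hw => simp only [TensorProduct.tmul_add, map_add, hz, hw]
    | tmul f g =>
      rw [← pairHom_homPair θ', pairHom_tmul]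
      exact pairHom_tmul (A := R.obj) (homPair θ') a f g
  have hπ : Function.Surjective π := by
    intro z
    obtain ⟨z, rfl⟩ := hθ z
    induction z using TensorProduct.induction_on with
    | zero => exact ⟨0, by rw [map_zero, map_zero]⟩
    | add z w hz hw =>
      obtain ⟨z', hz⟩ := hz
      obtain ⟨w', hw⟩ := hw
      exact ⟨z' + w', by rw [map_add, map_add, hz, hw]⟩
    | tmul a z =>
      obtain ⟨a, rfl⟩ := Ideal.Quotient.mk_surjective a
      exact ⟨a ⊗ₜ z, hπ' a z⟩
  have : Algebra.Smooth W (H ⊗[W] H) := Algebra.Smooth.comp W H (H ⊗[W] H)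
  obtain ⟨Y, _, _, hY, a, σ, τ, hτ⟩ := exists_smooth_lift_mod p π hπ
  let : Algebra W Y := ((algebraMap R.obj Y).comp (algebraMap W R.obj)).toAlgebra
  have : IsScalarTower W R.obj Y := IsScalarTower.of_algebraMap_eq' rfl
  have : Module.Flat W R.obj := R.property
  have : Module.Flat R.obj Y := Algebra.Smooth.flat R.obj Y
  let Y' : FlatAlg.{u} W := ⟨CommAlgCat.of W Y, Module.Flat.trans W R.obj Y⟩
  let f : R ⟶ Y' := ObjectProperty.homMk (CommAlgCat.ofHom (IsScalarTower.toAlgHom W R.obj Y))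
  have hf : f.hom.hom.toRingHom = algebraMap R.obj Y := rfl
  refine ⟨Y', f, ?_, ?_, homPair a, ?_⟩
  · rw [hf]
    exact RingHom.smooth_algebraMap.mpr hY
  -- A prime that contains `p` comes from `R / p`, lifts to `Q`, and is carried to `Y` by `σ`.
  · intro q hq
    obtain ⟨q', hq'⟩ : q ∈ Set.range (PrimeSpectrum.comap (Ideal.Quotient.mk
        (Ideal.span {(p : R.obj)}))) := by
      rw [range_comap_of_surjective _ _ Ideal.Quotient.mk_surjective,
        PrimeSpectrum.mem_zeroLocus, Ideal.mk_ker]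
      exact (Ideal.span_singleton_le_iff_mem _).mpr hq
    obtain ⟨q'', hq''⟩ := hsurj q'
    refine ⟨PrimeSpectrum.comap σ.toRingHom q'', ?_⟩
    rw [hf, ← PrimeSpectrum.comap_comp_apply, σ.toRingHom_eq_coe, σ.comp_algebraMap, ← hq', ← hq'']
    rfl
  · let t : kappaOf p Q hQ ⟶ (redFlat p W).obj Y' :=
      ObjectProperty.homMk (CommAlgCat.ofHom (τ.restrictScalars W))
    have ht : (redFlat p W).map f = kappaOfHom p ((redFlat p W).obj R) Q hQ ≫ t := by
      ext r
      obtain ⟨r, rfl⟩ := Ideal.Quotient.mk_surjective r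
      exact (τ.commutes r).symm
    rw [ht, Functor.map_comp_apply, hs, zipClass_map]
    congr 1
    apply Prod.ext
    · apply WithConv.ofConv_injective
      ext z
      change τ (θ' (Ideal.Quotient.mk _ 1 ⊗ₜ (z ⊗ₜ 1))) = Ideal.Quotient.mk _ (a (1 ⊗ₜ (z ⊗ₜ 1)))
      rw [← hπ', hτ]
    · apply WithConv.ofConv_injective
      ext z
      change τ (θ' (Ideal.Quotient.mk _ 1 ⊗ₜ (1 ⊗ₜ z))) = Ideal.Quotient.mk _ (a (1 ⊗ₜ (1 ⊗ₜ z)))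
      rw [← hπ', hτ]

end SmoothLift

end

end CrisZip

namespace CrisZip

noncomputable section

/-! ### Comparison of the sheaves in mixed characteristic -/

section SheafComparison

variable (p : ℕ) {W H : Type u} [CommRing W] [CommRing H] [HopfAlgebra W H]
  (μ : H →ₐc[W] W[T;T⁻¹])

/-- The zero ring is covered by the empty family. -/
lemma zipSheaf_eq_of_subsingleton (A : KappaAlg.{u} p W) (hA : Subsingleton A.obj)
    (s s' : (zipSheaf p μ).obj A) : s = s' := by
  have hc : IsFppfCover (X := A) (I := Empty) (Y := fun i => i.elim) (fun i => i.elim) :=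
    ⟨fun i => i.elim, fun i => i.elim, fun q =>
      (q.isPrime.ne_top (Subsingleton.elim q.asIdeal ⊤)).elim⟩
  exact (isFppfSheaf_zipSheaf p μ).eq_of_cover hc fun i => i.elim

/-- The localization `R[1/p]` as a flat algebra. -/
abbrev flatAway (R : FlatAlg.{u} W) : FlatAlg.{u} W :=
  ⟨CommAlgCat.of W (Localization.Away (p : R.obj)), by
    have : Module.Flat W R.obj := R.property
    have : Module.Flat R.obj (Localization.Away (p : R.obj)) :=
      IsLocalization.flat _ (Submonoid.powers (p : R.obj))
    exact Module.Flat.trans W R.obj (Localization.Away (p : R.obj))⟩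

/-- The localization map `R → R[1/p]`. -/
abbrev flatAwayHom (R : FlatAlg.{u} W) : R ⟶ flatAway p R :=
  ObjectProperty.homMk (CommAlgCat.ofHom
    (IsScalarTower.toAlgHom W R.obj (Localization.Away (p : R.obj))))

lemma subsingleton_redFlat_flatAway (R : FlatAlg.{u} W) :
    Subsingleton ((redFlat p W).obj (flatAway p R)).obj := by
  refine Ideal.Quotient.subsingleton_iff.mpr ?_
  have h := IsLocalization.Away.algebraMap_isUnit (S := Localization.Away (p : R.obj)) (p : R.obj)
  rw [map_natCast] at h
  exact Ideal.span_singleton_eq_top.mpr h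

/-- `Y` only has to reach the locus `p = 0`, since `R[1/p]` takes care of the complement. -/
lemma isFppfCover_flatAway {R Y : FlatAlg.{u} W} (f : R ⟶ Y) (hf : f.hom.hom.toRingHom.Smooth)
    (hs : ∀ q : PrimeSpectrum R.obj, (p : R.obj) ∈ q.asIdeal →
        q ∈ Set.range (PrimeSpectrum.comap f.hom.hom.toRingHom)) :
    IsFppfCover (X := R) (I := Bool) (Y := fun b => b.rec (flatAway p R) Y)
      (fun b => b.rec (flatAwayHom p R) f) := by
  have h : (flatAwayHom p R).hom.hom.toRingHom =
    algebraMap R.obj (Localization.Away (p : R.obj)) := rfl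
  refine ⟨?_, ?_, fun q => ?_⟩
  · rintro (_ | _)
    · change (flatAwayHom p R).hom.hom.toRingHom.Flat
      rw [h, RingHom.flat_algebraMap_iff]
      exact IsLocalization.flat _ (Submonoid.powers (p : R.obj))
    · let := f.hom.hom.toRingHom.toAlgebra
      have : Algebra.Smooth R.obj Y.obj := hf
      exact Algebra.Smooth.flat R.obj Y.obj
  · rintro (_ | _)
    · change (flatAwayHom p R).hom.hom.toRingHom.FinitePresentation
      rw [h, RingHom.finitePresentation_algebraMap]
      exact IsLocalization.Away.finitePresentation (p : R.obj)
    · exact hf.finitePresentation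
  · by_cases hq : (p : R.obj) ∈ q.asIdeal
    · exact ⟨true, hs q hq⟩
    · refine ⟨false, ?_⟩
      change q ∈ Set.range (PrimeSpectrum.comap (flatAwayHom p R).hom.hom.toRingHom)
      rw [h, PrimeSpectrum.localization_away_comap_range _ (p : R.obj)]
      exact hq

/-- The isomorphism between the sheafification of `R ↦ K₁(R) \ 𝒢(R) μ(p) 𝒢(R) / K₁(R)` and the
sheaf `R ↦ (E_μ \ G²)(R / p)`. -/
theorem exists_crisSheaf_iso [IsNoetherianRing W] [Algebra.Smooth W H]
    (hp : (p : W) ∈ nonZeroDivisors W) :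
    ∃ Φ : crisSheaf p μ ≅ redFlat p W ⋙ zipSheaf p μ,
      ∀ (R : FlatAlg.{u} W) (g h : Pt W H R.obj),
        Φ.hom.app R (toSheafification _ _ (crisClass p μ R g h)) =
          zipClass p μ (A := (redFlat p W).obj R) ((ptRed p H R.obj g)⁻¹, ptRed p H R.obj h) := by
  let α (R : FlatAlg.{u} W) (x : (crisPresheaf p μ).obj R) :
      (redFlat p W ⋙ zipSheaf p μ).obj R :=
    toSheafification (kappaTop p W) (zipPresheaf p μ) (R := (redFlat p W).obj R)
      ((crisToZip p μ hp).app R x)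
  have nat : ∀ {R S : FlatAlg.{u} W} (f : R ⟶ S) (x : (crisPresheaf p μ).obj R),
      α S ((crisPresheaf p μ).map f x) = (redFlat p W ⋙ zipSheaf p μ).map f (α R x) := by
    intro R S f x
    refine Eq.trans ?_ (toSheafification_naturality (kappaTop p W) (zipPresheaf p μ)
      ((redFlat p W).map f) ((crisToZip p μ hp).app R x)).symm
    exact congrArg (toSheafification (kappaTop p W) (zipPresheaf p μ)
      (R := (redFlat p W).obj S)) (NatTrans.naturality_apply (crisToZip p μ hp) f x)
  obtain ⟨Φ, hΦ⟩ := exists_sheafification_iso (crisPresheaf p μ) (redFlat p W ⋙ zipSheaf p μ)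
    (isFppfSheaf_redFlat_comp p (isFppfSheaf_zipSheaf p μ)) α nat
    (fun R => (toSheafification_zip_injective p μ _).comp (crisToZip_injective p μ hp R))
    (by
      intro X z
      obtain ⟨Y, f, hf, hs, x, hx⟩ := exists_smooth_lift_zipClass p μ X z
      -- Over `R[1/p]` the target has only one section, so an arbitrary class serves there. The
      -- inverse on the first entry over `Y` undoes the one in the comparison map.
      refine ⟨Bool, inferInstance, _, _, isFppfCover_flatAway p f hf hs,
        fun b => b.rec (crisClass p μ _ 1 1) (crisClass p μ Y x.1⁻¹ x.2), ?_⟩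
      rintro (_ | _)
      · exact zipSheaf_eq_of_subsingleton p μ _ (subsingleton_redFlat_flatAway p X) _ _
      · refine hx.trans (congrArg (toSheafification (kappaTop p W) (zipPresheaf p μ)
          (R := (redFlat p W).obj Y))
          ((crisToZip_crisClass p μ hp Y x.1⁻¹ x.2).trans ?_).symm)
        rw [map_inv, inv_inv]
        rfl)
  refine ⟨Φ, fun R g h => (hΦ R _).trans ?_⟩
  exact congrArg (toSheafification (kappaTop p W) (zipPresheaf p μ)
    (R := (redFlat p W).obj R)) (crisToZip_crisClass p μ hp R g h)

end SheafComparison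

end

end CrisZip

namespace CrisZip

noncomputable section

/-! ### Double classes in the loop group -/

section LoopComparison

variable (p : ℕ) {W H : Type u} [CommRing W] [CommRing H] [HopfAlgebra W H]
  (μ : H →ₐc[W] W[T;T⁻¹])

lemma X_mem_nonZeroDivisors (A : Type u) [CommRing A] :
    (PowerSeries.X : A⟦X⟧) ∈ nonZeroDivisors A⟦X⟧ := by
  rw [mem_nonZeroDivisors_iff_right]
  intro x hx
  ext n
  rw [← PowerSeries.coeff_succ_mul_X, hx, map_zero, map_zero]

lemma tZero_X (A : Type u) [CommRing A] [Algebra W A] : tZero W A PowerSeries.X = 0 :=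
  PowerSeries.constantCoeff_X

lemma map_tZero_map_tConst {A : Type u} [CommRing A] [Algebra W A] (g : Pt W H A) :
    Pt.map H (tZero W A) (Pt.map H (tConst W A) g) = g := by
  apply WithConv.ofConv_injective
  ext f
  exact PowerSeries.constantCoeff_C _

lemma tConst_naturality {A B : Type u} [CommRing A] [Algebra W A] [CommRing B] [Algebra W B]
    (f : A →ₐ[W] B) : (PowerSeries.mapAlgHom f).comp (tConst W A) = (tConst W B).comp f := by
  ext a n
  change PowerSeries.coeff n (PowerSeries.map f.toRingHom (PowerSeries.C a)) =
    PowerSeries.coeff n (PowerSeries.C (f a))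
  rw [PowerSeries.map_C]
  rfl

/-- The general lifting lemma for the nonzerodivisor `t` of `A[[t]]`; the first entry lifts as a
constant. -/
lemma exists_degen_lift_X [Algebra.FormallySmooth W H] [Algebra.FiniteType W H]
    {A : Type u} [CommRing A] [Algebra W A] {x : Pt W H A × Pt W H A} (hx : x ∈ degen μ 0) :
    ∃ z ∈ degen μ (PowerSeries.X : A⟦X⟧),
      Pt.map H (tZero W A) z.1 = x.1 ∧ Pt.map H (tZero W A) z.2 = x.2 := by
  let m := Ideal.Quotient.mkₐ W (Ideal.span {(PowerSeries.X : A⟦X⟧)})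
  let e : (A⟦X⟧ ⧸ Ideal.span {(PowerSeries.X : A⟦X⟧)}) →ₐ[W] A :=
    Ideal.Quotient.liftₐ _ (tZero W A) fun a ha => by
      obtain ⟨b, rfl⟩ := Ideal.mem_span_singleton.mp ha
      rw [map_mul, tZero_X, zero_mul]
  have he : e.comp m = tZero W A := rfl
  obtain ⟨z, hz, h1, h2⟩ := exists_degen_lift μ (X_mem_nonZeroDivisors A)
    (Pt.map H (tConst W A) x.1) (degen_map μ (m.comp (tConst W A)) (map_zero _) hx)
  refine ⟨z, hz, ?_, ?_⟩
  · rw [← he, ← Pt.map_map, h1, Pt.map_map, he, map_tZero_map_tConst]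
  · rw [← he, ← Pt.map_map, h2, ← Pt.map_map, Pt.map_map, he, map_tZero_map_tConst]

lemma loopClass_eq_iff [Algebra.FormallySmooth W H] [Algebra.FiniteType W H]
    {A : KappaAlg.{u} p W} {g h g' h' : Pt W H A.obj⟦X⟧} :
    loopClass p μ A g h = loopClass p μ A g' h' ↔
      ZipQuot.mk μ ((Pt.map H (tZero W A.obj) g)⁻¹, Pt.map H (tZero W A.obj) h) =
        ZipQuot.mk μ ((Pt.map H (tZero W A.obj) g')⁻¹, Pt.map H (tZero W A.obj) h') := by
  have h0 : loopClass p μ A g h = loopClass p μ A g' h' ↔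
      ∃ k ∈ kerLoc H (PowerSeries.X : A.obj⟦X⟧) (tZero W A.obj),
      ∃ k' ∈ kerLoc H (PowerSeries.X : A.obj⟦X⟧) (tZero W A.obj),
        cellElt μ (PowerSeries.X : A.obj⟦X⟧) g' h' = k * cellElt μ PowerSeries.X g h * k' :=
    Quotient.eq
  rw [h0, exists_cellElt_eq_iff μ _ (X_mem_nonZeroDivisors A.obj), zipQuot_mk_eq_iff, Prod.inv_mk,
    Prod.mk_mul_mk, inv_inv]
  constructor
  · rintro ⟨z, hz, h1, h2⟩
    have := degen_map μ (tZero W A.obj) (tZero_X A.obj) hz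
    rwa [h1, h2] at this
  · exact fun hx => exists_degen_lift_X μ hx

lemma loopClass_map {A B : KappaAlg.{u} p W} (f : A ⟶ B) (g h : Pt W H A.obj⟦X⟧) :
    (loopPresheaf p μ).map f (loopClass p μ A g h) = loopClass p μ B
      (Pt.map H (PowerSeries.mapAlgHom f.hom.hom) g)
      (Pt.map H (PowerSeries.mapAlgHom f.hom.hom) h) :=
  congrArg (Quotient.mk _) (Subtype.ext (map_cellElt μ _ (mapAlgHom_X f.hom.hom) g h))

/-- The map `(x, y) ↦ x⁻¹ μ(t) y`. -/
def zipToLoop [Algebra.FormallySmooth W H] [Algebra.FiniteType W H] (A : KappaAlg.{u} p W) :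
    (zipPresheaf p μ).obj A → (loopPresheaf p μ).obj A :=
  Quotient.lift (fun x : Pt W H A.obj × Pt W H A.obj => loopClass p μ A
    (Pt.map H (tConst W A.obj) x.1⁻¹) (Pt.map H (tConst W A.obj) x.2)) (by
      intro x y e
      rw [loopClass_eq_iff]
      simp only [map_tZero_map_tConst, inv_inv]
      exact Quotient.sound e)

variable [Algebra.FormallySmooth W H] [Algebra.FiniteType W H]

lemma zipToLoop_mk (A : KappaAlg.{u} p W) (x : Pt W H A.obj × Pt W H A.obj) :
    zipToLoop p μ A (ZipQuot.mk μ x) = loopClass p μ A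
      (Pt.map H (tConst W A.obj) x.1⁻¹) (Pt.map H (tConst W A.obj) x.2) := rfl

lemma zipToLoop_injective (A : KappaAlg.{u} p W) : Function.Injective (zipToLoop p μ A) := by
  intro x y e
  obtain ⟨x, rfl⟩ : ∃ a, ZipQuot.mk μ a = x := Quotient.exists_rep x
  obtain ⟨y, rfl⟩ : ∃ a, ZipQuot.mk μ a = y := Quotient.exists_rep y
  rw [zipToLoop_mk, zipToLoop_mk, loopClass_eq_iff] at e
  simp only [map_tZero_map_tConst, inv_inv] at e
  exact e

/-- A point over `A[[t]]` and the constant point with the same value at `t = 0` differ by `L¹G`, so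
every class of an element `g μ(t) h` comes from constants. -/
lemma zipToLoop_eq (A : KappaAlg.{u} p W) (g h : Pt W H A.obj⟦X⟧) :
    zipToLoop p μ A (ZipQuot.mk μ ((Pt.map H (tZero W A.obj) g)⁻¹, Pt.map H (tZero W A.obj) h)) =
      loopClass p μ A g h := by
  rw [zipToLoop_mk, loopClass_eq_iff]
  simp only [map_tZero_map_tConst, inv_inv]

lemma zipToLoop_naturality {A B : KappaAlg.{u} p W} (f : A ⟶ B) (x : (zipPresheaf p μ).obj A) :
    zipToLoop p μ B ((zipPresheaf p μ).map f x) =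
      (loopPresheaf p μ).map f (zipToLoop p μ A x) := by
  obtain ⟨x, rfl⟩ : ∃ a, ZipQuot.mk μ a = x := Quotient.exists_rep x
  rw [zipToLoop_mk, loopClass_map, Pt.map_map, Pt.map_map, tConst_naturality, ← Pt.map_map,
    ← Pt.map_map, map_inv]
  exact zipToLoop_mk p μ B (pairMap f.hom.hom x)

end LoopComparison

/-! ### Composition of covers -/

section Refine

variable {W : Type u} [CommRing W] {P : ObjectProperty (CommAlgCat.{u} W)}

lemma IsFppfCover.sigma {X : P.FullSubcategory} {I : Type} {Y : I → P.FullSubcategory}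
    {f : ∀ i, X ⟶ Y i} (hf : IsFppfCover f) {J : I → Type} {Z : ∀ i, J i → P.FullSubcategory}
    {g : ∀ i j, Y i ⟶ Z i j} (hg : ∀ i, IsFppfCover (g i)) :
    IsFppfCover (X := X) (I := Σ i, J i) (Y := fun k => Z k.1 k.2)
      fun k => f k.1 ≫ g k.1 k.2 := by
  refine ⟨fun k => RingHom.Flat.comp (hf.flat k.1) ((hg k.1).flat k.2),
    fun k => RingHom.FinitePresentation.comp ((hg k.1).finitePresentation k.2)
      (hf.finitePresentation k.1), fun q => ?_⟩
  obtain ⟨i, q', rfl⟩ := hf.surjective q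
  obtain ⟨j, q'', rfl⟩ := (hg i).surjective q'
  exact ⟨⟨i, j⟩, q'', rfl⟩

end Refine

/-! ### The quotient sheaf of the loop cell -/

section LoopSheaf

variable (p : ℕ) {W H : Type u} [CommRing W] [CommRing H] [HopfAlgebra W H]
  (μ : H →ₐc[W] W[T;T⁻¹])

lemma isFppfSheaf_loopSheaf :
    IsFppfSheaf (fun f hR _ => IsKappaAlg.of_hom p W f hR) (loopSheaf p μ) :=
  isFppfSheaf_sheafification _

variable [Algebra.FormallySmooth W H] [Algebra.FiniteType W H]

/-- An element of `𝒞^μ` factors as `g μ(t) h` only locally, which is why a cover is needed. -/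
lemma exists_cover_zipToLoop {X : KappaAlg.{u} p W} (z : (loopPresheaf p μ).obj X) :
    ∃ (I : Type) (_ : Finite I) (Y : I → KappaAlg.{u} p W) (f : ∀ i, X ⟶ Y i)
      (_ : IsFppfCover f) (x : ∀ i, (zipPresheaf p μ).obj (Y i)),
      ∀ i, (loopPresheaf p μ).map (f i) z = zipToLoop p μ (Y i) (x i) := by
  obtain ⟨⟨z, 𝒮, ⟨I, hI, Y, f, hf, hs, hm⟩, h𝒮⟩, rfl⟩ := Quotient.exists_rep z
  choose g h hgh using fun i => h𝒮 (f i) (hm i)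
  refine ⟨I, hI, Y, f, ⟨fun i => (hf i).1, fun i => (hf i).2, hs⟩, fun i => ZipQuot.mk μ
    ((Pt.map H (tZero W (Y i).obj) (g i))⁻¹, Pt.map H (tZero W (Y i).obj) (h i)), fun i => ?_⟩
  rw [zipToLoop_eq]
  exact congrArg (Quotient.mk _) (Subtype.ext (hgh i))

/-- The isomorphism between `E_μ \ G²` and `L¹G \ 𝒞^μ / L¹G`. -/
theorem exists_zipSheaf_iso_loopSheaf :
    ∃ Θ : zipSheaf p μ ≅ loopSheaf p μ, ∀ (A : KappaAlg.{u} p W) (x y : Pt W H A.obj),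
      Θ.hom.app A (zipClass p μ (x, y)) = toSheafification (kappaTop p W) (loopPresheaf p μ)
        (loopClass p μ A (Pt.map H (tConst W A.obj) x⁻¹) (Pt.map H (tConst W A.obj) y)) := by
  let α (A : KappaAlg.{u} p W) (x : (zipPresheaf p μ).obj A) : (loopSheaf p μ).obj A :=
    toSheafification (kappaTop p W) (loopPresheaf p μ) (zipToLoop p μ A x)
  have nat : ∀ {A B : KappaAlg.{u} p W} (f : A ⟶ B) (x : (zipPresheaf p μ).obj A),
      α B ((zipPresheaf p μ).map f x) = (loopSheaf p μ).map f (α A x) := by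
    intro A B f x
    refine Eq.trans ?_ (toSheafification_naturality (kappaTop p W) (loopPresheaf p μ)
      f (zipToLoop p μ A x)).symm
    exact congrArg (toSheafification (kappaTop p W) (loopPresheaf p μ))
      (zipToLoop_naturality p μ f x)
  -- Equality in the loop sheaf gives equality of loop classes on a cover, hence of zip classes
  -- there; that the zip presheaf is separated brings this back to `A`.
  have inj : ∀ A, Function.Injective (α A) := by
    intro A x y e
    obtain ⟨I, _, Y, f, hf, hxy⟩ := exists_cover_of_toSheafification_eq _ e
    apply toSheafification_zip_injective p μ A
    refine (isFppfSheaf_zipSheaf p μ).eq_of_cover hf fun i => ?_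
    refine (toSheafification_naturality (kappaTop p W) (zipPresheaf p μ) (f i) x).trans
      (Eq.trans ?_ (toSheafification_naturality (kappaTop p W) (zipPresheaf p μ) (f i) y).symm)
    refine congrArg (toSheafification (kappaTop p W) (zipPresheaf p μ))
      (zipToLoop_injective p μ (Y i) ?_)
    rw [zipToLoop_naturality, zipToLoop_naturality]
    exact hxy i
  obtain ⟨Θ, hΘ⟩ := exists_sheafification_iso (zipPresheaf p μ) (loopSheaf p μ)
    (isFppfSheaf_loopSheaf p μ) α nat inj (by
      intro X z
      obtain ⟨I, _, Y, f, hf, x, hx⟩ := exists_cover_toSheafification _ z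
      choose J hJ Z g hg y hy using fun i => exists_cover_zipToLoop p μ (x i)
      refine ⟨Σ i, J i, inferInstance, _, _, hf.sigma hg, fun k => y k.1 k.2, fun k => ?_⟩
      rw [Functor.map_comp_apply]
      refine (congrArg ((loopSheaf p μ).map (g k.1 k.2)) (hx k.1)).trans ?_
      refine (toSheafification_naturality (kappaTop p W) (loopPresheaf p μ) _ _).trans ?_
      exact congrArg (toSheafification (kappaTop p W) (loopPresheaf p μ)) (hy k.1 k.2))
  exact ⟨Θ, fun A x y => hΘ A (ZipQuot.mk μ (x, y))⟩

end LoopSheaf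

end

end CrisZip

namespace CrisZip

noncomputable section

/-! ### Completions of smooth algebras over crystalline algebras -/

section Completion

variable (p : ℕ) (Y : Type u) [CommRing Y]

/-- The `p`-adic completion. -/
abbrev PCompletion : Type u := AdicCompletion (Ideal.span {(p : Y)}) Y

variable {Y}

lemma evalₐ_eq_mk_of_le {x : PCompletion p Y} {m n : ℕ} (hmn : m ≤ n) {y : Y}
    (h : AdicCompletion.evalₐ (Ideal.span {(p : Y)}) n x = Ideal.Quotient.mk _ y) :
    AdicCompletion.evalₐ (Ideal.span {(p : Y)}) m x = Ideal.Quotient.mk _ y := by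
  obtain ⟨x, rfl⟩ := AdicCompletion.mk_surjective _ _ x
  rw [AdicCompletion.evalₐ_mk] at h ⊢
  rw [← AdicCompletion.Ideal.mk_eq_mk _ hmn, Ideal.Quotient.eq]
  exact Ideal.pow_le_pow_right hmn (Ideal.Quotient.eq.mp h)

lemma map_span_natCast {A B : Type u} [CommRing A] [CommRing B] (f : A →+* B) :
    (Ideal.span {(p : A)}).map f = Ideal.span {(p : B)} := by
  rw [Ideal.map_span, Set.image_singleton, map_natCast]

variable (Y) in
lemma isAdicComplete_pCompletion :
    IsAdicComplete (Ideal.span {(p : PCompletion p Y)}) (PCompletion p Y) := by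
  have := AdicCompletion.isAdicComplete_self (Ideal.span {(p : Y)})
    (Submodule.fg_span_singleton (p : Y))
  rwa [map_span_natCast] at this

lemma exists_sub_mem_span (x : PCompletion p Y) :
    ∃ y : Y, x - algebraMap Y (PCompletion p Y) y ∈ Ideal.span {(p : PCompletion p Y)} := by
  obtain ⟨y, hy⟩ := Ideal.Quotient.mk_surjective (AdicCompletion.evalOneₐ (Ideal.span {(p : Y)}) x)
  refine ⟨y, ?_⟩
  rw [← map_span_natCast p (algebraMap Y (PCompletion p Y)),
    ← AdicCompletion.ker_evalOneₐ_eq_map _ (Submodule.fg_span_singleton (p : Y)),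
    RingHom.mem_ker]
  change AdicCompletion.evalOneₐ (Ideal.span {(p : Y)}) (x - algebraMap Y (PCompletion p Y) y) = 0
  rw [map_sub, ← hy, AlgHom.commutes]
  exact sub_self _

lemma mem_span_of_algebraMap_mem {y : Y}
    (h : algebraMap Y (PCompletion p Y) y ∈ Ideal.span {(p : PCompletion p Y)}) :
    y ∈ Ideal.span {(p : Y)} := by
  rw [← map_span_natCast p (algebraMap Y (PCompletion p Y)),
    ← AdicCompletion.ker_evalOneₐ_eq_map _ (Submodule.fg_span_singleton (p : Y)),
    RingHom.mem_ker] at h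
  change AdicCompletion.evalOneₐ (Ideal.span {(p : Y)}) (algebraMap Y (PCompletion p Y) y) = 0 at h
  rw [AlgHom.commutes] at h
  exact Ideal.Quotient.eq_zero_iff_mem.mp h

/-- If `p x = 0` and `y` represents `x` modulo `p ^ (n + 1)`, then `p y` is divisible by `p ^ (n +
1)`, so `y` is divisible by `p ^ n` and `x` vanishes modulo `p ^ n`. -/
lemma pCompletion_regular (hY : (p : Y) ∈ nonZeroDivisors Y) :
    (p : PCompletion p Y) ∈ nonZeroDivisors (PCompletion p Y) := by
  rw [mem_nonZeroDivisors_iff_right]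
  intro x hx
  refine AdicCompletion.ext_evalₐ fun n => ?_
  obtain ⟨y, hy⟩ := Ideal.Quotient.mk_surjective
    (AdicCompletion.evalₐ (Ideal.span {(p : Y)}) (n + 1) x)
  have h := congrArg (AdicCompletion.evalₐ (Ideal.span {(p : Y)}) (n + 1)) hx
  rw [map_mul, ← hy, map_natCast, map_zero, ← map_natCast (Ideal.Quotient.mk _), ← map_mul,
    Ideal.Quotient.eq_zero_iff_mem, Ideal.span_singleton_pow, Ideal.mem_span_singleton] at h
  obtain ⟨c, hc⟩ := h
  rw [evalₐ_eq_mk_of_le p n.le_succ hy.symm, map_zero, Ideal.Quotient.eq_zero_iff_mem,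
    Ideal.span_singleton_pow, Ideal.mem_span_singleton]
  refine ⟨c, (mul_cancel_right_mem_nonZeroDivisors hY).mp ?_⟩
  rw [hc]
  ring

lemma exists_pCompletion_lift {T : Type u} [CommRing T] [IsAdicComplete (Ideal.span {(p : T)}) T]
    (ψ : Y →+* T) : ∃ Ψ : PCompletion p Y →+* T, ∀ y, Ψ (algebraMap Y _ y) = ψ y := by
  let I : Ideal T := Ideal.span {(p : T)}
  have hle : ∀ n, Ideal.span {(p : Y)} ^ n ≤ (I ^ n).comap ψ := fun n => by
    rw [← Ideal.map_le_iff_le_comap, Ideal.map_pow, map_span_natCast]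
  let f (n : ℕ) : PCompletion p Y →+* T ⧸ I ^ n := (Ideal.quotientMap (I ^ n) ψ (hle n)).comp
    (AdicCompletion.evalₐ (Ideal.span {(p : Y)}) n).toRingHom
  have hf : ∀ n x y, AdicCompletion.evalₐ (Ideal.span {(p : Y)}) n x = Ideal.Quotient.mk _ y →
      f n x = Ideal.Quotient.mk _ (ψ y) := fun n x y h => by
    change Ideal.quotientMap (I ^ n) ψ (hle n) (AdicCompletion.evalₐ _ n x) = _
    rw [h, Ideal.quotientMap_mk]
  let Ψ := IsAdicComplete.liftRingHom I f (by
    intro m n hmn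
    ext x
    obtain ⟨y, hy⟩ := Ideal.Quotient.mk_surjective
      (AdicCompletion.evalₐ (Ideal.span {(p : Y)}) n x)
    rw [RingHom.comp_apply, hf n x y hy.symm, hf m x y (evalₐ_eq_mk_of_le p hmn hy.symm)]
    rfl)
  refine ⟨Ψ, fun y => ?_⟩
  refine (IsHausdorff.eq_iff_smodEq (I := I)).mpr fun n => ?_
  rw [SModEq.sub_mem, smul_eq_mul, Ideal.mul_top, ← Ideal.Quotient.eq,
    IsAdicComplete.mk_liftRingHom]
  exact hf n _ y (AlgHom.commutes _ _)

/-- The completion of a formally smooth algebra inherits a Frobenius lift. -/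
lemma exists_frobenius_pCompletion {R : Type u} [CommRing R] [Algebra R Y] [Fact p.Prime]
    [Algebra.FormallySmooth R Y] (φ : R →+* R) (hφ : ∀ x, φ x - x ^ p ∈ Ideal.span {(p : R)}) :
    ∃ Ψ : PCompletion p Y →+* PCompletion p Y,
      ∀ x, Ψ x - x ^ p ∈ Ideal.span {(p : PCompletion p Y)} := by
  have hc := isAdicComplete_pCompletion p Y
  let I := Ideal.span {(p : PCompletion p Y)}
  have hchar : (p : PCompletion p Y ⧸ I) = 0 := natCast_quotient_eq_zero p _
  have hmk : ∀ z w, z - w ∈ I ↔ Ideal.Quotient.mk I z = Ideal.Quotient.mk I w := fun z w =>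
    Ideal.Quotient.eq.symm
  rcases subsingleton_or_nontrivial (PCompletion p Y ⧸ I) with h | h
  · exact ⟨RingHom.id _, fun x => (hmk _ _).mpr (Subsingleton.elim _ _)⟩
  have : CharP (PCompletion p Y ⧸ I) p := (CharP.charP_iff_prime_eq_zero Fact.out).mpr hchar
  let ι := algebraMap Y (PCompletion p Y)
  -- The structure map is twisted by `φ`. Then the Frobenius of the reduction is `R`-linear, and
  -- formal smoothness of `Y` over `R` lifts it to the complete ring.
  let : Algebra R (PCompletion p Y) := (ι.comp ((algebraMap R Y).comp φ)).toAlgebra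
  let F : Y →ₐ[R] PCompletion p Y ⧸ I :=
    { (frobenius (PCompletion p Y ⧸ I) p).comp ((Ideal.Quotient.mk I).comp ι) with
      commutes' := fun r => by
        change Ideal.Quotient.mk I (ι (algebraMap R Y r)) ^ p =
          Ideal.Quotient.mk I (ι (algebraMap R Y (φ r)))
        rw [← map_pow, eq_comm, ← hmk]
        obtain ⟨c, hc⟩ := Ideal.mem_span_singleton.mp (hφ r)
        rw [← map_pow, ← map_pow, ← map_sub, ← map_sub, hc, map_mul, map_mul, map_natCast,
          map_natCast]
        exact Ideal.mul_mem_right _ _ (Ideal.mem_span_singleton_self _) }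
  obtain ⟨ψ, hψ⟩ := Algebra.FormallySmooth.exists_mkₐ_comp_eq_of_isAdicComplete F
  obtain ⟨Ψ, hΨ⟩ := exists_pCompletion_lift p ψ.toRingHom
  refine ⟨Ψ, fun x => (hmk _ _).mpr ?_⟩
  obtain ⟨y, hy⟩ := exists_sub_mem_span p x
  have h1 : Ideal.Quotient.mk I (Ψ x) = Ideal.Quotient.mk I (Ψ (ι y)) := by
    rw [← hmk, ← map_sub]
    obtain ⟨c, hc⟩ := Ideal.mem_span_singleton.mp hy
    rw [hc, map_mul, map_natCast]
    exact Ideal.mul_mem_right _ _ (Ideal.mem_span_singleton_self _)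
  rw [h1, hΨ, map_pow, (hmk _ _).mp hy]
  exact DFunLike.congr_fun hψ y

end Completion

end

end CrisZip

namespace CrisZip

noncomputable section

/-! ### Crystalline algebras from smooth algebras -/

section CrisCompletion

variable (p : ℕ) {W : Type u} [CommRing W]

/-- Over a discrete valuation ring flatness is torsion-freeness, and every nonzero element is a unit
times a power of the uniformizer `p`. -/
lemma flat_of_natCast_mem_nonZeroDivisors [IsDomain W] [IsDiscreteValuationRing W]
    (hp : Irreducible (p : W)) (A : Type u) [CommRing A] [Algebra W A]
    (hA : (p : A) ∈ nonZeroDivisors A) : Module.Flat W A := by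
  have : Module.IsTorsionFree W A := by
    refine ⟨fun r hr => ?_⟩
    obtain ⟨n, v, rfl⟩ := IsDiscreteValuationRing.eq_unit_mul_pow_irreducible hr.ne_zero hp
    have h1 : (p : A) ^ n ∈ nonZeroDivisors A := pow_mem hA n
    intro x y hxy
    simp only [Algebra.smul_def, map_mul, map_pow, map_natCast, mul_assoc] at hxy
    have h2 := (v.isUnit.map (algebraMap W A)).mul_left_cancel hxy
    exact (mul_cancel_left_mem_nonZeroDivisors h1).mp h2
  infer_instance

/-- The completion of a smooth algebra over a crystalline algebra is crystalline. -/
lemma exists_crisW_completion [Fact p.Prime] [IsDomain W] [IsDiscreteValuationRing W]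
    (hp : Irreducible (p : W)) (R : CrisW.{u} p W) (Y : Type u) [CommRing Y] [Algebra R.obj Y]
    [Algebra W Y] [IsScalarTower W R.obj Y] [Algebra.Smooth R.obj Y] :
    ∃ (R₁ : CrisW.{u} p W) (ι : Y →ₐ[W] R₁.obj),
      (∀ x, ∃ y, x - ι y ∈ Ideal.span {(p : R₁.obj)}) ∧
      (∀ y, ι y ∈ Ideal.span {(p : R₁.obj)} → y ∈ Ideal.span {(p : Y)}) ∧
      ∀ (T : CrisW.{u} p W) (ψ : Y →ₐ[W] T.obj),
        ∃ Ψ : R₁.obj →ₐ[W] T.obj, ∀ y, Ψ (ι y) = ψ y := by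
  obtain ⟨hflat, -, φ, hφ⟩ := R.property
  have : Module.Flat W R.obj := hflat
  have : Module.Flat R.obj Y := Algebra.Smooth.flat R.obj Y
  have : Module.Flat W Y := Module.Flat.trans W R.obj Y
  have hpY := natCast_mem_nonZeroDivisors p (mem_nonZeroDivisors_of_ne_zero hp.ne_zero) Y
  have e : ∀ w, algebraMap W (PCompletion p Y) w = algebraMap Y _ (algebraMap W Y w) :=
    fun w => rfl
  refine ⟨⟨CommAlgCat.of W (PCompletion p Y),
    flat_of_natCast_mem_nonZeroDivisors p hp _ (pCompletion_regular p hpY),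
    isAdicComplete_pCompletion p Y, exists_frobenius_pCompletion p φ hφ⟩,
    { algebraMap Y (PCompletion p Y) with commutes' := fun w => (e w).symm },
    exists_sub_mem_span p, fun y hy => mem_span_of_algebraMap_mem p hy, fun T ψ => ?_⟩
  have : IsAdicComplete (Ideal.span {(p : T.obj)}) T.obj := T.property.2.1
  obtain ⟨Ψ, hΨ⟩ := exists_pCompletion_lift p ψ.toRingHom
  refine ⟨{ Ψ with commutes' := fun w => ?_ }, hΨ⟩
  change Ψ (algebraMap W (PCompletion p Y) w) = _
  rw [e, hΨ]
  exact ψ.commutes w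

end CrisCompletion

/-! ### Refining covers by reductions of crystalline algebras -/

section Red

variable (p : ℕ) {W : Type u} [CommRing W]

/-- The homomorphism of reductions modulo `p` induced by a homomorphism. -/
abbrev redHom {A B : Type u} [CommRing A] [Algebra W A] [CommRing B] [Algebra W B]
    (f : A →ₐ[W] B) : (A ⧸ Ideal.span {(p : A)}) →ₐ[W] (B ⧸ Ideal.span {(p : B)}) :=
  ((modP p W).map (CommAlgCat.ofHom f)).hom

/-- The reduction of a map into the completion is an isomorphism. -/
lemma exists_redHom_inverse {A B : Type u} [CommRing A] [Algebra W A] [CommRing B] [Algebra W B]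
    (f : A →ₐ[W] B) (h1 : ∀ x, ∃ y, x - f y ∈ Ideal.span {(p : B)})
    (h2 : ∀ y, f y ∈ Ideal.span {(p : B)} → y ∈ Ideal.span {(p : A)}) :
    ∃ g : (B ⧸ Ideal.span {(p : B)}) →ₐ[W] (A ⧸ Ideal.span {(p : A)}),
      ∀ a, g (redHom p f a) = a := by
  have hb : Function.Bijective (redHom p f) := by
    constructor
    · rw [injective_iff_map_eq_zero]
      intro a ha
      obtain ⟨a, rfl⟩ := Ideal.Quotient.mk_surjective a
      exact Ideal.Quotient.eq_zero_iff_mem.mpr (h2 a (Ideal.Quotient.eq_zero_iff_mem.mp ha))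
    · intro b
      obtain ⟨b, rfl⟩ := Ideal.Quotient.mk_surjective b
      obtain ⟨a, ha⟩ := h1 b
      exact ⟨Ideal.Quotient.mk _ a, (Ideal.Quotient.eq.mpr ha).symm⟩
  exact ⟨(AlgEquiv.ofBijective _ hb).symm, (AlgEquiv.ofBijective _ hb).symm_apply_apply⟩

/-- A smooth cover of the reduction of a crystalline algebra can be refined to the reduction of a
crystalline algebra. -/
lemma exists_crisW_refinement [Fact p.Prime] [IsDomain W] [IsDiscreteValuationRing W]
    (hp : Irreducible (p : W)) (S : CrisW.{u} p W) (Q : Type u) [CommRing Q]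
    [Algebra (S.obj ⧸ Ideal.span {(p : S.obj)}) Q] [Algebra W Q]
    [IsScalarTower W (S.obj ⧸ Ideal.span {(p : S.obj)}) Q]
    [Algebra.Smooth (S.obj ⧸ Ideal.span {(p : S.obj)}) Q]
    (hQ : Function.Surjective
      (PrimeSpectrum.comap (algebraMap (S.obj ⧸ Ideal.span {(p : S.obj)}) Q))) :
    ∃ (S₁ : CrisW.{u} p W) (b : S.obj →ₐ[W] S₁.obj)
      (c : Q →ₐ[W] S₁.obj ⧸ Ideal.span {(p : S₁.obj)}),
      (∀ x, c (algebraMap _ Q x) = redHom p b x) ∧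
      ∃ (V : FlatAlg.{u} W) (j : (crisWIncl p W).obj S ⟶ V)
        (_ : IsFppfCover fun _ : Unit => (redFlat p W).map j)
        (g : (S₁.obj ⧸ Ideal.span {(p : S₁.obj)}) →ₐ[W] (V.obj ⧸ Ideal.span {(p : V.obj)})),
        g.comp (redHom p b) = redHom p j.hom.hom := by
  let Sb := S.obj ⧸ Ideal.span {(p : S.obj)}
  let : Algebra S.obj Q := ((algebraMap Sb Q).comp (Ideal.Quotient.mk _)).toAlgebra
  have : IsScalarTower S.obj Sb Q := IsScalarTower.of_algebraMap_eq' rfl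
  have : IsScalarTower W S.obj Q := IsScalarTower.of_algebraMap_eq' (by
    rw [IsScalarTower.algebraMap_eq W Sb Q]
    rfl)
  have : Algebra.FiniteType S.obj Q := Algebra.FiniteType.trans (S := Sb) inferInstance inferInstance
  obtain ⟨n, π, hπ⟩ := Algebra.FiniteType.iff_quotient_mvPolynomial''.mp this
  have : Algebra.Smooth S.obj (MvPolynomial (Fin n) S.obj) := ⟨inferInstance, inferInstance⟩
  obtain ⟨Y, _, _, hY, -, σ, τ, -⟩ := exists_smooth_lift_mod p π hπ
  let : Algebra W Y := ((algebraMap S.obj Y).comp (algebraMap W S.obj)).toAlgebra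
  have : IsScalarTower W S.obj Y := IsScalarTower.of_algebraMap_eq' rfl
  have : Module.Flat W S.obj := S.property.1
  have : Module.Flat S.obj Y := Algebra.Smooth.flat S.obj Y
  obtain ⟨S₁, ι, h1, h2, -⟩ := exists_crisW_completion p hp S Y
  obtain ⟨g, hg⟩ := exists_redHom_inverse p ι h1 h2
  let V : FlatAlg.{u} W := ⟨CommAlgCat.of W Y, Module.Flat.trans W S.obj Y⟩
  let j : (crisWIncl p W).obj S ⟶ V :=
    ObjectProperty.homMk (CommAlgCat.ofHom (IsScalarTower.toAlgHom W S.obj Y))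
  have hsm : (algebraMap S.obj Y).Smooth := RingHom.smooth_algebraMap.mpr hY
  have hfl : (algebraMap S.obj Y).Flat := RingHom.flat_algebraMap_iff.mpr inferInstance
  have hσ : ∀ q : PrimeSpectrum Q,
      PrimeSpectrum.comap (algebraMap S.obj Y) (PrimeSpectrum.comap σ.toRingHom q) =
        PrimeSpectrum.comap (Ideal.Quotient.mk _) (PrimeSpectrum.comap (algebraMap Sb Q) q) := by
    intro q
    rw [← PrimeSpectrum.comap_comp_apply, σ.toRingHom_eq_coe, σ.comp_algebraMap]
    rfl
  -- The crystalline algebra is the completion of `Y`, while the cover uses `Y` itself, which is of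
  -- finite presentation over `S`. Their reductions agree through `g`.
  refine ⟨S₁, ι.comp (IsScalarTower.toAlgHom W S.obj Y),
    (redHom p ι).comp (τ.restrictScalars W), ?_, V, j,
    ⟨fun _ => flat_redFlat (f := j) p hfl,
      fun _ => finitePresentation_redFlat (f := j) p hsm.finitePresentation,
      fun q => ⟨(), ?_⟩⟩, g, ?_⟩
  · intro x
    obtain ⟨x, rfl⟩ := Ideal.Quotient.mk_surjective x
    exact congrArg (redHom p ι) (τ.commutes x)
  · obtain ⟨q', rfl⟩ := hQ q
    exact mem_range_comap_redFlat (f := j) p ⟨PrimeSpectrum.comap σ.toRingHom q', hσ q'⟩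
  · ext x
    obtain ⟨x, rfl⟩ := Ideal.Quotient.mk_surjective x
    exact hg (Ideal.Quotient.mk _ (algebraMap S.obj Y x))

/-- A smooth cover can be transported along a homomorphism to the reduction of a crystalline
algebra, and refined to the reduction of a crystalline algebra. -/
lemma exists_crisW_cover [Fact p.Prime] [IsDomain W] [IsDiscreteValuationRing W]
    (hp : Irreducible (p : W)) (S : CrisW.{u} p W) {A B : Type u} [CommRing A] [Algebra W A]
    [CommRing B] [Algebra W B] (k : A →ₐ[W] B) (hk : k.toRingHom.Smooth)
    (hk' : Function.Surjective (PrimeSpectrum.comap k.toRingHom))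
    (f : A →ₐ[W] S.obj ⧸ Ideal.span {(p : S.obj)}) :
    ∃ (S₁ : CrisW.{u} p W) (b : S.obj →ₐ[W] S₁.obj)
      (c : B →ₐ[W] S₁.obj ⧸ Ideal.span {(p : S₁.obj)}),
      c.comp k = (redHom p b).comp f ∧
      ∃ (V : FlatAlg.{u} W) (j : (crisWIncl p W).obj S ⟶ V)
        (_ : IsFppfCover fun _ : Unit => (redFlat p W).map j)
        (g : (S₁.obj ⧸ Ideal.span {(p : S₁.obj)}) →ₐ[W] (V.obj ⧸ Ideal.span {(p : V.obj)})),
        g.comp (redHom p b) = redHom p j.hom.hom := by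
  let : Algebra A B := k.toRingHom.toAlgebra
  let : Algebra A (S.obj ⧸ Ideal.span {(p : S.obj)}) := f.toRingHom.toAlgebra
  have : IsScalarTower W A (S.obj ⧸ Ideal.span {(p : S.obj)}) :=
    IsScalarTower.of_algebraMap_eq' f.comp_algebraMap.symm
  have : IsScalarTower W A B := IsScalarTower.of_algebraMap_eq' k.comp_algebraMap.symm
  have : Algebra.Smooth A B := hk
  -- The base change of the smooth cover along `f` is a smooth cover of the reduction of `S`, to
  -- which the refinement applies.
  let Q := (S.obj ⧸ Ideal.span {(p : S.obj)}) ⊗[A] B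
  obtain ⟨S₁, b, c, hc, hV⟩ := exists_crisW_refinement p hp S Q
    (fun q => mem_range_comap_includeLeft q (hk' _))
  refine ⟨S₁, b, c.comp ((Algebra.TensorProduct.includeRight : B →ₐ[A] Q).restrictScalars W),
    ?_, hV⟩
  ext x
  refine Eq.trans ?_ (hc (f x))
  exact congrArg c ((Algebra.TensorProduct.includeRight : B →ₐ[A] Q).commutes x)

end Red

end

end CrisZip

namespace CrisZip

noncomputable section

/-! ### Uniqueness of the reduction -/

section Uniqueness

variable {Y Z : Type (u + 1)} [Category.{u} Y] [Category.{u} Z] {red : Y ⥤ Z}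
  {G G' : Z ⥤ Type (u + 1)} (η : red ⋙ G' ≅ red ⋙ G)

/-- An isomorphism of restrictions along a functor commutes with morphisms that can be lifted
locally. -/
lemma naturality_of_lift {R S R₀ R₁ S₁ : Y} (r : R ⟶ R₁) (b : S ⟶ S₁) (a : R₀ ⟶ R₁)
    (d : R₀ ⟶ S₁) (f : red.obj R ⟶ red.obj S) (c : red.obj R₁ ⟶ red.obj S₁)
    (h1 : red.map r ≫ c = f ≫ red.map b) (h2 : red.map a ≫ c = red.map d)
    (x : G'.obj (red.obj R)) (v : G.obj (red.obj R₀))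
    (hv : G.map (red.map a) v = G.map (red.map r) (η.hom.app R x))
    (hb : Function.Injective (G.map (red.map b))) :
    η.hom.app S (G'.map f x) = G.map f (η.hom.app R x) := by
  have nat : ∀ {A B : Y} (g : A ⟶ B) (z : G'.obj (red.obj A)),
      η.hom.app B (G'.map (red.map g) z) = G.map (red.map g) (η.hom.app A z) :=
    fun g z => NatTrans.naturality_apply η.hom g z
  obtain ⟨w, rfl⟩ : ∃ w, η.hom.app R₀ w = v :=
    -- Since `η` is an isomorphism over `R₀`, the section `v` comes from `G'`, and there it has the
    -- same image over `R₁` as `x`.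
    ⟨η.inv.app R₀ v, by rw [← NatTrans.comp_app_apply, η.inv_hom_id]; rfl⟩
  have hw : G'.map (red.map a) w = G'.map (red.map r) x := by
    have hinj : Function.Injective (η.hom.app R₁) :=
      ((isIso_iff_bijective _).mp inferInstance).1
    apply hinj
    rw [nat, nat, hv]
  -- Over `S₁`, applying `f` becomes applying `c` to a section that comes from `R₀`. There `c` may
  -- be replaced by the liftable morphism `d`, with which `η` commutes.
  apply hb
  rw [← nat, ← Functor.map_comp_apply, ← h1, Functor.map_comp_apply, ← hw,
    ← Functor.map_comp_apply, h2, nat, ← h2, Functor.map_comp_apply, hv, ← Functor.map_comp_apply,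
    h1, Functor.map_comp_apply]

/-- An isomorphism of restrictions along an essentially surjective functor that commutes with all
morphisms comes from an isomorphism. -/
lemma nonempty_iso_of_naturality [red.EssSurj]
    (h : ∀ {R S : Y} (f : red.obj R ⟶ red.obj S) (x : G'.obj (red.obj R)),
      η.hom.app S (G'.map f x) = G.map f (η.hom.app R x)) : Nonempty (G' ≅ G) := by
  refine ⟨NatIso.ofComponents (fun z => G'.mapIso (red.objObjPreimageIso z).symm ≪≫
    η.app (red.objPreimage z) ≪≫ G.mapIso (red.objObjPreimageIso z)) fun {z w} f => ?_⟩
  ext x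
  let e := red.objObjPreimageIso z
  let e' := red.objObjPreimageIso w
  have key := h (e.hom ≫ f ≫ e'.inv) (G'.map e.inv x)
  change G.map e'.hom (η.hom.app _ (G'.map e'.inv (G'.map f x))) =
    G.map f (G.map e.hom (η.hom.app _ (G'.map e.inv x)))
  have h1 : G'.map e'.inv (G'.map f x) = G'.map (e.hom ≫ f ≫ e'.inv) (G'.map e.inv x) := by
    simp only [← Functor.map_comp_apply, Iso.inv_hom_id_assoc]
  rw [h1, key]
  simp only [← Functor.map_comp_apply, Category.assoc, Iso.inv_hom_id, Category.comp_id]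

end Uniqueness

/-! ### Essential surjectivity of the reduction map -/

section EssSurj

variable (p : ℕ) {W : Type u} [CommRing W]

instance : (redCris p W).EssSurj where
  mem_essImage Z := by
    obtain ⟨R, hR, ⟨e⟩⟩ := Z.property
    exact ⟨⟨R, hR⟩, ⟨(IsCrisKappa p W).fullyFaithfulι.preimageIso (CommAlgCat.isoMk e)⟩⟩

end EssSurj

/-! ### Smoothness of reductions -/

section Smooth

variable (p : ℕ) {W : Type u} [CommRing W]

lemma smooth_redFlat {R S : FlatAlg.{u} W} {f : R ⟶ S} (hf : f.hom.hom.toRingHom.Smooth) :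
    ((redFlat p W).map f).hom.hom.toRingHom.Smooth := by
  let := f.hom.hom.toRingHom.toAlgebra
  rw [redFlat_map_eq]
  exact RingHom.Smooth.respectsIso.1 _ _
    (RingHom.Smooth.isStableUnderBaseChange.tensorProduct (R.obj ⧸ Ideal.span {(p : R.obj)}) hf)

end Smooth

/-! ### Naturality for homomorphisms of reductions -/

section ZipNaturality

variable (p : ℕ) {W H : Type u} [CommRing W] [CommRing H] [HopfAlgebra W H]
  (μ : H →ₐc[W] W[T;T⁻¹])

/-- The morphism `f` need not lift to `W_cris`. After refining both sides, the section is pulled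
back from the universal pair of points, over the completion `R₀` of `H ⊗ H`. Homomorphisms from the
reduction of `R₀` lift, since `H ⊗ H` is smooth over `W` and the targets are complete. The
hypothesis `hW` makes `R₀` crystalline. -/
theorem zip_naturality [Fact p.Prime] [IsDomain W] [IsDiscreteValuationRing W]
    [Algebra.Smooth W H] (hp : Irreducible (p : W)) (hW : IsCrisW p W (CommAlgCat.of W W))
    {G' : CrisKappa.{u} p W ⥤ Type (u + 1)}
    (η : redCris p W ⋙ G' ≅ redCris p W ⋙ crisKappaIncl p W ⋙ zipSheaf p μ)
    {R S : CrisW.{u} p W} (f : (redCris p W).obj R ⟶ (redCris p W).obj S)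
    (x : G'.obj ((redCris p W).obj R)) :
    η.hom.app S (G'.map f x) = (crisKappaIncl p W ⋙ zipSheaf p μ).map f (η.hom.app R x) := by
  obtain ⟨Y, k, hk, hs, y, hy⟩ := exists_smooth_lift_zipClass p μ ((crisWIncl p W).obj R)
    (η.hom.app R x)
  let : Algebra R.obj Y.obj := k.hom.hom.toRingHom.toAlgebra
  have : IsScalarTower W R.obj Y.obj :=
    IsScalarTower.of_algebraMap_eq' k.hom.hom.comp_algebraMap.symm
  have : Algebra.Smooth R.obj Y.obj := hk
  obtain ⟨R₁, ι, h1, h2, -⟩ := exists_crisW_completion p hp R Y.obj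
  obtain ⟨g, hg⟩ := exists_redHom_inverse p ι h1 h2
  obtain ⟨S₁, b, c, hc, V, j, hj, e, he⟩ := exists_crisW_cover p hp S (redHom p k.hom.hom)
    (smooth_redFlat p hk) (fun q => mem_range_comap_redFlat (f := k) p (hs _ (by
      change Ideal.Quotient.mk _ _ ∈ q.asIdeal
      rw [map_natCast, natCast_quotient_eq_zero]
      exact zero_mem _))) f.hom.hom
  have : Algebra.Smooth W (H ⊗[W] H) := Algebra.Smooth.comp W H (H ⊗[W] H)
  obtain ⟨R₀, ι₀, h3, -, lift₀⟩ := exists_crisW_completion p hp ⟨CommAlgCat.of W W, hW⟩ (H ⊗[W] H)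
  let v : Pt W H R₀.obj × Pt W H R₀.obj :=
    (toConv (ι₀.comp Algebra.TensorProduct.includeLeft),
      toConv (ι₀.comp Algebra.TensorProduct.includeRight))
  -- The classifying map of the pair `y` that represents the section over `R₁`.
  obtain ⟨a, ha⟩ := lift₀ R₁
    (Algebra.TensorProduct.productMap (ι.comp y.1.ofConv) (ι.comp y.2.ofConv))
  have hav : pairMap a v = pairMap ι y := by
    apply Prod.ext
    · apply WithConv.ofConv_injective
      ext z
      exact (ha _).trans (Algebra.TensorProduct.productMap_left_apply _ _ z)
    · apply WithConv.ofConv_injective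
      ext z
      exact (ha _).trans (Algebra.TensorProduct.productMap_right_apply _ _ z)
  have : IsAdicComplete (Ideal.span {(p : S₁.obj)}) S₁.obj := S₁.property.2.1
  -- The composite from `H ⊗ H` to the reduction of `S₁` lifts to `S₁`, and then extends to the
  -- completion `R₀` as `d`.
  obtain ⟨δ, hδ⟩ := Algebra.FormallySmooth.exists_mkₐ_comp_eq_of_isAdicComplete
    (((c.comp g).comp (redHom p a)).comp ((Ideal.Quotient.mkₐ W _).comp ι₀))
  obtain ⟨d, hd⟩ := lift₀ S₁ δ
  let hom {A B : CrisW.{u} p W} (q : A.obj →ₐ[W] B.obj) : A ⟶ B :=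
    ObjectProperty.homMk (CommAlgCat.ofHom q)
  let cc : (redCris p W).obj R₁ ⟶ (redCris p W).obj S₁ :=
    ObjectProperty.homMk (CommAlgCat.ofHom (c.comp g))
  have hcd (z : R₀.obj) :
      c (g (redHom p a (Ideal.Quotient.mk (Ideal.span {(p : R₀.obj)}) z))) =
        redHom p d (Ideal.Quotient.mk (Ideal.span {(p : R₀.obj)}) z) := by
    obtain ⟨w, hw⟩ := h3 z
    rw [Ideal.Quotient.eq.mpr hw]
    refine (DFunLike.congr_fun hδ w).symm.trans ?_
    exact congrArg (Ideal.Quotient.mk (Ideal.span {(p : S₁.obj)})) (hd w).symm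
  refine naturality_of_lift η (hom (ι.comp k.hom.hom)) (hom b) (hom a) (hom d) f cc ?_ ?_ x
    (zipClass p μ (A := (redFlat p W).obj ((crisWIncl p W).obj R₀))
      (pairMap (Ideal.Quotient.mkₐ W (Ideal.span {(p : R₀.obj)})) v)) ?_ ?_
  · ext z
    obtain ⟨z, rfl⟩ := Ideal.Quotient.mk_surjective z
    refine (congrArg c (hg (Ideal.Quotient.mk (Ideal.span {(p : Y.obj)})
      (k.hom.hom z)))).trans ?_
    exact DFunLike.congr_fun hc (Ideal.Quotient.mk (Ideal.span {(p : R.obj)}) z)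
  · ext z
    obtain ⟨z, rfl⟩ := Ideal.Quotient.mk_surjective z
    exact hcd z
  · let m : (redFlat p W).obj Y ⟶ (redFlat p W).obj ((crisWIncl p W).obj R₁) :=
      ObjectProperty.homMk (CommAlgCat.ofHom (redHom p ι))
    have hm : (redFlat p W).map ((crisWIncl p W).map (hom (ι.comp k.hom.hom))) =
        (redFlat p W).map k ≫ m := by
      ext t
      obtain ⟨t, rfl⟩ := Ideal.Quotient.mk_surjective t
      rfl
    have key (t : (zipSheaf p μ).obj ((redFlat p W).obj ((crisWIncl p W).obj R))) :
        (zipSheaf p μ).map ((redFlat p W).map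
          ((crisWIncl p W).map (hom (ι.comp k.hom.hom)))) t =
        (zipSheaf p μ).map m ((zipSheaf p μ).map ((redFlat p W).map k) t) := by
      rw [hm, Functor.map_comp_apply]
    refine (zipClass_map p μ ((redFlat p W).map ((crisWIncl p W).map (hom a))) _).trans ?_
    refine Eq.trans ?_ (key _).symm
    refine Eq.trans ?_ (congrArg ((zipSheaf p μ).map m) hy).symm
    refine Eq.trans ?_ (zipClass_map p μ m _).symm
    exact congrArg (fun t => zipClass p μ (A := (redFlat p W).obj ((crisWIncl p W).obj R₁))
      (pairMap (Ideal.Quotient.mkₐ W (Ideal.span {(p : R₁.obj)})) t)) hav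
  -- Restriction to `S₁` is injective on sections because the flat cover given by `V` factors
  -- through the reduction of `S₁`.
  · intro z z' hzz
    refine (isFppfSheaf_zipSheaf p μ).eq_of_cover hj fun _ => ?_
    let m : (redFlat p W).obj ((crisWIncl p W).obj S₁) ⟶ (redFlat p W).obj V :=
      ObjectProperty.homMk (CommAlgCat.ofHom e)
    have hm : (redFlat p W).map j = (redFlat p W).map ((crisWIncl p W).map (hom b)) ≫ m := by
      ext t
      exact (DFunLike.congr_fun he t).symm
    have key (t : (zipSheaf p μ).obj ((redFlat p W).obj ((crisWIncl p W).obj S))) :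
        (zipSheaf p μ).map ((redFlat p W).map j) t = (zipSheaf p μ).map m
          ((zipSheaf p μ).map ((redFlat p W).map ((crisWIncl p W).map (hom b))) t) := by
      rw [hm, Functor.map_comp_apply]
    exact (key z).trans ((congrArg ((zipSheaf p μ).map m) hzz).trans (key z').symm)

end ZipNaturality

end

end CrisZip

namespace CrisZip

noncomputable section

/-! ### The sheaf of reduction -/

section Reduction

variable (p : ℕ) {W H : Type u} [CommRing W] [CommRing H] [HopfAlgebra W H]
  (μ : H →ₐc[W] W[T;T⁻¹])

/-- On crystalline algebras the two double quotients agree. -/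
theorem exists_crisSheaf_iso_loopSheaf [IsNoetherianRing W] [Algebra.Smooth W H]
    (hp : (p : W) ∈ nonZeroDivisors W) :
    ∃ Ψ : crisWIncl p W ⋙ crisSheaf p μ ≅ redCris p W ⋙ crisKappaIncl p W ⋙ loopSheaf p μ,
      ∀ (R : CrisW.{u} p W) (g h : Pt W H R.obj),
        Ψ.hom.app R (toSheafification _ _ (crisClass p μ ((crisWIncl p W).obj R) g h)) =
          toSheafification (kappaTop p W) (loopPresheaf p μ)
            (R := (crisKappaIncl p W).obj ((redCris p W).obj R))
            (loopClass p μ _ (Pt.map H (tConst W _) (ptRed p H R.obj g))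
              (Pt.map H (tConst W _) (ptRed p H R.obj h))) := by
  obtain ⟨Φ, hΦ⟩ := exists_crisSheaf_iso p μ hp
  obtain ⟨Θ, hΘ⟩ := exists_zipSheaf_iso_loopSheaf p μ
  refine ⟨Functor.isoWhiskerLeft (crisWIncl p W) Φ ≪≫
    Functor.isoWhiskerLeft (redCris p W ⋙ crisKappaIncl p W) Θ, fun R g h => ?_⟩
  refine (congrArg (Θ.hom.app ((redFlat p W).obj ((crisWIncl p W).obj R)))
    (hΦ ((crisWIncl p W).obj R) g h)).trans ?_
  refine (hΘ ((redFlat p W).obj ((crisWIncl p W).obj R)) _ _).trans ?_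
  exact congrArg (fun y => toSheafification (kappaTop p W) (loopPresheaf p μ)
    (R := (redFlat p W).obj ((crisWIncl p W).obj R))
    (loopClass p μ _ (Pt.map H (tConst W _) y) (Pt.map H (tConst W _) (ptRed p H R.obj h))))
    (inv_inv (ptRed p H R.obj g))

/-- Uniqueness is proved for the zip sheaf, where sections have explicit local representatives, and
carried over to the loop sheaf. Naturality for all homomorphisms of reductions suffices because
reduction is essentially surjective. -/
theorem isReductionBy_loopSheaf [Fact p.Prime] [IsDomain W] [IsDiscreteValuationRing W]
    [Algebra.Smooth W H] (hp : Irreducible (p : W)) (hW : IsCrisW p W (CommAlgCat.of W W)) :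
    IsReductionBy (redCris p W) (crisWIncl p W ⋙ crisSheaf p μ)
      (crisKappaIncl p W ⋙ loopSheaf p μ) := by
  obtain ⟨Ψ, -⟩ := exists_crisSheaf_iso_loopSheaf p μ (mem_nonZeroDivisors_of_ne_zero hp.ne_zero)
  obtain ⟨Θ, -⟩ := exists_zipSheaf_iso_loopSheaf p μ
  refine ⟨⟨Ψ⟩, fun G' ⟨ε⟩ => ?_⟩
  let η : redCris p W ⋙ G' ≅ redCris p W ⋙ crisKappaIncl p W ⋙ zipSheaf p μ :=
    ε.symm ≪≫ Ψ ≪≫ Functor.isoWhiskerLeft (redCris p W ⋙ crisKappaIncl p W) Θ.symm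
  obtain ⟨e⟩ := nonempty_iso_of_naturality η fun f x => zip_naturality p μ hp hW η f x
  exact ⟨e ≪≫ Functor.isoWhiskerLeft (crisKappaIncl p W) Θ⟩

end Reduction

/-- The ring of Witt vectors of a perfect field is crystalline. -/
lemma isCrisW_wittVector (p : ℕ) [Fact p.Prime] (κ : Type u) [Field κ] [CharP κ p]
    [PerfectRing κ p] :
    IsCrisW p (WittVector p κ) (CommAlgCat.of (WittVector p κ) (WittVector p κ)) := by
  have key (x : WittVector p κ) :
      WittVector.frobenius x - x ^ p ∈ Ideal.span {(p : WittVector p κ)} := by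
    rw [← WittVector.ker_constantCoeff, RingHom.mem_ker, map_sub, map_pow, sub_eq_zero]
    exact WittVector.coeff_frobenius_charP p x 0
  exact ⟨inferInstanceAs (Module.Flat (WittVector p κ) (WittVector p κ)),
    WittVector.isAdicCompleteIdealSpanP, WittVector.frobenius, key⟩

end

end CrisZip

theorem mainTheorem2 (p : ℕ) [Fact p.Prime] (κ : Type u) [Field κ] [Finite κ] [CharP κ p]
    (H : Type u) [CommRing H] [HopfAlgebra (WittVector p κ) H] [Algebra.Smooth (WittVector p κ) H]
    (μ : H →ₐc[WittVector p κ] LaurentPolynomial (WittVector p κ)) :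
    (∃ β : CrisZip.crisPresheaf p μ ⟶
          CrisZip.redFlat p (WittVector p κ) ⋙ CrisZip.zipPresheaf p μ,
      (∀ (R : CrisZip.FlatAlg (WittVector p κ)) (g h : CrisZip.Pt (WittVector p κ) H R.obj),
        β.app R (CrisZip.crisClass p μ R g h) =
          CrisZip.ZipQuot.mk μ ((CrisZip.ptRed p H R.obj g)⁻¹, CrisZip.ptRed p H R.obj h)) ∧
      (∀ R : CrisZip.FlatAlg (WittVector p κ), Function.Injective (β.app R)) ∧
      (∀ R : CrisZip.FlatAlg (WittVector p κ), IsAdicComplete (Ideal.span {(p : R.obj)}) R.obj →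
        Function.Bijective (β.app R))) ∧
    (∃ Φ : CrisZip.crisSheaf p μ ≅ CrisZip.redFlat p (WittVector p κ) ⋙ CrisZip.zipSheaf p μ,
      ∀ (R : CrisZip.FlatAlg (WittVector p κ)) (g h : CrisZip.Pt (WittVector p κ) H R.obj),
        Φ.hom.app R (CrisZip.toSheafification _ _ (CrisZip.crisClass p μ R g h)) =
          CrisZip.toSheafification (CrisZip.kappaTop p (WittVector p κ)) (CrisZip.zipPresheaf p μ)
            (R := (CrisZip.redFlat p (WittVector p κ)).obj R)
            (CrisZip.ZipQuot.mk μ ((CrisZip.ptRed p H R.obj g)⁻¹, CrisZip.ptRed p H R.obj h))) ∧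
    (∃ Ψ : CrisZip.crisWIncl p (WittVector p κ) ⋙ CrisZip.crisSheaf p μ ≅
          CrisZip.redCris p (WittVector p κ) ⋙
            CrisZip.crisKappaIncl p (WittVector p κ) ⋙ CrisZip.loopSheaf p μ,
      ∀ (R : CrisZip.CrisW p (WittVector p κ)) (g h : CrisZip.Pt (WittVector p κ) H R.obj),
        Ψ.hom.app R (CrisZip.toSheafification _ _
            (CrisZip.crisClass p μ ((CrisZip.crisWIncl p (WittVector p κ)).obj R) g h)) =
          CrisZip.toSheafification (CrisZip.kappaTop p (WittVector p κ)) (CrisZip.loopPresheaf p μ)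
            (R := (CrisZip.crisKappaIncl p (WittVector p κ)).obj
              ((CrisZip.redCris p (WittVector p κ)).obj R))
            (CrisZip.loopClass p μ _
              (CrisZip.Pt.map H (CrisZip.tConst (WittVector p κ) _) (CrisZip.ptRed p H R.obj g))
              (CrisZip.Pt.map H (CrisZip.tConst (WittVector p κ) _)
                (CrisZip.ptRed p H R.obj h)))) ∧
    CrisZip.IsReductionBy (CrisZip.redCris p (WittVector p κ))
      (CrisZip.crisWIncl p (WittVector p κ) ⋙ CrisZip.crisSheaf p μ)
      (CrisZip.crisKappaIncl p (WittVector p κ) ⋙ CrisZip.loopSheaf p μ) := by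
  have hp : Irreducible (p : WittVector p κ) := WittVector.irreducible p
  have hp' := mem_nonZeroDivisors_of_ne_zero hp.ne_zero
  exact ⟨⟨CrisZip.crisToZip p μ hp', CrisZip.crisToZip_crisClass p μ hp',
      CrisZip.crisToZip_injective p μ hp', CrisZip.crisToZip_bijective p μ hp'⟩,
    CrisZip.exists_crisSheaf_iso p μ hp', CrisZip.exists_crisSheaf_iso_loopSheaf p μ hp',
    CrisZip.isReductionBy_loopSheaf p μ hp (CrisZip.isCrisW_wittVector p κ)⟩
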